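/- Manifolds are smooth, finite-dimensional, without boundary and, unless said otherwise, Hausdorff and second countable. An *almost contact metric structure* $(g,\xi,\eta,\varphi)$ on a manifold $N$ of dimension $2k+1$ consists of a Riemannian metric $g$, a unit vector field $\xi$, the dual 1-form $\eta=g(\xi,\cdot)$ and an endomorphism $\varphi$ of $TN$ with $\varphi(\xi)=0$, $\varphi^2=-1+\eta\otimes\xi$, $g(\varphi X,\varphi Y)=g(X,Y)-\eta(X)\eta(Y)$. It is an *ST structure* (Sasaki with torsion) if it is normal, i.e. $$[\varphi X,\varphi Y]+\varphi^2[X,Y]-\varphi[\varphi X,Y]-\varphi[X,\varphi Y]+d\eta(X,Y)\,\xi=0$$ for all vector fields $X,Y$, where $d\eta(X,Y)=X\eta(Y)-Y\eta(X)-\eta([X,Y])$, and $\xi$ is a Killing field of $g$. It is *regular* if the foliation of $N$ by the maximal integral curves of $\xi$ is regular: every point has a foliated chart which each leaf meets in at most one plaque. A *Hermitian structure* $(h,J)$ on a manifold is an almost complex structure $J$ with vanishing Nijenhuis tensor together with a $J$-invariant Riemannian metric $h$; a real 2-form $\sigma$ is of type $(1,1)$ if $\sigma(JX,JY)=\sigma(X,Y)$.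 For a map $\pi\colon N\to M$, an ST structure $(g,\xi,\eta,\varphi)$ on $N$, a Hermitian structure $(h,J)$ on $M$ and a 2-form $\sigma$ on $M$, consider the conditions: (i) $\pi\colon(N,g)\to(M,h)$ is a (smooth, surjective) Riemannian submersion; (ii) $\pi_*\circ\varphi=J\circ\pi_*$; (iii) $\frac1{2\pi}d\eta=\pi^*\sigma$, where $\frac{1}{2\pi}$ is the numerical factor. **Proposition.** (1) Let $(N,g,\xi,\eta,\varphi)$ be a regular ST manifold of dimension $2k+1$, let $M$ be its space of leaves with the quotient topology, and $\pi\colon N\to M$ the projection. Then $M$ is second countable and is a $2k$-dimensional smooth manifold (possibly non-Hausdorff) for which $\pi$ is a smooth submersion; and for every such smooth structure, $M$ carries a unique Hermitian structure $(h,J)$ and a unique closed $(1,1)$-form $\sigma$ such that (i), (ii) and (iii) hold. (2) Conversely, let $(M,h,J)$ be a Hermitian manifold with a closed $(1,1)$-form $\sigma$, let $\pi\colon N\to M$ be a smooth principal circle bundle, with fundamental vector field $\xi_p=\frac{d}{dt}\big|_{t=0}e^{it}\cdot p$, and let $\eta$ be a connection form on $N$ (a circle-invariant 1-form with $\eta(\xi)=1$)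 satisfying (iii). (The class of $\sigma$ is then automatically integral: up to the sign convention it is the real first Chern class of the bundle.) Then $N$ has a unique ST structure $(g,\xi,\eta,\varphi)$, with this $\xi$ and this $\eta$, satisfying (i), (ii) and (iii). (3) Every ST manifold is locally of this form. That is, each point of a $(2k+1)$-dimensional ST manifold $N$ has an open neighbourhood which is isomorphic, by a diffeomorphism preserving $(g,\xi,\eta,\varphi)$, to an open subset of a trivial principal circle bundle $U\times S^1\to U$ over an open set $U\subseteq\mathbb R^{2k}$, where $U\times S^1$ carries an ST structure $(g',\xi',\eta',\varphi')$ whose $\xi'$ is the fundamental vector field, whose $\eta'$ is a connection form, and which satisfies (i), (ii) and (iii) for some Hermitian structure $(h,J)$ on $U$ and some exact (in particular closed and integral) $(1,1)$-form $\sigma$ on $U$. -/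

import Mathlib

open Set Bundle VectorField
open scoped Manifold ContDiff Topology

noncomputable section

namespace SasakiTorsion

/-! ### Local vector fields, differential forms, metrics -/

section Forms

variable {E : Type*} [NormedAddCommGroup E] [NormedSpace ℝ E]
  {H : Type*} [TopologicalSpace H] (I : ModelWithCorners ℝ E H)
  (N : Type*) [TopologicalSpace N] [ChartedSpace H N]

variable [IsManifold I ∞ N]

variable {N} in
/-- The vector field `X` is smooth at (that is, near) the point `p`. All tensorial identities below
are tested on vector fields that are smooth near the point in question, not necessarily globally. -/
def SmoothFieldAt (X : (q : N) → TangentSpace I q) (p : N) : Prop :=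
  ContMDiffAt I I.tangent ∞ (fun q => (⟨q, X q⟩ : TangentBundle I N)) p

/-- Smooth Riemannian metrics on `N`. -/
abbrev Metric : Type _ :=
  ContMDiffRiemannianMetric I ∞ E (fun p : N => TangentSpace I p)

/-- Smooth differential `1`-forms on `N`. -/
@[ext] structure OneForm where
  toFun (p : N) : TangentSpace I p →L[ℝ] ℝ
  smooth : ContMDiff I (I.prod 𝓘(ℝ, E →L[ℝ] ℝ)) ∞
    (fun p => TotalSpace.mk' (E →L[ℝ] ℝ)
      (E := fun q : N => TangentSpace I q →L[ℝ] ℝ) p (toFun p))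

/-- Smooth differential `2`-forms on `N`. -/
@[ext] structure TwoForm where
  toFun (p : N) : TangentSpace I p →L[ℝ] TangentSpace I p →L[ℝ] ℝ
  alternating (p : N) (v : TangentSpace I p) : toFun p v v = 0
  smooth : ContMDiff I (I.prod 𝓘(ℝ, E →L[ℝ] E →L[ℝ] ℝ)) ∞
    (fun p => TotalSpace.mk' (E →L[ℝ] E →L[ℝ] ℝ)
      (E := fun q : N => TangentSpace I q →L[ℝ] TangentSpace I q →L[ℝ] ℝ) p (toFun p))

/-- Smooth endomorphisms of the tangent bundle of `N`, i.e. tensor fields of type `(1,1)`. -/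
@[ext] structure EndField where
  toFun (p : N) : TangentSpace I p →L[ℝ] TangentSpace I p
  smooth : ContMDiff I (I.prod 𝓘(ℝ, E →L[ℝ] E)) ∞
    (fun p => TotalSpace.mk' (E →L[ℝ] E)
      (E := fun q : N => TangentSpace I q →L[ℝ] TangentSpace I q) p (toFun p))

variable {I N}

/-- The exterior derivative of a `1`-form,
`dα(X, Y) = X(α(Y)) - Y(α(X)) - α([X, Y])`. -/
def OneForm.d (α : OneForm I N) (X Y : (q : N) → TangentSpace I q) (p : N) : ℝ :=
  mvfderiv I (fun q => α.toFun q (Y q)) p (X p)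
    - mvfderiv I (fun q => α.toFun q (X q)) p (Y p)
    - α.toFun p (mlieBracket I X Y p)

/-- The exterior derivative of a `2`-form, `dσ(X, Y, Z) =
X(σ(Y, Z)) - Y(σ(X, Z)) + Z(σ(X, Y)) - σ([X, Y], Z) + σ([X, Z], Y) - σ([Y, Z], X)`. -/
def TwoForm.d (σ : TwoForm I N) (X Y Z : (q : N) → TangentSpace I q) (p : N) : ℝ :=
  mvfderiv I (fun q => σ.toFun q (Y q) (Z q)) p (X p)
    - mvfderiv I (fun q => σ.toFun q (X q) (Z q)) p (Y p)
    + mvfderiv I (fun q => σ.toFun q (X q) (Y q)) p (Z p)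
    - σ.toFun p (mlieBracket I X Y p) (Z p)
    + σ.toFun p (mlieBracket I X Z p) (Y p)
    - σ.toFun p (mlieBracket I Y Z p) (X p)

/-- `dσ = 0`. -/
def TwoForm.IsClosed (σ : TwoForm I N) : Prop :=
  ∀ (p : N) (X Y Z : (q : N) → TangentSpace I q),
    SmoothFieldAt I X p → SmoothFieldAt I Y p → SmoothFieldAt I Z p → σ.d X Y Z p = 0

/-- `σ = dα` for some `1`-form `α`. -/
def TwoForm.IsExact (σ : TwoForm I N) : Prop :=
  ∃ α : OneForm I N, ∀ (p : N) (X Y : (q : N) → TangentSpace I q),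
    SmoothFieldAt I X p → SmoothFieldAt I Y p → α.d X Y p = σ.toFun p (X p) (Y p)

/-- `ξ` is a Killing vector field of `g`: `(L_ξ g)(X, Y) = 0` for all `X`, `Y`, that is,
`ξ(g(X, Y)) = g([ξ, X], Y) + g(X, [ξ, Y])`. -/
def IsKilling (g : Metric I N) (ξ : (q : N) → TangentSpace I q) : Prop :=
  ∀ (p : N) (X Y : (q : N) → TangentSpace I q), SmoothFieldAt I X p → SmoothFieldAt I Y p →
    mvfderiv I (fun q => g.inner q (X q) (Y q)) p (ξ p)
      = g.inner p (mlieBracket I ξ X p) (Y p) + g.inner p (X p) (mlieBracket I ξ Y p)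

/-- The Nijenhuis bracket
`[A X, A Y] + A²[X, Y] - A[A X, Y] - A[X, A Y]` of an endomorphism field `A`. -/
def EndField.nijenhuis (A : EndField I N) (X Y : (q : N) → TangentSpace I q) (p : N) :
    TangentSpace I p :=
  mlieBracket I (fun q => A.toFun q (X q)) (fun q => A.toFun q (Y q)) p
    + A.toFun p (A.toFun p (mlieBracket I X Y p))
    - A.toFun p (mlieBracket I (fun q => A.toFun q (X q)) Y p)
    - A.toFun p (mlieBracket I X (fun q => A.toFun q (Y q)) p)

end Forms

/-! ### Almost contact metric, ST and Hermitian structures -/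

section Structures

variable {E : Type*} [NormedAddCommGroup E] [NormedSpace ℝ E]
  {H : Type*} [TopologicalSpace H] (I : ModelWithCorners ℝ E H)
  (N : Type*) [TopologicalSpace N] [ChartedSpace H N] [IsManifold I ∞ N]

/-- An almost contact metric structure `(g, ξ, η, φ)` on `N`. -/
@[ext] structure AlmostContactMetric where
  g : Metric I N
  ξ : (p : N) → TangentSpace I p
  η : OneForm I N
  φ : EndField I N
  smooth_ξ : ContMDiff I I.tangent ∞ (fun p => (⟨p, ξ p⟩ : TangentBundle I N))
  unit (p : N) : g.inner p (ξ p) (ξ p) = 1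
  dual (p : N) (v : TangentSpace I p) : η.toFun p v = g.inner p (ξ p) v
  φ_ξ (p : N) : φ.toFun p (ξ p) = 0
  φ_sq (p : N) (v : TangentSpace I p) :
    φ.toFun p (φ.toFun p v) = - v + η.toFun p v • ξ p
  compat (p : N) (v w : TangentSpace I p) :
    g.inner p (φ.toFun p v) (φ.toFun p w) = g.inner p v w - η.toFun p v * η.toFun p w

variable {I N} in
/-- The Sasaki-Hatakeyama tensor
`S(X, Y) = [φ X, φ Y] + φ²[X, Y] - φ[φ X, Y] - φ[X, φ Y] + dη(X, Y) ξ`. -/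
def AlmostContactMetric.sasakiHatakeyama (A : AlmostContactMetric I N)
    (X Y : (q : N) → TangentSpace I q) (p : N) : TangentSpace I p :=
  A.φ.nijenhuis X Y p + A.η.d X Y p • A.ξ p

/-- An ST structure (Sasaki with torsion): a normal almost contact metric structure whose
Reeb vector field is Killing. -/
@[ext] structure STStructure extends AlmostContactMetric I N where
  normal (p : N) (X Y : (q : N) → TangentSpace I q) :
    SmoothFieldAt I X p → SmoothFieldAt I Y p →
      toAlmostContactMetric.sasakiHatakeyama X Y p = 0
  killing : IsKilling g ξ

/-- A Hermitian structure `(h, J)`: an integrable almost complex structure `J` with a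
`J`-invariant Riemannian metric `h`. -/
@[ext] structure HermitianStructure where
  h : Metric I N
  J : EndField I N
  J_sq (p : N) (v : TangentSpace I p) : J.toFun p (J.toFun p v) = - v
  compat (p : N) (v w : TangentSpace I p) :
    h.inner p (J.toFun p v) (J.toFun p w) = h.inner p v w
  integrable (p : N) (X Y : (q : N) → TangentSpace I q) :
    SmoothFieldAt I X p → SmoothFieldAt I Y p → J.nijenhuis X Y p = 0

variable {I N} in
/-- The real `2`-form `σ` is of type `(1,1)` with respect to `J`. -/
def TwoForm.IsOneOne (σ : TwoForm I N) (J : EndField I N) : Prop :=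
  ∀ (p : N) (v w : TangentSpace I p),
    σ.toFun p (J.toFun p v) (J.toFun p w) = σ.toFun p v w

end Structures

/-! ### Submersions -/

section Submersions

variable {E : Type*} [NormedAddCommGroup E] [NormedSpace ℝ E]
  {H : Type*} [TopologicalSpace H] (I : ModelWithCorners ℝ E H)
  {N : Type*} [TopologicalSpace N] [ChartedSpace H N]
  {E' : Type*} [NormedAddCommGroup E'] [NormedSpace ℝ E']
  {H' : Type*} [TopologicalSpace H'] (I' : ModelWithCorners ℝ E' H')
  {M : Type*} [TopologicalSpace M] [ChartedSpace H' M]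

/-- A smooth surjective submersion. -/
def IsSurjSubmersion (pr : N → M) : Prop :=
  ContMDiff I I' ∞ pr ∧ Function.Surjective pr ∧
    ∀ p, Function.Surjective (mfderiv I I' pr p)

variable {I I'} [IsManifold I ∞ N] [IsManifold I' ∞ M]

/-- A Riemannian submersion: a surjective submersion whose differential is isometric on the
orthogonal complement of its kernel. -/
def IsRiemannianSubmersion (g : Metric I N) (h : Metric I' M) (pr : N → M) : Prop :=
  IsSurjSubmersion I I' pr ∧
    ∀ (p : N) (v w : TangentSpace I p),
      (∀ u : TangentSpace I p, mfderiv I I' pr p u = 0 → g.inner p v u = 0) →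
      (∀ u : TangentSpace I p, mfderiv I I' pr p u = 0 → g.inner p w u = 0) →
      h.inner (pr p) (mfderiv I I' pr p v) (mfderiv I I' pr p w) = g.inner p v w

/-- `(1 / 2π) dη = pr^* σ`. -/
def HasCurvature (η : OneForm I N) (σ : TwoForm I' M) (pr : N → M) : Prop :=
  ∀ (p : N) (X Y : (q : N) → TangentSpace I q), SmoothFieldAt I X p → SmoothFieldAt I Y p →
    (1 / (2 * Real.pi)) * η.d X Y p
      = σ.toFun (pr p) (mfderiv I I' pr p (X p)) (mfderiv I I' pr p (Y p))

/-- The three conditions relating an ST structure upstairs to a Hermitian structure and a `2`-form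
downstairs: `pr` is a Riemannian submersion, `pr_* ∘ φ = J ∘ pr_*`, and `(1 / 2π) dη = pr^* σ`. -/
structure IsCompatible (S : STStructure I N) (K : HermitianStructure I' M) (σ : TwoForm I' M)
    (pr : N → M) : Prop where
  riemannian : IsRiemannianSubmersion S.g K.h pr
  intertwines (p : N) (v : TangentSpace I p) :
    mfderiv I I' pr p (S.φ.toFun p v) = K.J.toFun (pr p) (mfderiv I I' pr p v)
  curvature : HasCurvature S.η σ pr

end Submersions

/-! ### The foliation by the orbits of a vector field -/

section Leaves

variable {E : Type*} [NormedAddCommGroup E] [NormedSpace ℝ E]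
  {H : Type*} [TopologicalSpace H] (I : ModelWithCorners ℝ E H)
  {N : Type*} [TopologicalSpace N] [ChartedSpace H N]

/-- `p` and `q` lie on a common integral curve of `V`, defined on an open interval. -/
def OnIntegralCurve (V : (p : N) → TangentSpace I p) (p q : N) : Prop :=
  ∃ (γ : ℝ → N) (a b : ℝ), IsMIntegralCurveOn γ V (Ioo a b) ∧
    ∃ s ∈ Ioo a b, ∃ t ∈ Ioo a b, γ s = p ∧ γ t = q

/-- The space of leaves of the foliation by the maximal integral curves of `V`: the quotient of `N`
by the equivalence relation generated by lying on a common integral curve. -/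
def LeafSpace (V : (p : N) → TangentSpace I p) : Type _ :=
  Quot (OnIntegralCurve I V)

/-- The leaf space carries the quotient topology. -/
instance (V : (p : N) → TangentSpace I p) : TopologicalSpace (LeafSpace I V) :=
  inferInstanceAs (TopologicalSpace (Quot (OnIntegralCurve I V)))

/-- The projection onto the leaf space. -/
def leafProj (V : (p : N) → TangentSpace I p) (p : N) : LeafSpace I V :=
  Quot.mk _ p

/-- The one-dimensional foliation by the orbits of `V` on an `(m + 1)`-dimensional manifold is
regular: every point has a foliated chart `e : U → W × (a, b)` (the plaques `{w} × (a, b)` are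
tangent to `V`) such that each leaf meets `U` in at most one plaque. -/
def IsRegularFoliation (m : ℕ) (V : (p : N) → TangentSpace I p) : Prop :=
  ∀ p : N, ∃ e : OpenPartialHomeomorph N (EuclideanSpace ℝ (Fin m) × ℝ),
    p ∈ e.source ∧
    ContMDiffOn I 𝓘(ℝ, EuclideanSpace ℝ (Fin m) × ℝ) ∞ e e.source ∧
    ContMDiffOn 𝓘(ℝ, EuclideanSpace ℝ (Fin m) × ℝ) I ∞ e.symm e.target ∧
    (∃ (W : Set (EuclideanSpace ℝ (Fin m))) (a b : ℝ), e.target = W ×ˢ Ioo a b) ∧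
    (∀ q ∈ e.source,
      mfderiv I 𝓘(ℝ, EuclideanSpace ℝ (Fin m)) (fun x => (e x).1) q (V q) = 0) ∧
    (∀ q ∈ e.source, ∀ q' ∈ e.source, leafProj I V q = leafProj I V q' → (e q).1 = (e q').1)

end Leaves

/-! ### Principal circle bundles -/

section CircleBundles

variable {E : Type*} [NormedAddCommGroup E] [NormedSpace ℝ E]
  {H : Type*} [TopologicalSpace H] (I : ModelWithCorners ℝ E H)
  (P : Type*) [TopologicalSpace P] [ChartedSpace H P]
  {E' : Type*} [NormedAddCommGroup E'] [NormedSpace ℝ E']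
  {H' : Type*} [TopologicalSpace H'] (I' : ModelWithCorners ℝ E' H')
  (M : Type*) [TopologicalSpace M] [ChartedSpace H' M]

/-- A smooth principal circle bundle `P → M`. -/
structure CircleBundle where
  proj : P → M
  act : Circle → P → P
  one_act (p : P) : act 1 p = p
  mul_act (z w : Circle) (p : P) : act (z * w) p = act z (act w p)
  smooth_act : ContMDiff ((𝓡 1).prod I) I ∞ (fun x : Circle × P => act x.1 x.2)
  proj_act (z : Circle) (p : P) : proj (act z p) = proj p
  locally_trivial (x : M) : ∃ e : Trivialization Circle proj,
    x ∈ e.baseSet ∧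
    ContMDiffOn I (I'.prod (𝓡 1)) ∞ e e.source ∧
    ContMDiffOn (I'.prod (𝓡 1)) I ∞ e.toOpenPartialHomeomorph.symm e.target ∧
    ∀ p ∈ e.source, ∀ z : Circle, e (act z p) = ((e p).1, z * (e p).2)

variable {I P I' M}

/-- The fundamental vector field of the circle action, `ξ_p = d/dt|_{t=0} e^{it} p`. -/
def CircleBundle.fundamental (B : CircleBundle I P I' M) (p : P) : TangentSpace I p :=
  mfderiv 𝓘(ℝ, ℝ) I (fun t : ℝ => B.act (Circle.exp t) p) 0 (1 : ℝ)

/-- `η` is a connection form: it is invariant under the circle action and equals `1` on the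
fundamental vector field. -/
def CircleBundle.IsConnection [IsManifold I ∞ P] (B : CircleBundle I P I' M) (η : OneForm I P) :
    Prop :=
  (∀ p, η.toFun p (B.fundamental p) = 1) ∧
    ∀ (z : Circle) (p : P) (v : TangentSpace I p),
      η.toFun (B.act z p) (mfderiv I I (B.act z) p v) = η.toFun p v

end CircleBundles

/-! ### Local isomorphisms -/

section LocalIso

variable {E : Type*} [NormedAddCommGroup E] [NormedSpace ℝ E]
  {H : Type*} [TopologicalSpace H] {I : ModelWithCorners ℝ E H}
  {N : Type*} [TopologicalSpace N] [ChartedSpace H N] [IsManifold I ∞ N]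
  {E' : Type*} [NormedAddCommGroup E'] [NormedSpace ℝ E']
  {H' : Type*} [TopologicalSpace H'] {I' : ModelWithCorners ℝ E' H'}
  {N' : Type*} [TopologicalSpace N'] [ChartedSpace H' N'] [IsManifold I' ∞ N']

/-- `e` is a diffeomorphism from an open subset of `N` onto an open subset of `N'` that
identifies the ST structures `S` and `S'`. -/
structure IsLocalSTIso (S : STStructure I N) (S' : STStructure I' N')
    (e : OpenPartialHomeomorph N N') : Prop where
  smooth : ContMDiffOn I I' ∞ e e.source
  smooth_symm : ContMDiffOn I' I ∞ e.symm e.target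
  map_g : ∀ p ∈ e.source, ∀ v w : TangentSpace I p,
    S'.g.inner (e p) (mfderiv I I' e p v) (mfderiv I I' e p w) = S.g.inner p v w
  map_ξ : ∀ p ∈ e.source, mfderiv I I' e p (S.ξ p) = S'.ξ (e p)
  map_η : ∀ p ∈ e.source, ∀ v : TangentSpace I p,
    S'.η.toFun (e p) (mfderiv I I' e p v) = S.η.toFun p v
  map_φ : ∀ p ∈ e.source, ∀ v : TangentSpace I p,
    mfderiv I I' e p (S.φ.toFun p v) = S'.φ.toFun (e p) (mfderiv I I' e p v)

end LocalIso

end SasakiTorsion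

end

noncomputable section

namespace SasakiTorsion

set_option linter.unusedSectionVars false

section Calculus

variable {E : Type*} [NormedAddCommGroup E] [NormedSpace ℝ E] [FiniteDimensional ℝ E]
  {H : Type*} [TopologicalSpace H] {I : ModelWithCorners ℝ E H}
  {N : Type*} [TopologicalSpace N] [ChartedSpace H N] [IsManifold I ∞ N]
  {F : Type*} [NormedAddCommGroup F] [NormedSpace ℝ F]

instance isManifold_infty_add_one : IsManifold I (((⊤ : ℕ∞) : WithTop ℕ∞) + 1) N :=
  IsManifold.of_le (n := ∞) (by simp)

instance isManifold_minSmoothness_two : IsManifold I (minSmoothness ℝ 2) N := by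
  rw [minSmoothness_of_isRCLikeNormedField]; infer_instance

instance isManifold_minSmoothness_three : IsManifold I (minSmoothness ℝ 3) N := by
  rw [minSmoothness_of_isRCLikeNormedField]; infer_instance

lemma eventually_mdifferentiableAt {E' : Type*} [NormedAddCommGroup E'] [NormedSpace ℝ E']
    {H' : Type*} [TopologicalSpace H'] {I' : ModelWithCorners ℝ E' H'} {M : Type*}
    [TopologicalSpace M] [ChartedSpace H' M] [IsManifold I' ∞ M] {f : N → M} {p : N} {n : WithTop ℕ∞}
    (hf : ContMDiffAt I I' n f p) (hn : 1 ≤ n) : ∀ᶠ q in 𝓝 p, MDifferentiableAt I I' f q :=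
  ((contMDiffAt_iff_contMDiffAt_nhds (n := 1) (by simp)).1 (hf.of_le hn)).mono
    fun _ hq => hq.mdifferentiableAt (by simp)

namespace SmoothFieldAt

variable {X Y : (q : N) → TangentSpace I q} {p : N}

lemma mdiff (hX : SmoothFieldAt I X p) : MDiffAt (T% X) p :=
  hX.mdifferentiableAt (by simp)

lemma of_le (hX : SmoothFieldAt I X p) (n : ℕ) : CMDiffAt n (T% X) p :=
  ContMDiffAt.of_le hX (by exact_mod_cast le_top)

lemma eventually_mdiff (hX : SmoothFieldAt I X p) : ∀ᶠ q in 𝓝 p, MDiffAt (T% X) q :=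
  (eventually_mdifferentiableAt (n := ∞) hX (by simp))

lemma add (hX : SmoothFieldAt I X p) (hY : SmoothFieldAt I Y p) : SmoothFieldAt I (X + Y) p :=
  ContMDiffAt.add_section hX hY

lemma smul {f : N → ℝ} (hf : ContMDiffAt I 𝓘(ℝ, ℝ) ∞ f p) (hX : SmoothFieldAt I X p) :
    SmoothFieldAt I (f • X) p :=
  ContMDiffAt.smul_section hf hX

lemma bracket (hX : SmoothFieldAt I X p) (hY : SmoothFieldAt I Y p) :
    SmoothFieldAt I (mlieBracket I X Y) p :=
  ContMDiffAt.mlieBracket_vectorField (m := ⊤) (n := ⊤) hX hY (by simp)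

lemma congr (hX : SmoothFieldAt I X p) (h : ∀ᶠ q in 𝓝 p, Y q = X q) : SmoothFieldAt I Y p :=
  ContMDiffAt.congr_of_eventuallyEq hX (h.mono fun q hq => by simp only [hq])

end SmoothFieldAt

lemma smoothFieldAt_extend {p : N} (v : TangentSpace I p) :
    SmoothFieldAt I (FiberBundle.extend E v) p :=
  FiberBundle.contMDiffAt_extend I E v

lemma mvfderiv_congr {u v : N → F} {p : N} (h : u =ᶠ[𝓝 p] v) :
    mvfderiv I u p = mvfderiv I v p := by
  have h0 := h.mfderiv_eq (I := I) (I' := 𝓘(ℝ, F))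
  ext w
  exact congrArg (fun A : TangentSpace I p →L[ℝ] F => A w) h0

/-- The derivative of a vector valued function along a vector field. -/
lemma contMDiffAt_mvfderiv {u : N → F} {X : (q : N) → TangentSpace I q} {p : N} {m n : WithTop ℕ∞}
    (hu : ContMDiffAt I 𝓘(ℝ, F) n u p) (hX : CMDiffAt m (T% X) p) (hmn : m + 1 ≤ n)
    [IsManifold I m N] :
    ContMDiffAt I 𝓘(ℝ, F) m (fun q => mvfderiv I u q (X q)) p := by
  have h1 := hu.mfderiv_const hmn
  have h2 := ContMDiffAt.clm_apply_of_inCoordinates h1 hX (hu.of_le (le_trans le_self_add hmn))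
  exact (contMDiff_snd_tangentBundle_modelSpace F 𝓘(ℝ, F)).contMDiffAt.comp p h2

lemma SmoothFieldAt.mvfderiv {u : N → F} {X : (q : N) → TangentSpace I q} {p : N}
    (hu : ContMDiffAt I 𝓘(ℝ, F) ∞ u p) (hX : SmoothFieldAt I X p) :
    ContMDiffAt I 𝓘(ℝ, F) ∞ (fun q => mvfderiv I u q (X q)) p :=
  contMDiffAt_mvfderiv hu hX (by simp)

/-- In the preferred chart at `p`, the derivative of a function is its coordinate derivative. -/
lemma mvfderiv_apply_eq_fderiv [I.Boundaryless] {u : N → F} {p : N}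
    (hu : MDifferentiableAt I 𝓘(ℝ, F) u p) (v : E) :
    mvfderiv I u p v = fderiv ℝ (u ∘ (extChartAt I p).symm) (extChartAt I p p) v := by
  simp only [mvfderiv]
  rw [hu.mfderiv]
  simp only [I.range_eq_univ, fderivWithin_univ]
  rfl

lemma fderiv_lieBracket {f : E → F} {V W : E → E} {x : E} (hf : ContDiffAt ℝ 2 f x)
    (hV : DifferentiableAt ℝ V x) (hW : DifferentiableAt ℝ W x) :
    fderiv ℝ f x (lieBracket ℝ V W x) =
      fderiv ℝ (fun y => fderiv ℝ f y (W y)) x (V x)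
        - fderiv ℝ (fun y => fderiv ℝ f y (V y)) x (W x) := by
  have hd : DifferentiableAt ℝ (fderiv ℝ f) x :=
    (hf.fderiv_right (m := 1) (by norm_num)).differentiableAt (by simp)
  have hs : IsSymmSndFDerivAt ℝ f x := hf.isSymmSndFDerivAt (by simp)
  rw [fderiv_clm_apply hd hW, fderiv_clm_apply hd hV]
  simp only [lieBracket, map_sub, _root_.add_apply, ContinuousLinearMap.comp_apply,
    ContinuousLinearMap.flip_apply]
  rw [hs.eq (V x) (W x)]
  abel

lemma inverse_apply_of_eq_id {A : E →L[ℝ] E} (h : A = ContinuousLinearMap.id ℝ E) (v : E) :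
    A.inverse v = v := by
  rw [h, ContinuousLinearMap.inverse_id, ContinuousLinearMap.id_apply]

/-- `[X, Y] u = X (Y u) - Y (X u)`. -/
theorem mvfderiv_mlieBracket [I.Boundaryless] {u : N → F} {X Y : (q : N) → TangentSpace I q} {p : N}
    (hu : ContMDiffAt I 𝓘(ℝ, F) 2 u p) (hX : CMDiffAt 1 (T% X) p) (hY : CMDiffAt 1 (T% Y) p) :
    mvfderiv I u p (mlieBracket I X Y p) =
      mvfderiv I (fun q => mvfderiv I u q (Y q)) p (X p)
        - mvfderiv I (fun q => mvfderiv I u q (X q)) p (Y p) := by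
  set φ := extChartAt I p with hφ
  have hud := hu.mdifferentiableAt (by simp)
  have hf : ContDiffAt ℝ 2 (u ∘ φ.symm) (φ p) := by
    have := (contMDiffAt_iff.1 hu).2
    rw [I.range_eq_univ, contDiffWithinAt_univ] at this
    exact this
  have hev : ∀ᶠ y in 𝓝 (φ p), y ∈ φ.target ∧ MDifferentiableAt I 𝓘(ℝ, F) u (φ.symm y) := by
    refine Filter.Eventually.and (extChartAt_target_mem_nhds p) ?_
    have h1 := eventually_mdifferentiableAt hu (by norm_num)
    have h2 : Filter.Tendsto φ.symm (𝓝 (φ p)) (𝓝 p) := by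
      have := continuousAt_extChartAt_symm (I := I) p
      rwa [ContinuousAt, extChartAt_to_inv] at this
    exact h2.eventually h1
  -- the coordinate expression of a vector field
  let c (Z : (q : N) → TangentSpace I q) : E → E :=
    mpullbackWithin 𝓘(ℝ, E) I φ.symm Z (range I)
  have hc (Z : (q : N) → TangentSpace I q) (hZ : MDiffAt (T% Z) p) :
      DifferentiableAt ℝ (c Z) (φ p) := by
    have h := hZ.mdifferentiableWithinAt (s := univ)
      |>.differentiableWithinAt_mpullbackWithin_vectorField
    rw [preimage_univ, univ_inter] at h
    have h2 : range I ∈ 𝓝 (φ p) := by rw [I.range_eq_univ]; exact Filter.univ_mem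
    exact h.differentiableAt h2
  have hcZ (Z : (q : N) → TangentSpace I q) : ∀ᶠ y in 𝓝 (φ p),
      mvfderiv I u (φ.symm y) (Z (φ.symm y)) = fderiv ℝ (u ∘ φ.symm) y (c Z y) := by
    filter_upwards [hev] with y hy
    have hinv := isInvertible_mfderivWithin_extChartAt_symm (I := I) (x := p) hy.1
    have hcomp : mfderiv 𝓘(ℝ, E) 𝓘(ℝ, F) (u ∘ φ.symm) y =
        (mfderiv I 𝓘(ℝ, F) u (φ.symm y)).comp (mfderiv 𝓘(ℝ, E) I φ.symm y) := by
      refine mfderiv_comp y hy.2 ?_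
      have := mdifferentiableWithinAt_extChartAt_symm (I := I) (x := p) hy.1
      rw [I.range_eq_univ] at this
      exact mdifferentiableWithinAt_univ.1 this
    rw [mfderiv_eq_fderiv] at hcomp
    have h1 : (mfderiv 𝓘(ℝ, E) I φ.symm y) (c Z y) = Z (φ.symm y) := by
      simp only [c, mpullbackWithin_apply]
      simp only [I.range_eq_univ, mfderivWithin_univ] at hinv ⊢
      exact hinv.self_apply_inverse _
    rw [hcomp]
    show _ = (mfderiv I 𝓘(ℝ, F) u (φ.symm y)) ((mfderiv 𝓘(ℝ, E) I φ.symm y) (c Z y))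
    rw [h1]
    rfl
  have hmd (Z : (q : N) → TangentSpace I q) (hZ : CMDiffAt 1 (T% Z) p) (v : E) :
      mvfderiv I (fun q => mvfderiv I u q (Z q)) p v =
        fderiv ℝ (fun y => fderiv ℝ (u ∘ φ.symm) y (c Z y)) (φ p) v := by
    rw [mvfderiv_apply_eq_fderiv
      ((contMDiffAt_mvfderiv hu hZ (by norm_num)).mdifferentiableAt (by simp))]
    congr 1
    exact Filter.EventuallyEq.fderiv_eq (hcZ Z)
  have hp : φ.symm (φ p) = p := extChartAt_to_inv p
  have hid (Z : (q : N) → TangentSpace I q) : c Z (φ p) = Z p := by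
    simp only [c, mpullbackWithin_apply, hφ]
    have h0 : mfderivWithin 𝓘(ℝ, E) I (extChartAt I p).symm (range I) (extChartAt I p p)
      = ContinuousLinearMap.id ℝ E := mfderivWithin_range_extChartAt_symm
    refine (inverse_apply_of_eq_id (E := E) h0 (Z ((extChartAt I p).symm (extChartAt I p p)))).trans ?_
    rw [extChartAt_to_inv]
  have hbr : mlieBracket I X Y p = lieBracket ℝ (c X) (c Y) (φ p) := by
    rw [← mlieBracketWithin_univ, mlieBracketWithin_apply]
    have h0 : mfderiv I 𝓘(ℝ, E) (extChartAt I p) p = ContinuousLinearMap.id ℝ E :=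
      mfderiv_extChartAt_self
    refine (inverse_apply_of_eq_id (E := E) h0 _).trans ?_
    rw [preimage_univ, univ_inter]
    have hr : lieBracketWithin ℝ (c X) (c Y) (range I) = lieBracket ℝ (c X) (c Y) := by
      rw [I.range_eq_univ, lieBracketWithin_univ]
    exact congrFun hr (φ p)
  have h := fderiv_lieBracket hf (hc X (hX.mdifferentiableAt (by simp)))
    (hc Y (hY.mdifferentiableAt (by simp)))
  rw [hid, hid] at h
  refine ((mvfderiv_apply_eq_fderiv hud _).trans ?_).trans
    (h.trans (congrArg₂ (· - ·) (hmd Y hY (X p)).symm (hmd X hX (Y p)).symm))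
  rw [hbr]

end Calculus

section SmoothSections

variable {E : Type*} [NormedAddCommGroup E] [NormedSpace ℝ E] [FiniteDimensional ℝ E]
  {H : Type*} [TopologicalSpace H] {I : ModelWithCorners ℝ E H}
  {N : Type*} [TopologicalSpace N] [ChartedSpace H N] [IsManifold I ∞ N]
  {F : Type*} [NormedAddCommGroup F] [NormedSpace ℝ F]

lemma contMDiffAt_clm_of_apply {E₁ : Type*} [NormedAddCommGroup E₁] [NormedSpace ℝ E₁]
    [FiniteDimensional ℝ E₁] {A : N → E₁ →L[ℝ] F} {p : N} {n : WithTop ℕ∞}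
    (h : ∀ v, ContMDiffAt I 𝓘(ℝ, F) n (fun q => A q v) p) :
    ContMDiffAt I 𝓘(ℝ, E₁ →L[ℝ] F) n A p := by
  let b := Module.finBasis ℝ E₁
  have hA : A = fun q => ∑ i, ContinuousLinearMap.smulRightL ℝ E₁ F
      (LinearMap.toContinuousLinearMap (b.coord i)) (A q (b i)) := by
    funext q
    ext v
    conv_lhs => rw [← b.sum_repr v, map_sum]
    simp
  rw [hA]
  refine ContMDiffAt.sum fun i _ => ?_
  exact (ContinuousLinearMap.contMDiff _).contMDiffAt.comp p (h (b i))

/-- A family of linear maps out of the tangent spaces is smooth if it maps smooth vector fields to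
smooth sections. -/
theorem contMDiffAt_hom_section {V : N → Type*} [TopologicalSpace (TotalSpace F V)]
    [∀ x, AddCommGroup (V x)] [∀ x, Module ℝ (V x)] [∀ x, TopologicalSpace (V x)]
    [∀ x, IsTopologicalAddGroup (V x)] [∀ x, ContinuousSMul ℝ (V x)]
    [FiberBundle F V] [VectorBundle ℝ F V]
    {T : (q : N) → TangentSpace I q →L[ℝ] V q} {p : N}
    (h : ∀ X, SmoothFieldAt I X p →
      ContMDiffAt I (I.prod 𝓘(ℝ, F)) ∞ (fun q => TotalSpace.mk' F q (T q (X q))) p) :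
    ContMDiffAt I (I.prod 𝓘(ℝ, E →L[ℝ] F)) ∞
      (fun q => TotalSpace.mk' (E →L[ℝ] F) (E := fun q : N => TangentSpace I q →L[ℝ] V q) q (T q))
      p := by
  rw [contMDiffAt_hom_bundle]
  refine ⟨contMDiffAt_id, contMDiffAt_clm_of_apply fun v => ?_⟩
  let t := trivializationAt E (TangentSpace I : N → Type _) p
  have hX : SmoothFieldAt I (FiberBundle.extend E (t.symm p v)) p := smoothFieldAt_extend _
  refine (((contMDiffAt_section p).1 (h _ hX))).congr_of_eventuallyEq ?_
  have hp := FiberBundle.mem_baseSet_trivializationAt' (F := E) (E := (TangentSpace I : N → Type _)) p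
  have hp' := FiberBundle.mem_baseSet_trivializationAt' (F := F) (E := V) p
  filter_upwards [(trivializationAt E (TangentSpace I) p).open_baseSet.mem_nhds hp,
    (trivializationAt F V p).open_baseSet.mem_nhds hp'] with q hq hq'
  rw [ContinuousLinearMap.inCoordinates_eq hq hq']
  simp only [ContinuousLinearMap.comp_apply]
  have h2 : (t ⟨p, t.symm p v⟩).2 = v := by
    have := t.apply_mk_symm hp v
    rw [this]
  simp only [FiberBundle.extend]
  have : (trivializationAt E (TangentSpace I) p) ⟨p, t.symm p v⟩ = t ⟨p, t.symm p v⟩ := rfl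
  rw [this, h2]
  simp

lemma contMDiffAt_trivial_iff {f : N → F} {p : N} {n : WithTop ℕ∞} :
    ContMDiffAt I (I.prod 𝓘(ℝ, F)) n
      (fun q => TotalSpace.mk' F (E := Bundle.Trivial N F) q (f q)) p ↔
    ContMDiffAt I 𝓘(ℝ, F) n f p :=
  contMDiffAt_section p

lemma mdifferentiableAt_trivial_iff {f : N → F} {p : N} :
    MDifferentiableAt I (I.prod 𝓘(ℝ, F))
      (fun q => TotalSpace.mk' F (E := Bundle.Trivial N F) q (f q)) p ↔
    MDifferentiableAt I 𝓘(ℝ, F) f p :=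
  mdifferentiableAt_section I _

variable {X Y : (q : N) → TangentSpace I q} {p : N}

lemma contMDiffAt_oneForm {α : (q : N) → TangentSpace I q →L[ℝ] ℝ}
    (h : ∀ X, SmoothFieldAt I X p → ContMDiffAt I 𝓘(ℝ, ℝ) ∞ (fun q => α q (X q)) p) :
    ContMDiffAt I (I.prod 𝓘(ℝ, E →L[ℝ] ℝ)) ∞ (fun q => TotalSpace.mk' (E →L[ℝ] ℝ)
      (E := fun q : N => TangentSpace I q →L[ℝ] ℝ) q (α q)) p :=
  contMDiffAt_hom_section (V := Bundle.Trivial N ℝ)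
    fun X hX => contMDiffAt_trivial_iff.2 (h X hX)

lemma contMDiffAt_bilinForm {b : (q : N) → TangentSpace I q →L[ℝ] TangentSpace I q →L[ℝ] ℝ}
    (h : ∀ X Y, SmoothFieldAt I X p → SmoothFieldAt I Y p →
      ContMDiffAt I 𝓘(ℝ, ℝ) ∞ (fun q => b q (X q) (Y q)) p) :
    ContMDiffAt I (I.prod 𝓘(ℝ, E →L[ℝ] E →L[ℝ] ℝ)) ∞ (fun q => TotalSpace.mk' (E →L[ℝ] E →L[ℝ] ℝ)
      (E := fun q : N => TangentSpace I q →L[ℝ] TangentSpace I q →L[ℝ] ℝ) q (b q)) p :=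
  contMDiffAt_hom_section (V := fun q : N => TangentSpace I q →L[ℝ] ℝ)
    fun X hX => contMDiffAt_oneForm fun Y hY => h X Y hX hY

lemma contMDiffAt_endField {A : (q : N) → TangentSpace I q →L[ℝ] TangentSpace I q}
    (h : ∀ X, SmoothFieldAt I X p → SmoothFieldAt I (fun q => A q (X q)) p) :
    ContMDiffAt I (I.prod 𝓘(ℝ, E →L[ℝ] E)) ∞ (fun q => TotalSpace.mk' (E →L[ℝ] E)
      (E := fun q : N => TangentSpace I q →L[ℝ] TangentSpace I q) q (A q)) p :=
  contMDiffAt_hom_section (V := (TangentSpace I : N → Type _)) h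

lemma OneForm.contMDiffAt_apply (α : OneForm I N) (hX : SmoothFieldAt I X p) :
    ContMDiffAt I 𝓘(ℝ, ℝ) ∞ (fun q => α.toFun q (X q)) p :=
  contMDiffAt_trivial_iff.1 (ContMDiffAt.clm_bundle_apply (E₂ := Bundle.Trivial N ℝ) (α.smooth p) hX)

lemma OneForm.mdifferentiableAt_apply (α : OneForm I N) (hX : MDiffAt (T% X) p) :
    MDifferentiableAt I 𝓘(ℝ, ℝ) (fun q => α.toFun q (X q)) p :=
  mdifferentiableAt_trivial_iff.1 (MDifferentiableAt.clm_bundle_apply (E₂ := Bundle.Trivial N ℝ)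
    ((α.smooth p).mdifferentiableAt (by simp)) hX)

lemma TwoForm.contMDiffAt_apply (σ : TwoForm I N) (hX : SmoothFieldAt I X p)
    (hY : SmoothFieldAt I Y p) :
    ContMDiffAt I 𝓘(ℝ, ℝ) ∞ (fun q => σ.toFun q (X q) (Y q)) p :=
  contMDiffAt_trivial_iff.1
    (ContMDiffAt.clm_bundle_apply₂ (E₃ := Bundle.Trivial N ℝ) (σ.smooth p) hX hY)

lemma Metric.contMDiffAt_apply (g : Metric I N) (hX : SmoothFieldAt I X p)
    (hY : SmoothFieldAt I Y p) :
    ContMDiffAt I 𝓘(ℝ, ℝ) ∞ (fun q => g.inner q (X q) (Y q)) p :=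
  contMDiffAt_trivial_iff.1
    (ContMDiffAt.clm_bundle_apply₂ (E₃ := Bundle.Trivial N ℝ) (g.contMDiff p) hX hY)

lemma Metric.mdifferentiableAt_apply (g : Metric I N) (hX : MDiffAt (T% X) p)
    (hY : MDiffAt (T% Y) p) :
    MDifferentiableAt I 𝓘(ℝ, ℝ) (fun q => g.inner q (X q) (Y q)) p :=
  mdifferentiableAt_trivial_iff.1 (MDifferentiableAt.clm_bundle_apply₂ (E₃ := Bundle.Trivial N ℝ)
    ((g.contMDiff p).mdifferentiableAt (by simp)) hX hY)

lemma EndField.smoothFieldAt_apply (A : EndField I N) (hX : SmoothFieldAt I X p) :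
    SmoothFieldAt I (fun q => A.toFun q (X q)) p :=
  ContMDiffAt.clm_bundle_apply (A.smooth p) hX

lemma EndField.mdifferentiableAt_apply (A : EndField I N) (hX : MDiffAt (T% X) p) :
    MDiffAt (T% (fun q => A.toFun q (X q))) p :=
  MDifferentiableAt.clm_bundle_apply ((A.smooth p).mdifferentiableAt (by simp)) hX

end SmoothSections

section Tensoriality

variable {E : Type*} [NormedAddCommGroup E] [NormedSpace ℝ E] [FiniteDimensional ℝ E]
  {H : Type*} [TopologicalSpace H] {I : ModelWithCorners ℝ E H}
  {N : Type*} [TopologicalSpace N] [ChartedSpace H N] [IsManifold I ∞ N]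
  {X Y Z : (q : N) → TangentSpace I q} {p : N}

lemma OneForm.d_swap (α : OneForm I N) : α.d X Y p = - α.d Y X p := by
  simp only [OneForm.d]
  rw [mlieBracket_swap_apply (V := X), map_neg]
  ring

lemma OneForm.tensorialAt_d_right (α : OneForm I N) :
    TensorialAt I E (fun Y => α.d X Y p) p where
  smul {f Y} hf hY := by
    have hαY := α.mdifferentiableAt_apply hY
    simp only [OneForm.d, mlieBracket_smul_right hf hY, Pi.smul_apply', map_smul, map_add,
      smul_eq_mul, mvfderiv_fun_mul hf hαY, _root_.add_apply, _root_.smul_apply]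
    ring
  add {Y Z} hY hZ := by
    have hαY := α.mdifferentiableAt_apply hY
    have hαZ := α.mdifferentiableAt_apply hZ
    simp only [OneForm.d, mlieBracket_add_right hY hZ, Pi.add_apply, map_add,
      mvfderiv_fun_add hαY hαZ, _root_.add_apply]
    ring

lemma OneForm.tensorialAt_d_left (α : OneForm I N) :
    TensorialAt I E (fun Y => α.d Y X p) p where
  smul {f Y} hf hY := by
    have := (α.tensorialAt_d_right (X := X) (p := p)).smul hf hY
    simp only [α.d_swap (Y := X), smul_neg] at this ⊢
    rw [this]
  add {Y Z} hY hZ := by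
    have := (α.tensorialAt_d_right (X := X) (p := p)).add hY hZ
    simp only [α.d_swap (Y := X)] at this ⊢
    rw [this]; ring

lemma EndField.nijenhuis_swap (A : EndField I N) : A.nijenhuis X Y p = - A.nijenhuis Y X p := by
  simp only [EndField.nijenhuis]
  rw [mlieBracket_swap_apply (V := X) (W := Y),
    mlieBracket_swap_apply (V := X) (W := fun q => A.toFun q (Y q)),
    mlieBracket_swap_apply (W := fun q => A.toFun q (Y q)),
    mlieBracket_swap_apply (V := fun q => A.toFun q (X q)) (W := Y)]
  simp only [map_neg]
  abel

lemma EndField.tensorialAt_nijenhuis_right (A : EndField I N) :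
    TensorialAt I E (fun Y => A.nijenhuis X Y p) p where
  smul {f Y} hf hY := by
    have hAY := A.mdifferentiableAt_apply hY
    have h : (fun q => A.toFun q ((f • Y) q)) = f • fun q => A.toFun q (Y q) := by
      funext q; simp
    simp only [EndField.nijenhuis, h, mlieBracket_smul_right hf hY, mlieBracket_smul_right hf hAY,
      map_smul, map_add]
    module
  add {Y Z} hY hZ := by
    have hAY := A.mdifferentiableAt_apply hY
    have hAZ := A.mdifferentiableAt_apply hZ
    have h : (fun q => A.toFun q ((Y + Z) q)) =
        (fun q => A.toFun q (Y q)) + fun q => A.toFun q (Z q) := by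
      funext q; simp
    simp only [EndField.nijenhuis, h, mlieBracket_add_right hY hZ, mlieBracket_add_right hAY hAZ,
      map_add]
    module

lemma EndField.tensorialAt_nijenhuis_left (A : EndField I N) :
    TensorialAt I E (fun Y => A.nijenhuis Y X p) p where
  smul {f Y} hf hY := by
    have := (A.tensorialAt_nijenhuis_right (X := X) (p := p)).smul hf hY
    simp only [A.nijenhuis_swap (Y := X), smul_neg] at this ⊢
    rw [this]
  add {Y Z} hY hZ := by
    have := (A.tensorialAt_nijenhuis_right (X := X) (p := p)).add hY hZ
    simp only [A.nijenhuis_swap (Y := X)] at this ⊢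
    rw [this]; abel

/-- The Lie derivative of a metric, `(L_ξ g)(X, Y)`. -/
def Metric.lieDeriv (g : Metric I N) (ξ X Y : (q : N) → TangentSpace I q) (p : N) : ℝ :=
  mvfderiv I (fun q => g.inner q (X q) (Y q)) p (ξ p)
    - g.inner p (mlieBracket I ξ X p) (Y p) - g.inner p (X p) (mlieBracket I ξ Y p)

lemma Metric.lieDeriv_symm (g : Metric I N) {ξ : (q : N) → TangentSpace I q} :
    g.lieDeriv ξ X Y p = g.lieDeriv ξ Y X p := by
  simp only [Metric.lieDeriv]
  have : (fun q => g.inner q (X q) (Y q)) = fun q => g.inner q (Y q) (X q) :=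
    funext fun q => g.symm q _ _
  rw [this, g.symm p (mlieBracket I ξ X p), g.symm p (X p)]
  ring

lemma Metric.tensorialAt_lieDeriv_right (g : Metric I N) {ξ : (q : N) → TangentSpace I q}
    (hX : MDiffAt (T% X) p) :
    TensorialAt I E (fun Y => g.lieDeriv ξ X Y p) p where
  smul {f Y} hf hY := by
    have hαY := g.mdifferentiableAt_apply hX hY
    simp only [Metric.lieDeriv, mlieBracket_smul_right hf hY, Pi.smul_apply', map_smul, map_add,
      smul_eq_mul, mvfderiv_fun_mul hf hαY, _root_.add_apply, _root_.smul_apply]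
    ring
  add {Y Z} hY hZ := by
    have hαY := g.mdifferentiableAt_apply hX hY
    have hαZ := g.mdifferentiableAt_apply hX hZ
    simp only [Metric.lieDeriv, mlieBracket_add_right hY hZ, Pi.add_apply, map_add,
      mvfderiv_fun_add hαY hαZ, _root_.add_apply]
    ring

lemma Metric.tensorialAt_lieDeriv_left (g : Metric I N) {ξ : (q : N) → TangentSpace I q}
    (hX : MDiffAt (T% X) p) :
    TensorialAt I E (fun Y => g.lieDeriv ξ Y X p) p := by
  simpa only [g.lieDeriv_symm (Y := X)] using g.tensorialAt_lieDeriv_right hX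

/-- The exterior derivative of a `1`-form, as a `2`-form. -/
def OneForm.dForm (α : OneForm I N) : TwoForm I N where
  toFun p := TensorialAt.mkHom₂ (fun X Y => α.d X Y p) p
    (fun _ _ => α.tensorialAt_d_left) (fun _ _ => α.tensorialAt_d_right)
  alternating p v := by
    rw [TensorialAt.mkHom₂_apply_eq_extend]
    have := α.d_swap (X := FiberBundle.extend E v) (Y := FiberBundle.extend E v) (p := p)
    linarith
  smooth p := by
    refine contMDiffAt_bilinForm fun X Y hX hY => ?_
    have h : ∀ᶠ q in 𝓝 p, TensorialAt.mkHom₂ (fun X Y => α.d X Y q) q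
        (fun _ _ => α.tensorialAt_d_left) (fun _ _ => α.tensorialAt_d_right) (X q) (Y q) =
        α.d X Y q := by
      filter_upwards [hX.eventually_mdiff, hY.eventually_mdiff] with q hXq hYq
      exact TensorialAt.mkHom₂_apply _ _ hXq hYq
    refine ContMDiffAt.congr_of_eventuallyEq ?_ h
    exact ((hX.mvfderiv (α.contMDiffAt_apply hY)).sub (hY.mvfderiv (α.contMDiffAt_apply hX))).sub
      (α.contMDiffAt_apply (hX.bracket hY))

lemma OneForm.dForm_apply (α : OneForm I N) (hX : MDiffAt (T% X) p) (hY : MDiffAt (T% Y) p) :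
    α.dForm.toFun p (X p) (Y p) = α.d X Y p :=
  TensorialAt.mkHom₂_apply _ _ hX hY

end Tensoriality

section Closedness

variable {E : Type*} [NormedAddCommGroup E] [NormedSpace ℝ E] [FiniteDimensional ℝ E]
  {H : Type*} [TopologicalSpace H] {I : ModelWithCorners ℝ E H} [I.Boundaryless]
  {N : Type*} [TopologicalSpace N] [ChartedSpace H N] [IsManifold I ∞ N]

lemma two_le_infty : (2 : WithTop ℕ∞) ≤ ∞ := by
  exact WithTop.coe_le_coe.2 (le_top : (2 : ℕ∞) ≤ ⊤)

lemma OneForm.dForm_isClosed (α : OneForm I N) : α.dForm.IsClosed := by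
  intro p X Y Z hX hY hZ
  have key {X Y Z : (q : N) → TangentSpace I q} (hX : SmoothFieldAt I X p)
      (hY : SmoothFieldAt I Y p) (hZ : SmoothFieldAt I Z p) :
      mvfderiv I (fun q => α.dForm.toFun q (Y q) (Z q)) p (X p) =
        mvfderiv I (fun q => mvfderiv I (fun q => α.toFun q (Z q)) q (Y q)) p (X p)
        - mvfderiv I (fun q => mvfderiv I (fun q => α.toFun q (Y q)) q (Z q)) p (X p)
        - mvfderiv I (fun q => α.toFun q (mlieBracket I Y Z q)) p (X p) := by
    have h : (fun q => α.dForm.toFun q (Y q) (Z q)) =ᶠ[𝓝 p] fun q =>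
        mvfderiv I (fun q => α.toFun q (Z q)) q (Y q)
        - mvfderiv I (fun q => α.toFun q (Y q)) q (Z q)
        - α.toFun q (mlieBracket I Y Z q) := by
      filter_upwards [hY.eventually_mdiff, hZ.eventually_mdiff] with q hYq hZq
      exact α.dForm_apply hYq hZq
    have h1 := (hY.mvfderiv (α.contMDiffAt_apply hZ)).mdifferentiableAt (by simp)
    have h2 := (hZ.mvfderiv (α.contMDiffAt_apply hY)).mdifferentiableAt (by simp)
    have h3 := (α.contMDiffAt_apply (hY.bracket hZ)).mdifferentiableAt (by simp)
    have h12 : MDifferentiableAt I 𝓘(ℝ, ℝ) (fun q => mvfderiv I (fun q => α.toFun q (Z q)) q (Y q)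
        - mvfderiv I (fun q => α.toFun q (Y q)) q (Z q)) p := h1.sub h2
    rw [mvfderiv_congr h, mvfderiv_fun_sub h12 h3, mvfderiv_fun_sub h1 h2]
    rfl
  have hbr {X Y Z : (q : N) → TangentSpace I q} (hX : SmoothFieldAt I X p)
      (hY : SmoothFieldAt I Y p) (hZ : SmoothFieldAt I Z p) :
      mvfderiv I (fun q => α.toFun q (Z q)) p (mlieBracket I X Y p) =
        mvfderiv I (fun q => mvfderiv I (fun q => α.toFun q (Z q)) q (Y q)) p (X p)
        - mvfderiv I (fun q => mvfderiv I (fun q => α.toFun q (Z q)) q (X q)) p (Y p) :=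
    mvfderiv_mlieBracket ((α.contMDiffAt_apply hZ).of_le two_le_infty)
      (hX.of_le 1) (hY.of_le 1)
  have hjac := leibniz_identity_mlieBracket_apply (I := I) (x := p) (U := X) (V := Y) (W := Z)
    (by simpa using hX.of_le 2) (by simpa using hY.of_le 2) (by simpa using hZ.of_le 2)
  have hjac' := congrArg (α.toFun p) hjac
  rw [map_add, mlieBracket_swap_apply (V := X) (W := mlieBracket I Y Z),
    mlieBracket_swap_apply (V := Y) (W := mlieBracket I X Z), map_neg, map_neg] at hjac'
  simp only [TwoForm.d]
  rw [key hX hY hZ, key hY hX hZ, key hZ hX hY,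
    α.dForm_apply (hX.bracket hY).mdiff hZ.mdiff, α.dForm_apply (hX.bracket hZ).mdiff hY.mdiff,
    α.dForm_apply (hY.bracket hZ).mdiff hX.mdiff]
  simp only [OneForm.d]
  rw [hbr hX hY hZ, hbr hX hZ hY, hbr hY hZ hX]
  linarith

end Closedness

section Frames

variable {E : Type*} [NormedAddCommGroup E] [NormedSpace ℝ E] [FiniteDimensional ℝ E]
  {H : Type*} [TopologicalSpace H] {I : ModelWithCorners ℝ E H}
  {N : Type*} [TopologicalSpace N] [ChartedSpace H N] [IsManifold I ∞ N]
  {F : Type*} [NormedAddCommGroup F] [NormedSpace ℝ F] {p : N}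

lemma contMDiffAt_inverse {E₁ E₂ : Type*} [NormedAddCommGroup E₁] [NormedSpace ℝ E₁]
    [NormedAddCommGroup E₂] [NormedSpace ℝ E₂] [FiniteDimensional ℝ E₁]
    {A : N → E₁ →L[ℝ] E₂} {n : WithTop ℕ∞}
    (hA : ContMDiffAt I 𝓘(ℝ, E₁ →L[ℝ] E₂) n A p) (hp : (A p).IsInvertible) :
    ContMDiffAt I 𝓘(ℝ, E₂ →L[ℝ] E₁) n (fun q => (A q).inverse) p ∧
      ∀ᶠ q in 𝓝 p, (A q).IsInvertible := by
  have : CompleteSpace E₁ := FiniteDimensional.complete ℝ E₁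
  obtain ⟨e, he⟩ := hp
  constructor
  · have h := contDiffAt_map_inverse (n := n) e
    rw [he] at h
    exact h.contMDiffAt.comp p hA
  · have h := e.nhds
    rw [he] at h
    exact (hA.continuousAt.eventually h)

lemma smoothFieldAt_symmL {c : N → E} (hc : ContMDiffAt I 𝓘(ℝ, E) ∞ c p) :
    SmoothFieldAt I (fun q => (trivializationAt E (TangentSpace I) p).symmL ℝ q (c q)) p := by
  rw [SmoothFieldAt, contMDiffAt_section]
  refine hc.congr_of_eventuallyEq ?_
  have hp := FiberBundle.mem_baseSet_trivializationAt' (F := E) (E := (TangentSpace I : N → Type _)) p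
  filter_upwards [(trivializationAt E (TangentSpace I) p).open_baseSet.mem_nhds hp] with q hq
  rw [Trivialization.symmL_apply _ hq]
  exact congrArg Prod.snd ((trivializationAt E (TangentSpace I) p).apply_mk_symm hq (c q))

/-- If every tangent vector at `p` is the value of a smooth field with the property `P`, then such
fields contain a local frame. -/
lemma exists_expansion {P : ((q : N) → TangentSpace I q) → Prop}
    (hP : ∀ v : TangentSpace I p, ∃ X, SmoothFieldAt I X p ∧ P X ∧ X p = v)
    {X : (q : N) → TangentSpace I q} (hX : SmoothFieldAt I X p) :
    ∃ (n : ℕ) (f : Fin n → N → ℝ) (Y : Fin n → (q : N) → TangentSpace I q),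
      (∀ i, ContMDiffAt I 𝓘(ℝ, ℝ) ∞ (f i) p) ∧ (∀ i, SmoothFieldAt I (Y i) p ∧ P (Y i)) ∧
      ∀ᶠ q in 𝓝 p, X q = ∑ i, f i q • Y i q := by
  let t := trivializationAt E (TangentSpace I : N → Type _) p
  have hp : p ∈ t.baseSet := FiberBundle.mem_baseSet_trivializationAt' p
  let b := Module.finBasis ℝ E
  choose Y hY hPY hYp using fun i => hP (t.symmL ℝ p (b i))
  let y (i) (q : N) : E := t.continuousLinearMapAt ℝ q (Y i q)
  have hsm {Z : (q : N) → TangentSpace I q} (hZ : SmoothFieldAt I Z p) :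
      ContMDiffAt I 𝓘(ℝ, E) ∞ (fun q => t.continuousLinearMapAt ℝ q (Z q)) p := by
    refine ((contMDiffAt_section p).1 hZ).congr_of_eventuallyEq ?_
    filter_upwards [t.open_baseSet.mem_nhds hp] with q hq
    exact congrFun (t.coe_linearMapAt_of_mem hq) (Z q)
  let G (q : N) : E →L[ℝ] E := ∑ i, ContinuousLinearMap.smulRightL ℝ E E
      (LinearMap.toContinuousLinearMap (b.coord i)) (y i q)
  have hGapp (q : N) (c : E) : G q c = ∑ i, b.repr c i • y i q := by
    simp [G]
  have hG : ContMDiffAt I 𝓘(ℝ, E →L[ℝ] E) ∞ G p :=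
    ContMDiffAt.sum fun i _ => (ContinuousLinearMap.contMDiff _).contMDiffAt.comp p (hsm (hY i))
  have hGp : G p = ContinuousLinearMap.id ℝ E := by
    ext c
    rw [hGapp]
    have : ∀ i, y i p = b i := fun i => by
      simp only [y, hYp]
      exact t.continuousLinearMapAt_symmL hp (b i)
    simp only [this, b.sum_repr, ContinuousLinearMap.id_apply]
  obtain ⟨hinv, hev⟩ := contMDiffAt_inverse hG (by
    rw [hGp]; exact ⟨ContinuousLinearEquiv.refl ℝ E, rfl⟩)
  refine ⟨_, fun i q => b.coord i ((G q).inverse (t.continuousLinearMapAt ℝ q (X q))), Y,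
    fun i => ?_, fun i => ⟨hY i, hPY i⟩, ?_⟩
  · exact (ContinuousLinearMap.contMDiff (LinearMap.toContinuousLinearMap (b.coord i))).contMDiffAt.comp
      p (hinv.clm_apply (hsm hX))
  · filter_upwards [hev, t.open_baseSet.mem_nhds hp] with q hq hqt
    have h1 := hGapp q ((G q).inverse (t.continuousLinearMapAt ℝ q (X q)))
    rw [hq.self_apply_inverse] at h1
    have h2 := congrArg (t.symmL ℝ q) h1
    rw [t.symmL_continuousLinearMapAt hqt, map_sum] at h2
    refine h2.trans (Finset.sum_congr rfl fun i _ => ?_)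
    rw [map_smul, t.symmL_continuousLinearMapAt hqt]
    rfl

lemma contMDiffAt_hom_apply_of_frame {P : ((q : N) → TangentSpace I q) → Prop}
    (hP : ∀ v : TangentSpace I p, ∃ X, SmoothFieldAt I X p ∧ P X ∧ X p = v)
    {V : N → Type*} [TopologicalSpace (TotalSpace F V)]
    [∀ x, AddCommGroup (V x)] [∀ x, Module ℝ (V x)] [∀ x, TopologicalSpace (V x)]
    [FiberBundle F V] [VectorBundle ℝ F V]
    {T : (q : N) → TangentSpace I q →L[ℝ] V q}
    (h : ∀ X, SmoothFieldAt I X p → P X →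
      ContMDiffAt I (I.prod 𝓘(ℝ, F)) ∞ (fun q => TotalSpace.mk' F q (T q (X q))) p)
    {X : (q : N) → TangentSpace I q} (hX : SmoothFieldAt I X p) :
    ContMDiffAt I (I.prod 𝓘(ℝ, F)) ∞ (fun q => TotalSpace.mk' F q (T q (X q))) p := by
  obtain ⟨n, f, Y, hf, hY, hXY⟩ := exists_expansion hP hX
  have : ContMDiffAt I (I.prod 𝓘(ℝ, F)) ∞
      (fun q => TotalSpace.mk' F q (∑ i, f i q • T q (Y i q))) p :=
    ContMDiffAt.sum_section fun i _ => (hf i).smul_section (h _ (hY i).1 (hY i).2)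
  refine this.congr_of_eventuallyEq ?_
  filter_upwards [hXY] with q hq
  simp only [hq, map_sum, map_smul]

lemma contMDiffAt_bilin_apply_of_frame {P : ((q : N) → TangentSpace I q) → Prop}
    (hP : ∀ v : TangentSpace I p, ∃ X, SmoothFieldAt I X p ∧ P X ∧ X p = v)
    {b : (q : N) → TangentSpace I q →L[ℝ] TangentSpace I q →L[ℝ] ℝ}
    (h : ∀ X Y, SmoothFieldAt I X p → P X → SmoothFieldAt I Y p → P Y →
      ContMDiffAt I 𝓘(ℝ, ℝ) ∞ (fun q => b q (X q) (Y q)) p)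
    {X Y : (q : N) → TangentSpace I q} (hX : SmoothFieldAt I X p) (hY : SmoothFieldAt I Y p) :
    ContMDiffAt I 𝓘(ℝ, ℝ) ∞ (fun q => b q (X q) (Y q)) p := by
  have h' (X) (hX : SmoothFieldAt I X p) (hPX : P X) (Y) (hY : SmoothFieldAt I Y p) :
      ContMDiffAt I 𝓘(ℝ, ℝ) ∞ (fun q => b q (X q) (Y q)) p :=
    contMDiffAt_trivial_iff.1 (contMDiffAt_hom_apply_of_frame hP (V := Bundle.Trivial N ℝ)
      (T := fun q => b q (X q))
      (fun Y hY hPY => contMDiffAt_trivial_iff.2 (h X Y hX hPX hY hPY)) hY)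
  have h1 := contMDiffAt_hom_apply_of_frame hP (V := fun q : N => TangentSpace I q →L[ℝ] ℝ)
    (T := b) (fun X hX hPX => contMDiffAt_oneForm (h' X hX hPX)) hX
  exact contMDiffAt_trivial_iff.1 (ContMDiffAt.clm_bundle_apply (E₂ := Bundle.Trivial N ℝ) h1 hY)

lemma tensorial_ext {P : ((q : N) → TangentSpace I q) → Prop}
    (hP : ∀ v : TangentSpace I p, ∃ X, SmoothFieldAt I X p ∧ P X ∧ X p = v)
    {A : Type*} [AddCommGroup A] [Module ℝ A]
    {Φ Ψ : ((q : N) → TangentSpace I q) → ((q : N) → TangentSpace I q) → A}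
    (hΦ₁ : ∀ τ, MDiffAt (T% τ) p → TensorialAt I E (Φ · τ) p)
    (hΦ₂ : ∀ τ, MDiffAt (T% τ) p → TensorialAt I E (Φ τ ·) p)
    (hΨ₁ : ∀ τ, MDiffAt (T% τ) p → TensorialAt I E (Ψ · τ) p)
    (hΨ₂ : ∀ τ, MDiffAt (T% τ) p → TensorialAt I E (Ψ τ ·) p)
    (h : ∀ X Y, SmoothFieldAt I X p → P X → SmoothFieldAt I Y p → P Y → Φ X Y = Ψ X Y)
    {X Y : (q : N) → TangentSpace I q} (hX : SmoothFieldAt I X p) (hY : SmoothFieldAt I Y p) :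
    Φ X Y = Ψ X Y := by
  obtain ⟨X', hX', hPX', hXX'⟩ := hP (X p)
  obtain ⟨Y', hY', hPY', hYY'⟩ := hP (Y p)
  rw [TensorialAt.pointwise₂ hΦ₁ hΦ₂ hX.mdiff hX'.mdiff hY.mdiff hY'.mdiff hXX'.symm hYY'.symm,
    TensorialAt.pointwise₂ hΨ₁ hΨ₂ hX.mdiff hX'.mdiff hY.mdiff hY'.mdiff hXX'.symm hYY'.symm,
    h _ _ hX' hPX' hY' hPY']

end Frames

section Submersion

variable {E : Type*} [NormedAddCommGroup E] [NormedSpace ℝ E] [FiniteDimensional ℝ E]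
  {H : Type*} [TopologicalSpace H] {I : ModelWithCorners ℝ E H}
  {N : Type*} [TopologicalSpace N] [ChartedSpace H N] [IsManifold I ∞ N]
  {E' : Type*} [NormedAddCommGroup E'] [NormedSpace ℝ E'] [FiniteDimensional ℝ E']
  {H' : Type*} [TopologicalSpace H'] {I' : ModelWithCorners ℝ E' H'}
  {M : Type*} [TopologicalSpace M] [ChartedSpace H' M] [IsManifold I' ∞ M]
  {F : Type*} [NormedAddCommGroup F] [NormedSpace ℝ F]

lemma mvfderiv_comp_mfderiv {pr : N → M} {u : M → F} {p : N}
    (hu : MDifferentiableAt I' 𝓘(ℝ, F) u (pr p)) (hpr : MDifferentiableAt I I' pr p)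
    (v : TangentSpace I p) :
    mvfderiv I (fun q => u (pr q)) p v = mvfderiv I' u (pr p) (mfderiv I I' pr p v) := by
  have h := mfderiv_comp p hu hpr
  exact congrArg (fun A : TangentSpace I p →L[ℝ] F => A v) h

lemma mdifferentiableAt_extChartAt_of_mem {x y : M} (hy : y ∈ (extChartAt I' x).source) :
    MDifferentiableAt I' 𝓘(ℝ, E') (extChartAt I' x) y :=
  mdifferentiableAt_extChartAt (by rwa [← extChartAt_source I'])

lemma mvfderiv_extChartAt_injective {x y : M} (hy : y ∈ (extChartAt I' x).source) :
    Function.Injective (mvfderiv I' (extChartAt I' x) y) := by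
  have h := (isInvertible_mfderiv_extChartAt (I := I') hy).bijective.1
  exact h

/-- `X` and `Y` are `pr`-related at `p`. -/
def IsRelatedNear (pr : N → M) (X : (q : N) → TangentSpace I q) (Y : (x : M) → TangentSpace I' x)
    (p : N) : Prop :=
  ∀ᶠ q in 𝓝 p, mfderiv I I' pr q (X q) = Y (pr q)

/-- The bracket of related vector fields is related to the bracket. -/
theorem mfderiv_mlieBracket_of_related [I.Boundaryless] [I'.Boundaryless] {pr : N → M} {p : N}
    (hpr : ContMDiffAt I I' ∞ pr p)
    {X₁ X₂ : (q : N) → TangentSpace I q} {Y₁ Y₂ : (x : M) → TangentSpace I' x}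
    (hX₁ : SmoothFieldAt I X₁ p) (hX₂ : SmoothFieldAt I X₂ p)
    (hY₁ : SmoothFieldAt I' Y₁ (pr p)) (hY₂ : SmoothFieldAt I' Y₂ (pr p))
    (h₁ : IsRelatedNear pr X₁ Y₁ p) (h₂ : IsRelatedNear pr X₂ Y₂ p) :
    mfderiv I I' pr p (mlieBracket I X₁ X₂ p) = mlieBracket I' Y₁ Y₂ (pr p) := by
  set u := extChartAt I' (pr p) with hu
  have hus : ContMDiffAt I' 𝓘(ℝ, E') ∞ u (pr p) := contMDiffAt_extChartAt
  have hupr : ContMDiffAt I 𝓘(ℝ, E') ∞ (fun q => u (pr q)) p := hus.comp p hpr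
  have hprd := eventually_mdifferentiableAt hpr (by simp)
  have hud : ∀ᶠ q in 𝓝 p, MDifferentiableAt I' 𝓘(ℝ, E') u (pr q) :=
    hpr.continuousAt.eventually (eventually_mdifferentiableAt hus (by simp))
  have hrel {X : (q : N) → TangentSpace I q} {Y : (x : M) → TangentSpace I' x}
      (h : IsRelatedNear pr X Y p) :
      (fun q => mvfderiv I (fun q => u (pr q)) q (X q)) =ᶠ[𝓝 p]
        fun q => mvfderiv I' u (pr q) (Y (pr q)) := by
    filter_upwards [hprd, hud, h] with q h1 h2 h3
    rw [mvfderiv_comp_mfderiv h2 h1, h3]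
  have hsm {Y : (x : M) → TangentSpace I' x} (hY : SmoothFieldAt I' Y (pr p)) :
      MDifferentiableAt I' 𝓘(ℝ, E') (fun x => mvfderiv I' u x (Y x)) (pr p) :=
    (hY.mvfderiv hus).mdifferentiableAt (by simp)
  apply mvfderiv_extChartAt_injective (mem_extChartAt_source (I := I') (pr p))
  rw [← hu, ← mvfderiv_comp_mfderiv hud.self_of_nhds hprd.self_of_nhds,
    mvfderiv_mlieBracket (hupr.of_le two_le_infty) (hX₁.of_le 1) (hX₂.of_le 1),
    mvfderiv_mlieBracket (hus.of_le two_le_infty) (hY₁.of_le 1) (hY₂.of_le 1),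
    mvfderiv_congr (hrel h₁), mvfderiv_congr (hrel h₂),
    mvfderiv_comp_mfderiv (hsm hY₁) hprd.self_of_nhds,
    mvfderiv_comp_mfderiv (hsm hY₂) hprd.self_of_nhds,
    h₁.self_of_nhds, h₂.self_of_nhds]

/-- On the open set `O`, `pr` is a submersion whose fibres are spanned by `ξ`, and `η` is a `1`-form
with `η(ξ) = 1`. -/
structure IsAdapted (pr : N → M) (ξ : (q : N) → TangentSpace I q) (η : OneForm I N)
    (O : Set N) : Prop where
  isOpen : IsOpen O
  smooth : ∀ p ∈ O, ContMDiffAt I I' ∞ pr p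
  surj : ∀ p ∈ O, Function.Surjective (mfderiv I I' pr p)
  smooth_ξ : ∀ p ∈ O, SmoothFieldAt I ξ p
  ker : ∀ p ∈ O, mfderiv I I' pr p (ξ p) = 0
  unit : ∀ p ∈ O, η.toFun p (ξ p) = 1
  finrank : ∀ p ∈ O, Module.finrank ℝ E = Module.finrank ℝ E' + 1

/-- The horizontal lift of a tangent vector with respect to the hyperplane field `ker η`. -/
def hlift (pr : N → M) (η : OneForm I N) (p : N) :
    TangentSpace I' (pr p) →L[ℝ] TangentSpace I p :=
  ((mfderiv I I' pr p).prod (η.toFun p)).inverse.comp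
    (ContinuousLinearMap.inl ℝ (TangentSpace I' (pr p)) ℝ)

namespace IsAdapted

variable {pr : N → M} {ξ : (q : N) → TangentSpace I q} {η : OneForm I N} {O : Set N} {p : N}

lemma isInvertible (h : IsAdapted (I' := I') pr ξ η O) (hp : p ∈ O) :
    ((mfderiv I I' pr p).prod (η.toFun p)).IsInvertible := by
  have hs : Function.Surjective ((mfderiv I I' pr p).prod (η.toFun p)) := by
    rintro ⟨w, c⟩
    obtain ⟨v, hv⟩ := h.surj p hp w
    refine ⟨v + (c - η.toFun p v) • ξ p, ?_⟩
    simp [hv, h.ker p hp, h.unit p hp]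
  have : FiniteDimensional ℝ (TangentSpace I p) := inferInstanceAs (FiniteDimensional ℝ E)
  have : FiniteDimensional ℝ (TangentSpace I' (pr p)) := inferInstanceAs (FiniteDimensional ℝ E')
  have : T2Space (TangentSpace I p) := inferInstanceAs (T2Space E)
  have : T2Space (TangentSpace I' (pr p)) := inferInstanceAs (T2Space E')
  have hd : Module.finrank ℝ (TangentSpace I p) =
      Module.finrank ℝ (TangentSpace I' (pr p) × ℝ) := by
    rw [Module.finrank_prod, Module.finrank_self]
    exact h.finrank p hp
  have hi := (LinearMap.injective_iff_surjective_of_finrank_eq_finrank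
    (f := ((mfderiv I I' pr p).prod (η.toFun p)).toLinearMap) hd).2 hs
  refine ⟨(LinearEquiv.ofBijective _ ⟨hi, hs⟩).toContinuousLinearEquiv, ?_⟩
  ext v <;> rfl

lemma mfderiv_hlift (h : IsAdapted (I' := I') pr ξ η O) (hp : p ∈ O) (w : TangentSpace I' (pr p)) :
    mfderiv I I' pr p (hlift pr η p w) = w :=
  congrArg Prod.fst ((h.isInvertible hp).self_apply_inverse (w, 0))

lemma form_hlift (h : IsAdapted (I' := I') pr ξ η O) (hp : p ∈ O) (w : TangentSpace I' (pr p)) :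
    η.toFun p (hlift pr η p w) = 0 :=
  congrArg Prod.snd ((h.isInvertible hp).self_apply_inverse (w, 0))

lemma ext (h : IsAdapted (I' := I') pr ξ η O) (hp : p ∈ O) {v w : TangentSpace I p}
    (h1 : mfderiv I I' pr p v = mfderiv I I' pr p w) (h2 : η.toFun p v = η.toFun p w) : v = w :=
  (h.isInvertible hp).bijective.1 (Prod.ext h1 h2)

lemma hlift_mfderiv (h : IsAdapted (I' := I') pr ξ η O) (hp : p ∈ O) (v : TangentSpace I p) :
    hlift pr η p (mfderiv I I' pr p v) = v - η.toFun p v • ξ p :=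
  h.ext hp (by simp [h.mfderiv_hlift hp, h.ker p hp]) (by simp [h.form_hlift hp, h.unit p hp])

lemma eq_smul_of_mfderiv_eq_zero (h : IsAdapted (I' := I') pr ξ η O) (hp : p ∈ O)
    {v : TangentSpace I p} (hv : mfderiv I I' pr p v = 0) : v = η.toFun p v • ξ p := by
  have := h.hlift_mfderiv hp v
  rw [hv, map_zero] at this
  exact sub_eq_zero.1 this.symm

/-- The horizontal lift of a smooth vector field is smooth. -/
lemma smoothFieldAt_hlift (h : IsAdapted (I' := I') pr ξ η O) (hp : p ∈ O)
    {Y : (x : M) → TangentSpace I' x} (hY : SmoothFieldAt I' Y (pr p)) :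
    SmoothFieldAt I (fun q => hlift pr η q (Y (pr q))) p := by
  set u := extChartAt I' (pr p) with hu
  let t := trivializationAt E (TangentSpace I : N → Type _) p
  have hpt : p ∈ t.baseSet := FiberBundle.mem_baseSet_trivializationAt' p
  have hpr := h.smooth p hp
  have hus : ContMDiffAt I' 𝓘(ℝ, E') ∞ u (pr p) := contMDiffAt_extChartAt
  have hupr : ContMDiffAt I 𝓘(ℝ, E') ∞ (fun q => u (pr q)) p := hus.comp p hpr
  have hprd := eventually_mdifferentiableAt hpr (by simp)
  have hsrc : ∀ᶠ q in 𝓝 p, pr q ∈ u.source :=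
    hpr.continuousAt.eventually (extChartAt_source_mem_nhds (I := I') (pr p))
  let D (q : N) : TangentSpace I q →L[ℝ] E' × ℝ :=
    (mvfderiv I (fun q => u (pr q)) q).prod (η.toFun q)
  let A (q : N) : E →L[ℝ] E' × ℝ := (D q).comp (t.symmL ℝ q)
  have hA : ContMDiffAt I 𝓘(ℝ, E →L[ℝ] E' × ℝ) ∞ A p := by
    refine contMDiffAt_clm_of_apply fun v => ?_
    have hX := smoothFieldAt_symmL (I := I) (p := p) (contMDiffAt_const (c := v))
    exact (hX.mvfderiv hupr).prodMk_space (η.contMDiffAt_apply hX)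
  have hDapp {q : N} (h1 : MDifferentiableAt I I' pr q) (h2 : pr q ∈ u.source)
      (v : TangentSpace I q) :
      D q v = (mvfderiv I' u (pr q) (mfderiv I I' pr q v), η.toFun q v) :=
    Prod.ext (mvfderiv_comp_mfderiv (mdifferentiableAt_extChartAt_of_mem h2) h1 v) rfl
  have hDinj {q : N} (hq : q ∈ O) (h1 : MDifferentiableAt I I' pr q) (h2 : pr q ∈ u.source) :
      Function.Injective (D q) := by
    intro v w hvw
    rw [hDapp h1 h2, hDapp h1 h2, Prod.mk.injEq] at hvw
    exact h.ext hq (mvfderiv_extChartAt_injective h2 hvw.1) hvw.2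
  have hAp : (A p).IsInvertible := by
    have hi : Function.Injective (A p) := by
      refine (hDinj hp hprd.self_of_nhds hsrc.self_of_nhds).comp ?_
      intro v w hvw
      simpa [t.continuousLinearMapAt_symmL hpt] using
        congrArg (t.continuousLinearMapAt ℝ p) hvw
    have hd : Module.finrank ℝ E = Module.finrank ℝ (E' × ℝ) := by
      rw [Module.finrank_prod, Module.finrank_self]
      exact h.finrank p hp
    have hs := (LinearMap.injective_iff_surjective_of_finrank_eq_finrank
      (f := (A p).toLinearMap) hd).1 hi
    refine ⟨(LinearEquiv.ofBijective _ ⟨hi, hs⟩).toContinuousLinearEquiv, ?_⟩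
    ext v <;> rfl
  obtain ⟨hinv, hev⟩ := contMDiffAt_inverse hA hAp
  have hc : ContMDiffAt I 𝓘(ℝ, E' × ℝ) ∞
      (fun q => ((mvfderiv I' u (pr q) (Y (pr q)), (0 : ℝ)) : E' × ℝ)) p :=
    ((hY.mvfderiv hus).comp p hpr).prodMk_space contMDiffAt_const
  refine (smoothFieldAt_symmL (I := I) (p := p) (hinv.clm_apply hc)).congr ?_
  filter_upwards [hev, hprd, hsrc, h.isOpen.mem_nhds hp] with q h0 h1 h2 h3
  apply hDinj h3 h1 h2
  rw [hDapp h1 h2, h.mfderiv_hlift h3, h.form_hlift h3]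
  exact (h0.self_apply_inverse _).symm

/-- Basic vector fields: related to a smooth vector field on the base, with constant vertical
component. -/
def IsBasic (pr : N → M) (η : OneForm I N) (p : N) (X : (q : N) → TangentSpace I q) : Prop :=
  (∃ Y : (x : M) → TangentSpace I' x, SmoothFieldAt I' Y (pr p) ∧ IsRelatedNear pr X Y p) ∧
    ∃ c : ℝ, ∀ᶠ q in 𝓝 p, η.toFun q (X q) = c

lemma exists_isBasic (h : IsAdapted (I' := I') pr ξ η O) (hp : p ∈ O) (v : TangentSpace I p) :
    ∃ X, SmoothFieldAt I X p ∧ IsBasic (I' := I') pr η p X ∧ X p = v := by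
  let Y : (x : M) → TangentSpace I' x := FiberBundle.extend E' (mfderiv I I' pr p v)
  have hY : SmoothFieldAt I' Y (pr p) := smoothFieldAt_extend _
  refine ⟨(fun q => hlift pr η q (Y (pr q))) + (fun _ => η.toFun p v) • ξ,
    (h.smoothFieldAt_hlift hp hY).add (.smul contMDiffAt_const (h.smooth_ξ p hp)),
    ⟨⟨Y, hY, ?_⟩, η.toFun p v, ?_⟩, ?_⟩
  · filter_upwards [h.isOpen.mem_nhds hp] with q hq
    simp [h.mfderiv_hlift hq, h.ker q hq]
  · filter_upwards [h.isOpen.mem_nhds hp] with q hq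
    simp [h.form_hlift hq, h.unit q hq]
  · have : Y (pr p) = mfderiv I I' pr p v := FiberBundle.extend_apply_self ..
    simp [this, h.hlift_mfderiv hp]

end IsAdapted

end Submersion

section LocalSections

variable {E : Type*} [NormedAddCommGroup E] [NormedSpace ℝ E] [FiniteDimensional ℝ E]
  {H : Type*} [TopologicalSpace H] {I : ModelWithCorners ℝ E H} [I.Boundaryless]
  {N : Type*} [TopologicalSpace N] [ChartedSpace H N] [IsManifold I ∞ N]
  {E' : Type*} [NormedAddCommGroup E'] [NormedSpace ℝ E'] [FiniteDimensional ℝ E']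
  {H' : Type*} [TopologicalSpace H'] {I' : ModelWithCorners ℝ E' H'} [I'.Boundaryless]
  {M : Type*} [TopologicalSpace M] [ChartedSpace H' M] [IsManifold I' ∞ M]

/-- A submersion has smooth local sections. -/
theorem exists_local_section {pr : N → M} {p : N} (hpr : ContMDiffAt I I' ∞ pr p)
    (hs : Function.Surjective (mfderiv I I' pr p)) :
    ∃ s : M → N, s (pr p) = p ∧ ContMDiffAt I' I ∞ s (pr p) ∧ ∀ᶠ x in 𝓝 (pr p), pr (s x) = x := by
  set φ := extChartAt I p with hφ
  set χ := extChartAt I' (pr p) with hχ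
  have hχs : ContMDiffAt I' 𝓘(ℝ, E') ∞ χ (pr p) := contMDiffAt_extChartAt
  have hφp : φ.symm (φ p) = p := extChartAt_to_inv p
  have hψ : ContMDiffAt 𝓘(ℝ, E) I ∞ φ.symm (φ p) :=
    (contMDiffOn_extChartAt_symm p).contMDiffAt (extChartAt_target_mem_nhds p)
  have hu : ContMDiffAt I 𝓘(ℝ, E') ∞ (fun q => χ (pr q)) p := hχs.comp p hpr
  let f : E → E' := fun y => χ (pr (φ.symm y))
  have hf : ContDiffAt ℝ ∞ f (φ p) := by
    refine ContMDiffAt.contDiffAt (ContMDiffAt.comp (φ p) (g := fun q => χ (pr q)) ?_ hψ)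
    rw [hφp]; exact hu
  have hfs : Function.Surjective (fderiv ℝ f (φ p)) := by
    intro w
    obtain ⟨w', hw'⟩ := (isInvertible_mfderiv_extChartAt (I := I')
      (mem_extChartAt_source (I := I') (pr p))).bijective.2 w
    obtain ⟨v, hv⟩ := hs w'
    refine ⟨v, ?_⟩
    have h1 := mvfderiv_apply_eq_fderiv (hu.mdifferentiableAt (by simp)) v
    rw [mvfderiv_comp_mfderiv (hχs.mdifferentiableAt (by simp))
      (hpr.mdifferentiableAt (by simp)), hv] at h1
    exact h1.symm.trans hw'
  obtain ⟨R₀, hR₀⟩ := (fderiv ℝ f (φ p)).toLinearMap.exists_rightInverse_of_surjective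
    (LinearMap.range_eq_top.2 hfs)
  let R : E' →L[ℝ] E := LinearMap.toContinuousLinearMap R₀
  have hR (w : E') : fderiv ℝ f (φ p) (R w) = w := congrArg (fun A => A w) hR₀
  let k : E' → E' := fun y => f (φ p + R y)
  have hk : ContDiffAt ℝ ∞ k 0 := by
    refine ContDiffAt.comp (0 : E') (g := f) (f := fun y => φ p + R y) ?_
      (contDiffAt_const.add R.contDiff.contDiffAt)
    simpa using hf
  have hk' : HasFDerivAt k ((ContinuousLinearEquiv.refl ℝ E' : E' ≃L[ℝ] E') : E' →L[ℝ] E') 0 := by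
    have h1 : HasFDerivAt f (fderiv ℝ f (φ p)) (φ p + R 0) := by
      simpa using (hf.differentiableAt (by simp)).hasFDerivAt
    have h2 := h1.comp (0 : E') (R.hasFDerivAt.const_add (φ p))
    convert! h2 using 1
    ext w
    exact (hR w).symm
  let l := hk.localInverse hk' (by simp)
  have hk0 : k 0 = χ (pr p) := by simp [k, f, hφp]
  have hl : ContDiffAt ℝ ∞ l (χ (pr p)) := by
    rw [← hk0]; exact hk.to_localInverse hk' (by simp)
  have hl0 : l (χ (pr p)) = 0 := by
    rw [← hk0]; exact hk.localInverse_apply_image hk' (by simp)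
  have hkl : ∀ᶠ y in 𝓝 (χ (pr p)), k (l y) = y := by
    rw [← hk0]
    exact (hk.hasStrictFDerivAt' hk' (by simp)).eventually_right_inverse
  have hsm : ContMDiffAt I' I ∞ (fun x => φ.symm (φ p + R (l (χ x)))) (pr p) := by
    have h1 : ContDiffAt ℝ ∞ (fun y => φ p + R (l y)) (χ (pr p)) :=
      contDiffAt_const.add (R.contDiff.contDiffAt.comp _ hl)
    have h2 := h1.contMDiffAt.comp (pr p) hχs
    refine ContMDiffAt.comp (pr p) (g := φ.symm) ?_ h2
    simpa [hl0] using! hψ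
  have hs0 : φ.symm (φ p + R (l (χ (pr p)))) = p := by rw [hl0, map_zero, add_zero, hφp]
  refine ⟨fun x => φ.symm (φ p + R (l (χ x))), hs0, hsm, ?_⟩
  have hsrc : ∀ᶠ x in 𝓝 (pr p), pr (φ.symm (φ p + R (l (χ x)))) ∈ χ.source := by
    have h1 : ContinuousAt (fun x => pr (φ.symm (φ p + R (l (χ x))))) (pr p) := by
      refine ContinuousAt.comp (g := pr) ?_ hsm.continuousAt
      rw [hs0]; exact hpr.continuousAt
    refine h1.eventually ?_
    show ∀ᶠ y in 𝓝 (pr (φ.symm (φ p + R (l (χ (pr p)))))), y ∈ χ.source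
    rw [hs0]
    exact extChartAt_source_mem_nhds (I := I') (pr p)
  filter_upwards [hsrc, hχs.continuousAt.eventually hkl,
    extChartAt_source_mem_nhds (I := I') (pr p)] with x h1 h2 h3
  exact χ.injOn h1 h3 h2

lemma contMDiffAt_of_comp {E'' : Type*} [NormedAddCommGroup E''] [NormedSpace ℝ E'']
    {H'' : Type*} [TopologicalSpace H''] {J : ModelWithCorners ℝ E'' H''}
    {Z : Type*} [TopologicalSpace Z] [ChartedSpace H'' Z]
    {pr : N → M} {p : N} (hpr : ContMDiffAt I I' ∞ pr p)
    (hs : Function.Surjective (mfderiv I I' pr p)) {f : M → Z}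
    (hf : ContMDiffAt I J ∞ (fun q => f (pr q)) p) : ContMDiffAt I' J ∞ f (pr p) := by
  obtain ⟨s, h1, h2, h3⟩ := exists_local_section hpr hs
  have h4 : ContMDiffAt I' J ∞ (fun x => f (pr (s x))) (pr p) := by
    refine ContMDiffAt.comp (pr p) (g := fun q => f (pr q)) ?_ h2
    rw [h1]; exact hf
  exact h4.congr_of_eventuallyEq (h3.mono fun x hx => by simp only [hx])

lemma smoothFieldAt_of_extChartAt {Y : (x : M) → TangentSpace I' x} {x : M}
    (h : ContMDiffAt I' 𝓘(ℝ, E') ∞ (fun y => mvfderiv I' (extChartAt I' x) y (Y y)) x) :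
    SmoothFieldAt I' Y x := by
  rw [SmoothFieldAt, contMDiffAt_section]
  refine h.congr_of_eventuallyEq ?_
  filter_upwards [chart_source_mem_nhds H' x] with y hy
  have h1 := TangentBundle.continuousLinearMapAt_trivializationAt (I := I') hy
  have h2 := congrFun ((trivializationAt E' (TangentSpace I') x).coe_linearMapAt_of_mem
    (R := ℝ) (b := y) (by simpa using hy)) (Y y)
  have h3 := congrArg (fun A : TangentSpace I' y →L[ℝ] E' => A (Y y)) h1
  exact h2.symm.trans h3

end LocalSections

lemma isVonNBounded_of_posDef {E : Type*} [NormedAddCommGroup E] [NormedSpace ℝ E]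
    [FiniteDimensional ℝ E] (b : E →L[ℝ] E →L[ℝ] ℝ) (hb : ∀ v, v ≠ 0 → 0 < b v v) :
    Bornology.IsVonNBounded ℝ {v : E | b v v < 1} := by
  rw [NormedSpace.isVonNBounded_iff]
  have : ProperSpace E := FiniteDimensional.proper ℝ E
  have hcont : Continuous fun v => b v v := b.continuous.clm_apply continuous_id
  obtain ⟨m, hm, hmin⟩ : ∃ m : ℝ, 0 < m ∧ ∀ v : E, ‖v‖ = 1 → m ≤ b v v := by
    rcases (Metric.sphere (0 : E) 1).eq_empty_or_nonempty with he | hne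
    · refine ⟨1, one_pos, fun v hv => ?_⟩
      have : v ∈ Metric.sphere (0 : E) 1 := by simpa using hv
      rw [he] at this
      exact this.elim
    · obtain ⟨v₀, hv₀, hmin⟩ := (isCompact_sphere (0 : E) 1).exists_isMinOn hne hcont.continuousOn
      refine ⟨b v₀ v₀, hb _ ?_, fun v hv => hmin (by simpa using hv)⟩
      rintro rfl
      simp at hv₀
  refine (Metric.isBounded_iff_subset_closedBall (0 : E)).2 ⟨1 / m + 1, fun v hv => ?_⟩
  rw [mem_closedBall_zero_iff]
  rcases eq_or_ne v 0 with rfl | hv0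
  · simp; positivity
  have hn : 0 < ‖v‖ := norm_pos_iff.2 hv0
  have h1 := hmin (‖v‖⁻¹ • v) (by rw [norm_smul, norm_inv, norm_norm, inv_mul_cancel₀ hn.ne'])
  simp only [map_smul, _root_.smul_apply, smul_eq_mul] at h1
  have h2 : m * ‖v‖ ^ 2 ≤ b v v := by
    have := mul_le_mul_of_nonneg_right h1 (sq_nonneg ‖v‖)
    field_simp at this
    linarith
  have h3 : b v v < 1 := hv
  have h4 : ‖v‖ ^ 2 ≤ 1 / m := by
    rw [le_div_iff₀ hm]; linarith
  have h5 : 0 < 1 / m := by positivity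
  nlinarith [sq_nonneg (‖v‖ - 1)]

section STAlgebra

variable {E : Type*} [NormedAddCommGroup E] [NormedSpace ℝ E] [FiniteDimensional ℝ E]
  {H : Type*} [TopologicalSpace H] {I : ModelWithCorners ℝ E H}
  {N : Type*} [TopologicalSpace N] [ChartedSpace H N] [IsManifold I ∞ N]
  {X Y : (q : N) → TangentSpace I q} {p : N}

lemma mlieBracket_self_apply (X : (q : N) → TangentSpace I q) : mlieBracket I X X p = 0 := by
  have h : mlieBracket I X X p = - mlieBracket I X X p := mlieBracket_swap_apply
  have h2 : (2 : ℝ) • mlieBracket I X X p = 0 := by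
    rw [two_smul]
    nth_rewrite 2 [h]
    exact add_neg_cancel _
  exact (smul_eq_zero.1 h2).resolve_left two_ne_zero

namespace AlmostContactMetric

variable (A : AlmostContactMetric I N)

lemma η_ξ : A.η.toFun p (A.ξ p) = 1 := by rw [A.dual, A.unit]

lemma ξ_ne_zero : A.ξ p ≠ 0 := fun h => by
  have := A.η_ξ (p := p)
  rw [h, map_zero] at this
  exact zero_ne_one this

lemma η_φ (v : TangentSpace I p) : A.η.toFun p (A.φ.toFun p v) = 0 := by
  have h1 := A.φ_sq p (A.φ.toFun p v)
  rw [A.φ_sq p v, map_add, map_neg, map_smul, A.φ_ξ, smul_zero, add_zero] at h1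
  have h2 : A.η.toFun p (A.φ.toFun p v) • A.ξ p = 0 := by
    have := congrArg (fun w => A.φ.toFun p v + w) h1
    simpa using this.symm
  exact (smul_eq_zero.1 h2).resolve_right A.ξ_ne_zero

lemma eq_smul_of_φ_eq_zero {v : TangentSpace I p} (h : A.φ.toFun p v = 0) :
    v = A.η.toFun p v • A.ξ p := by
  have := A.φ_sq p v
  rw [h, map_zero] at this
  have h2 := congrArg (fun w => v + w) this
  simpa using h2

lemma smoothFieldAt_ξ : SmoothFieldAt I A.ξ p := A.smooth_ξ p

end AlmostContactMetric

namespace STStructure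

variable (S : STStructure I N)

lemma d_ξ (hX : SmoothFieldAt I X p) : S.η.d S.ξ X p = 0 := by
  have h1 := S.killing p S.ξ X S.smoothFieldAt_ξ hX
  rw [mlieBracket_self_apply, map_zero, _root_.zero_apply, zero_add, ← S.dual] at h1
  have h2 : (fun q => S.η.toFun q (X q)) = fun q => S.g.inner q (S.ξ q) (X q) :=
    funext fun q => S.dual q (X q)
  have h3 : (fun q => S.η.toFun q (S.ξ q)) = fun _ => 1 := funext fun q => S.η_ξ
  simp only [OneForm.d, h3, mvfderiv_const, _root_.zero_apply, h2, h1]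
  ring

lemma dForm_ξ (v : TangentSpace I p) : S.η.dForm.toFun p (S.ξ p) v = 0 := by
  have h := S.d_ξ (smoothFieldAt_extend v)
  rwa [← OneForm.dForm_apply _ S.smoothFieldAt_ξ.mdiff (smoothFieldAt_extend v).mdiff,
    FiberBundle.extend_apply_self] at h

lemma φ_bracket_ξ (hX : SmoothFieldAt I X p) :
    S.φ.toFun p (mlieBracket I S.ξ (fun q => S.φ.toFun q (X q)) p) =
      S.φ.toFun p (S.φ.toFun p (mlieBracket I S.ξ X p)) := by
  have h := S.normal p S.ξ X S.smoothFieldAt_ξ hX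
  have h0 : (fun q => S.φ.toFun q (S.ξ q)) = 0 := funext fun q => S.φ_ξ q
  rw [AlmostContactMetric.sasakiHatakeyama, S.d_ξ hX, zero_smul, add_zero,
    EndField.nijenhuis, h0, mlieBracket_zero_left, mlieBracket_zero_left] at h
  simp only [Pi.zero_apply, map_zero, sub_zero, zero_add] at h
  exact (sub_eq_zero.1 h).symm

lemma d_φ_φ (hX : SmoothFieldAt I X p) (hY : SmoothFieldAt I Y p) :
    S.η.d (fun q => S.φ.toFun q (X q)) (fun q => S.φ.toFun q (Y q)) p = S.η.d X Y p := by
  have h := congrArg (S.η.toFun p) (S.normal p X Y hX hY)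
  rw [AlmostContactMetric.sasakiHatakeyama, EndField.nijenhuis] at h
  simp only [map_add, map_sub, map_smul, map_zero, S.η_φ, S.η_ξ, smul_eq_mul] at h
  have h0 (Z : (q : N) → TangentSpace I q) :
      (fun q => S.η.toFun q (S.φ.toFun q (Z q))) = fun _ => 0 := funext fun q => S.η_φ _
  rw [OneForm.d]
  simp only [h0, mvfderiv_const, _root_.zero_apply]
  linarith

lemma dForm_φ_φ (v w : TangentSpace I p) :
    S.η.dForm.toFun p (S.φ.toFun p v) (S.φ.toFun p w) = S.η.dForm.toFun p v w := by
  have hv := smoothFieldAt_extend (I := I) v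
  have hw := smoothFieldAt_extend (I := I) w
  have h := S.d_φ_φ hv hw
  rw [← OneForm.dForm_apply _ hv.mdiff hw.mdiff, ← OneForm.dForm_apply _
    (S.φ.smoothFieldAt_apply hv).mdiff (S.φ.smoothFieldAt_apply hw).mdiff] at h
  simpa only [FiberBundle.extend_apply_self] using h

end STStructure

end STAlgebra

section Curves

variable {E : Type*} [NormedAddCommGroup E] [NormedSpace ℝ E]
  {H : Type*} [TopologicalSpace H] {I : ModelWithCorners ℝ E H}
  {N : Type*} [TopologicalSpace N] [ChartedSpace H N]
  {F : Type*} [NormedAddCommGroup F] [NormedSpace ℝ F]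

lemma hasDerivAt_comp_integralCurve {V : (q : N) → TangentSpace I q} {γ : ℝ → N} {a b t : ℝ}
    (hγ : IsMIntegralCurveOn γ V (Ioo a b)) (ht : t ∈ Ioo a b) {u : N → F}
    (hu : MDifferentiableAt I 𝓘(ℝ, F) u (γ t)) :
    HasDerivAt (fun s => u (γ s)) (mvfderiv I u (γ t) (V (γ t))) t := by
  have h1 := (hγ t ht).hasMFDerivAt (Ioo_mem_nhds ht.1 ht.2)
  have h2 : HasFDerivAt (fun s => u (γ s)) (ContinuousLinearMap.comp (M₂ := E)
      (mvfderiv I u (γ t)) ((1 : ℝ →L[ℝ] ℝ).smulRight (M₂ := E) (V (γ t)))) t :=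
    (hu.hasMFDerivAt.comp t h1).hasFDerivAt
  convert! h2.hasDerivAt using 1
  exact congrArg (mvfderiv I u (γ t)) (one_smul ℝ (V (γ t))).symm

lemma continuousAt_of_integralCurve {V : (q : N) → TangentSpace I q} {γ : ℝ → N} {a b t : ℝ}
    (hγ : IsMIntegralCurveOn γ V (Ioo a b)) (ht : t ∈ Ioo a b) : ContinuousAt γ t :=
  ((hγ t ht).hasMFDerivAt (Ioo_mem_nhds ht.1 ht.2)).continuousAt

/-- `p` and `q` are joined by an integral curve of `V` contained in `O`. -/
def JoinedIn (V : (q : N) → TangentSpace I q) (O : Set N) (p q : N) : Prop :=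
  ∃ (γ : ℝ → N) (a b : ℝ), IsMIntegralCurveOn γ V (Ioo a b) ∧ (∀ t ∈ Ioo a b, γ t ∈ O) ∧
    ∃ s ∈ Ioo a b, ∃ t ∈ Ioo a b, γ s = p ∧ γ t = q

lemma JoinedIn.restrict {V : (q : N) → TangentSpace I q} {O : Set N} {γ : ℝ → N} {a b : ℝ}
    (hγ : IsMIntegralCurveOn γ V (Ioo a b)) (hO : ∀ t ∈ Ioo a b, γ t ∈ O) {s t : ℝ}
    (hs : s ∈ Ioo a b) (ht : t ∈ Ioo a b) : JoinedIn V O (γ s) (γ t) :=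
  ⟨γ, a, b, hγ, hO, s, hs, t, ht, rfl, rfl⟩

end Curves

section Descent

variable {E : Type*} [NormedAddCommGroup E] [NormedSpace ℝ E] [FiniteDimensional ℝ E]
  {H : Type*} [TopologicalSpace H] {I : ModelWithCorners ℝ E H} [I.Boundaryless]
  {N : Type*} [TopologicalSpace N] [ChartedSpace H N] [IsManifold I ∞ N]
  {E' : Type*} [NormedAddCommGroup E'] [NormedSpace ℝ E'] [FiniteDimensional ℝ E']
  {H' : Type*} [TopologicalSpace H'] {I' : ModelWithCorners ℝ E' H'} [I'.Boundaryless]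
  {M : Type*} [TopologicalSpace M] [ChartedSpace H' M] [IsManifold I' ∞ M]
  {F : Type*} [NormedAddCommGroup F] [NormedSpace ℝ F]

/-- `M` is the space of orbits of `ξ` on the open set `O`, and `pr` is the projection. -/
structure IsLeafProj (pr : N → M) (ξ : (q : N) → TangentSpace I q) (η : OneForm I N)
    (O : Set N) : Prop extends IsAdapted (I' := I') pr ξ η O where
  cover : ∀ x, ∃ p ∈ O, pr p = x
  const : ∀ p q, JoinedIn ξ O p q → pr p = pr q
  conn : ∀ p ∈ O, ∀ q ∈ O, pr p = pr q → Relation.EqvGen (JoinedIn ξ O) p q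

lemma smoothFieldAt_zero {p : N} : SmoothFieldAt I (0 : (q : N) → TangentSpace I q) p :=
  contMDiff_zeroSection ℝ (TangentSpace I : N → Type _) p

namespace IsAdapted

variable {pr : N → M} {ξ : (q : N) → TangentSpace I q} {η : OneForm I N} {O : Set N} {p : N}

lemma isRelatedNear_hlift (h : IsAdapted (I' := I') pr ξ η O) (hp : p ∈ O)
    (Y : (x : M) → TangentSpace I' x) :
    IsRelatedNear pr (fun q => hlift pr η q (Y (pr q))) Y p := by
  filter_upwards [h.isOpen.mem_nhds hp] with q hq
  exact h.mfderiv_hlift hq _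

/-- The bracket of `ξ` with a projectable field is vertical. -/
lemma bracket_ξ_eq_smul (h : IsAdapted (I' := I') pr ξ η O) (hp : p ∈ O)
    {X : (q : N) → TangentSpace I q} {Y : (x : M) → TangentSpace I' x}
    (hX : SmoothFieldAt I X p) (hY : SmoothFieldAt I' Y (pr p)) (hXY : IsRelatedNear pr X Y p) :
    mlieBracket I ξ X p = η.toFun p (mlieBracket I ξ X p) • ξ p := by
  refine h.eq_smul_of_mfderiv_eq_zero hp ?_
  have h0 : IsRelatedNear pr ξ (0 : (x : M) → TangentSpace I' x) p := by
    filter_upwards [h.isOpen.mem_nhds hp] with q hq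
    exact h.ker q hq
  rw [mfderiv_mlieBracket_of_related (h.smooth p hp) (h.smooth_ξ p hp) hX smoothFieldAt_zero hY
    h0 hXY, mlieBracket_zero_left]
  rfl

end IsAdapted

namespace IsLeafProj

variable {pr : N → M} {ξ : (q : N) → TangentSpace I q} {η : OneForm I N} {O : Set N} {p : N}

/-- A function that is locally, along the leaves, the restriction of a function annihilated by `ξ`
is constant along the leaves. -/
lemma eq_of_invariant (h : IsLeafProj (I' := I') pr ξ η O) {B : N → F} {x : M}
    (hB : ∀ p ∈ O, pr p = x → ∃ f : N → F, MDifferentiableAt I 𝓘(ℝ, F) f p ∧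
      mvfderiv I f p (ξ p) = 0 ∧ ∀ᶠ q in 𝓝 p, pr q = x → B q = f q)
    {p q : N} (hp : p ∈ O) (hq : q ∈ O) (hpx : pr p = x) (hqx : pr q = x) : B p = B q := by
  suffices H : ∀ {p q : N}, JoinedIn ξ O p q → pr p = x → B p = B q by
    have h1 := h.conn p hp q hq (hpx.trans hqx.symm)
    have h2 : ∀ {p q : N}, Relation.EqvGen (JoinedIn ξ O) p q → (pr p = x ↔ pr q = x) ∧
        (pr p = x → B p = B q) := by
      intro p q hpq
      induction hpq with
      | rel p q hpq => exact ⟨by rw [h.const p q hpq], H hpq⟩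
      | refl p => exact ⟨Iff.rfl, fun _ => rfl⟩
      | symm p q _ ih => exact ⟨ih.1.symm, fun hq => (ih.2 (ih.1.2 hq)).symm⟩
      | trans p q r _ _ ih ih' =>
        exact ⟨ih.1.trans ih'.1, fun hp => (ih.2 hp).trans (ih'.2 (ih.1.1 hp))⟩
    exact (h2 h1).2 hpx
  rintro p q ⟨γ, a, b, hγ, hO, s, hs, t, ht, rfl, rfl⟩ hsx
  have hx : ∀ r ∈ Ioo a b, pr (γ r) = x := fun r hr =>
    (h.const _ _ (.restrict hγ hO hr hs)).trans hsx
  have hd : ∀ r ∈ Ioo a b, HasDerivAt (fun r => B (γ r)) 0 r := by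
    intro r hr
    obtain ⟨f, hf, hf0, hBf⟩ := hB (γ r) (hO r hr) (hx r hr)
    have h1 := hasDerivAt_comp_integralCurve hγ hr hf
    rw [hf0] at h1
    refine h1.congr_of_eventuallyEq ?_
    filter_upwards [(continuousAt_of_integralCurve hγ hr).eventually hBf, Ioo_mem_nhds hr.1 hr.2] with r' h2 h3
    exact h2 (hx r' h3)
  exact isOpen_Ioo.is_const_of_deriv_eq_zero isPreconnected_Ioo
    (fun r hr => (hd r hr).differentiableAt.differentiableWithinAt) (fun r hr => (hd r hr).deriv)
    hs ht

/-- Descent of a `1`-form. -/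
theorem exists_oneForm (h : IsLeafProj (I' := I') pr ξ η O)
    (T : (q : N) → TangentSpace I q →L[ℝ] ℝ)
    (hT : ∀ p ∈ O, ∀ X, SmoothFieldAt I X p → ContMDiffAt I 𝓘(ℝ, ℝ) ∞ (fun q => T q (X q)) p)
    (hinv : ∀ p ∈ O, ∀ Y : (x : M) → TangentSpace I' x, SmoothFieldAt I' Y (pr p) →
      mvfderiv I (fun q => T q (hlift pr η q (Y (pr q)))) p (ξ p) = 0) :
    ∃ α : OneForm I' M, ∀ p ∈ O, ∀ w : TangentSpace I' (pr p),
      α.toFun (pr p) w = T p (hlift pr η p w) := by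
  choose s hsO hs using h.cover
  let b (x : M) : TangentSpace I' x →L[ℝ] ℝ :=
    show E' →L[ℝ] ℝ from (T (s x)).comp (hlift (I := I) (I' := I') pr η (s x))
  have key : ∀ p ∈ O, ∀ w : TangentSpace I' (pr p), b (pr p) w = T p (hlift pr η p w) := by
    intro p hp w
    refine h.eq_of_invariant (B := fun q => T q (hlift pr η q (show E' from w))) (x := pr p) ?_
      (hsO _) hp (hs _) rfl
    intro q hq hqx
    let Y : (x : M) → TangentSpace I' x :=
      FiberBundle.extend E' (show TangentSpace I' (pr p) from w)
    have hYw : Y (pr p) = w := FiberBundle.extend_apply_self ..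
    have hY : SmoothFieldAt I' Y (pr q) := by rw [hqx]; exact smoothFieldAt_extend _
    refine ⟨fun q => T q (hlift pr η q (Y (pr q))),
      (hT q hq _ (h.smoothFieldAt_hlift hq hY)).mdifferentiableAt (by simp), hinv q hq Y hY,
      .of_forall fun r hr => ?_⟩
    have : (show E' from Y (pr r)) = w := by rw [hr]; exact hYw
    exact congrArg (fun w : E' => T r (hlift pr η r w)) this.symm
  refine ⟨⟨b, fun x => ?_⟩, key⟩
  obtain ⟨p, hp, rfl⟩ := h.cover x
  refine contMDiffAt_oneForm fun Y hY => contMDiffAt_of_comp (h.smooth p hp) (h.surj p hp) ?_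
  refine (hT p hp _ (h.smoothFieldAt_hlift hp hY)).congr_of_eventuallyEq ?_
  filter_upwards [h.isOpen.mem_nhds hp] with q hq
  exact key q hq _

/-- Descent of a bilinear form. -/
theorem exists_bilin (h : IsLeafProj (I' := I') pr ξ η O)
    (T : (q : N) → TangentSpace I q →L[ℝ] TangentSpace I q →L[ℝ] ℝ)
    (hT : ∀ p ∈ O, ∀ X X', SmoothFieldAt I X p → SmoothFieldAt I X' p →
      ContMDiffAt I 𝓘(ℝ, ℝ) ∞ (fun q => T q (X q) (X' q)) p)
    (hinv : ∀ p ∈ O, ∀ Y Y' : (x : M) → TangentSpace I' x, SmoothFieldAt I' Y (pr p) →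
      SmoothFieldAt I' Y' (pr p) →
      mvfderiv I (fun q => T q (hlift pr η q (Y (pr q))) (hlift pr η q (Y' (pr q)))) p (ξ p) = 0) :
    ∃ b : (x : M) → TangentSpace I' x →L[ℝ] TangentSpace I' x →L[ℝ] ℝ,
      (∀ p ∈ O, ∀ w w' : TangentSpace I' (pr p),
        b (pr p) w w' = T p (hlift pr η p w) (hlift pr η p w')) ∧
      ContMDiff I' (I'.prod 𝓘(ℝ, E' →L[ℝ] E' →L[ℝ] ℝ)) ∞
        (fun x => TotalSpace.mk' (E' →L[ℝ] E' →L[ℝ] ℝ)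
          (E := fun x : M => TangentSpace I' x →L[ℝ] TangentSpace I' x →L[ℝ] ℝ) x (b x)) := by
  choose s hsO hs using h.cover
  let b (x : M) : TangentSpace I' x →L[ℝ] TangentSpace I' x →L[ℝ] ℝ :=
    ContinuousLinearMap.bilinearComp (E := E) (F := E) (G := ℝ) (E' := E') (F' := E') (T (s x))
      (hlift (I := I) (I' := I') pr η (s x)) (hlift (I := I) (I' := I') pr η (s x))
  have key : ∀ p ∈ O, ∀ w w' : TangentSpace I' (pr p),
      b (pr p) w w' = T p (hlift pr η p w) (hlift pr η p w') := by
    intro p hp w w'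
    refine h.eq_of_invariant (B := fun q => T q (hlift pr η q (show E' from w))
      (hlift pr η q (show E' from w'))) (x := pr p) ?_ (hsO _) hp (hs _) rfl
    intro q hq hqx
    let Y : (x : M) → TangentSpace I' x :=
      FiberBundle.extend E' (show TangentSpace I' (pr p) from w)
    let Y' : (x : M) → TangentSpace I' x :=
      FiberBundle.extend E' (show TangentSpace I' (pr p) from w')
    have hYw : Y (pr p) = w := FiberBundle.extend_apply_self ..
    have hYw' : Y' (pr p) = w' := FiberBundle.extend_apply_self ..
    have hY : SmoothFieldAt I' Y (pr q) := by rw [hqx]; exact smoothFieldAt_extend _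
    have hY' : SmoothFieldAt I' Y' (pr q) := by rw [hqx]; exact smoothFieldAt_extend _
    refine ⟨fun q => T q (hlift pr η q (Y (pr q))) (hlift pr η q (Y' (pr q))),
      (hT q hq _ _ (h.smoothFieldAt_hlift hq hY) (h.smoothFieldAt_hlift hq hY')).mdifferentiableAt
        (by simp), hinv q hq Y Y' hY hY', .of_forall fun r hr => ?_⟩
    have h1 : (show E' from Y (pr r)) = w := by rw [hr]; exact hYw
    have h2 : (show E' from Y' (pr r)) = w' := by rw [hr]; exact hYw'
    exact congrArg₂ (fun w w' : E' => T r (hlift pr η r w) (hlift pr η r w')) h1.symm h2.symm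
  refine ⟨b, key, fun x => ?_⟩
  obtain ⟨p, hp, rfl⟩ := h.cover x
  refine contMDiffAt_bilinForm fun Y Y' hY hY' =>
    contMDiffAt_of_comp (h.smooth p hp) (h.surj p hp) ?_
  refine (hT p hp _ _ (h.smoothFieldAt_hlift hp hY)
    (h.smoothFieldAt_hlift hp hY')).congr_of_eventuallyEq ?_
  filter_upwards [h.isOpen.mem_nhds hp] with q hq
  exact key q hq _ _

/-- Descent of an endomorphism field. -/
theorem exists_endField (h : IsLeafProj (I' := I') pr ξ η O) (A : EndField I N)
    (hinv : ∀ p ∈ O, ∀ Y : (x : M) → TangentSpace I' x, SmoothFieldAt I' Y (pr p) →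
      mfderiv I I' pr p
        (mlieBracket I ξ (fun q => A.toFun q (hlift pr η q (Y (pr q)))) p) = 0) :
    ∃ J : EndField I' M, ∀ p ∈ O, ∀ w : TangentSpace I' (pr p),
      J.toFun (pr p) w = mfderiv I I' pr p (A.toFun p (hlift pr η p w)) := by
  choose s hsO hs using h.cover
  have hprd {q : N} (hq : q ∈ O) : MDifferentiableAt I I' pr q :=
    (h.smooth q hq).mdifferentiableAt (by simp)
  let b (x : M) : TangentSpace I' x →L[ℝ] TangentSpace I' x :=
    show E' →L[ℝ] E' from
      ((mfderiv I I' pr (s x)).comp (A.toFun (s x))).comp (hlift (I := I) (I' := I') pr η (s x))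
  have key : ∀ p ∈ O, ∀ w : TangentSpace I' (pr p),
      b (pr p) w = mfderiv I I' pr p (A.toFun p (hlift pr η p w)) := by
    intro p hp w
    set u := extChartAt I' (pr p) with hu
    let L : E' →L[ℝ] E' := mvfderiv I' u (pr p)
    let B (q : N) : E' :=
      L (show E' from mfderiv I I' pr q (A.toFun q (hlift (I' := I') pr η q (show E' from w))))
    have hus : ContMDiffAt I' 𝓘(ℝ, E') ∞ u (pr p) := contMDiffAt_extChartAt
    have hud := eventually_mdifferentiableAt hus (by simp)
    have hB : B (s (pr p)) = B p := by
      refine h.eq_of_invariant (x := pr p) ?_ (hsO _) hp (hs _) rfl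
      intro q hq hqx
      let Y : (x : M) → TangentSpace I' x :=
        FiberBundle.extend E' (show TangentSpace I' (pr p) from w)
      have hYw : Y (pr p) = w := FiberBundle.extend_apply_self ..
      have hY : SmoothFieldAt I' Y (pr q) := by rw [hqx]; exact smoothFieldAt_extend _
      have hus' : ContMDiffAt I' 𝓘(ℝ, E') ∞ u (pr q) := by rw [hqx]; exact hus
      have hupr : ContMDiffAt I 𝓘(ℝ, E') ∞ (fun q => u (pr q)) q := hus'.comp q (h.smooth q hq)
      let Z (q : N) : TangentSpace I q := A.toFun q (hlift pr η q (Y (pr q)))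
      have hZ : SmoothFieldAt I Z q := A.smoothFieldAt_apply (h.smoothFieldAt_hlift hq hY)
      have hsm := hZ.mvfderiv hupr
      have hev : ∀ᶠ r in 𝓝 q, MDifferentiableAt I' 𝓘(ℝ, E') u (pr r) := by
        refine (h.smooth q hq).continuousAt.eventually ?_
        rw [hqx]; exact hud
      refine ⟨fun q => mvfderiv I (fun q => u (pr q)) q (Z q), hsm.mdifferentiableAt (by simp),
        ?_, ?_⟩
      · have h1 := mvfderiv_mlieBracket (hupr.of_le two_le_infty) ((h.smooth_ξ q hq).of_le 1)
          (hZ.of_le 1)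
        have h2 : (fun q => mvfderiv I (fun q => u (pr q)) q (ξ q)) =ᶠ[𝓝 q] fun _ => 0 := by
          filter_upwards [hev, h.isOpen.mem_nhds hq] with r hr hrO
          rw [mvfderiv_comp_mfderiv hr (hprd hrO), h.ker r hrO, map_zero]
        rw [mvfderiv_comp_mfderiv hev.self_of_nhds (hprd hq), hinv q hq Y hY, map_zero,
          mvfderiv_congr h2, mvfderiv_const, _root_.zero_apply, sub_zero] at h1
        exact h1.symm
      · filter_upwards [hev, h.isOpen.mem_nhds hq] with r hr hrO hrx
        rw [mvfderiv_comp_mfderiv hr (hprd hrO)]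
        have h1 : (show E' from Y (pr r)) = w := by rw [hrx]; exact hYw
        have h2 : (show E' →L[ℝ] E' from mvfderiv I' u (pr r)) = L := by rw [hrx]
        have h3 := congrArg₂ (fun (L : E' →L[ℝ] E') (w : E') => L (show E' from mfderiv I I' pr r
          (A.toFun r (hlift (I' := I') pr η r w)))) h2.symm h1.symm
        exact h3
    exact mvfderiv_extChartAt_injective (mem_extChartAt_source (I := I') (pr p)) hB
  refine ⟨⟨b, fun x => ?_⟩, key⟩
  obtain ⟨p, hp, rfl⟩ := h.cover x
  refine contMDiffAt_endField fun Y hY => smoothFieldAt_of_extChartAt ?_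
  refine contMDiffAt_of_comp (h.smooth p hp) (h.surj p hp) ?_
  have hus : ContMDiffAt I' 𝓘(ℝ, E') ∞ (extChartAt I' (pr p)) (pr p) := contMDiffAt_extChartAt
  have hZ : SmoothFieldAt I (fun q => A.toFun q (hlift pr η q (Y (pr q)))) p :=
    A.smoothFieldAt_apply (h.smoothFieldAt_hlift hp hY)
  refine (hZ.mvfderiv (hus.comp p (h.smooth p hp))).congr_of_eventuallyEq ?_
  filter_upwards [h.isOpen.mem_nhds hp, (h.smooth p hp).continuousAt.eventually
    (eventually_mdifferentiableAt hus (by simp))] with q hq hqd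
  rw [key q hq]
  exact (mvfderiv_comp_mfderiv hqd (hprd hq) _).symm

end IsLeafProj

end Descent

section DescentST

variable {E : Type*} [NormedAddCommGroup E] [NormedSpace ℝ E] [FiniteDimensional ℝ E]
  {H : Type*} [TopologicalSpace H] {I : ModelWithCorners ℝ E H} [I.Boundaryless]
  {N : Type*} [TopologicalSpace N] [ChartedSpace H N] [IsManifold I ∞ N]
  {E' : Type*} [NormedAddCommGroup E'] [NormedSpace ℝ E'] [FiniteDimensional ℝ E']
  {H' : Type*} [TopologicalSpace H'] {I' : ModelWithCorners ℝ E' H'} [I'.Boundaryless]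
  {M : Type*} [TopologicalSpace M] [ChartedSpace H' M] [IsManifold I' ∞ M]

/-- If `A` and `J` are intertwined by `pr`, so are their Nijenhuis brackets. -/
lemma mfderiv_nijenhuis {pr : N → M} {p : N} (hpr : ContMDiffAt I I' ∞ pr p)
    {A : EndField I N} {J : EndField I' M}
    (hAJ : ∀ᶠ q in 𝓝 p, ∀ v, mfderiv I I' pr q (A.toFun q v) = J.toFun (pr q) (mfderiv I I' pr q v))
    {X₁ X₂ : (q : N) → TangentSpace I q} {Y₁ Y₂ : (x : M) → TangentSpace I' x}
    (hX₁ : SmoothFieldAt I X₁ p) (hX₂ : SmoothFieldAt I X₂ p)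
    (hY₁ : SmoothFieldAt I' Y₁ (pr p)) (hY₂ : SmoothFieldAt I' Y₂ (pr p))
    (h₁ : IsRelatedNear pr X₁ Y₁ p) (h₂ : IsRelatedNear pr X₂ Y₂ p) :
    mfderiv I I' pr p (A.nijenhuis X₁ X₂ p) = J.nijenhuis Y₁ Y₂ (pr p) := by
  have hrel {X : (q : N) → TangentSpace I q} {Y : (x : M) → TangentSpace I' x}
      (h : IsRelatedNear pr X Y p) :
      IsRelatedNear pr (fun q => A.toFun q (X q)) (fun x => J.toFun x (Y x)) p := by
    filter_upwards [hAJ, h] with q h1 h2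
    rw [h1, h2]
  have hAX₁ := A.smoothFieldAt_apply hX₁
  have hAX₂ := A.smoothFieldAt_apply hX₂
  have hJY₁ := J.smoothFieldAt_apply hY₁
  have hJY₂ := J.smoothFieldAt_apply hY₂
  have hp := hAJ.self_of_nhds
  rw [EndField.nijenhuis, EndField.nijenhuis, map_sub, map_sub, map_add, hp, hp, hp, hp,
    mfderiv_mlieBracket_of_related hpr hAX₁ hAX₂ hJY₁ hJY₂ (hrel h₁) (hrel h₂),
    mfderiv_mlieBracket_of_related hpr hX₁ hX₂ hY₁ hY₂ h₁ h₂,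
    mfderiv_mlieBracket_of_related hpr hAX₁ hX₂ hJY₁ hY₂ (hrel h₁) h₂,
    mfderiv_mlieBracket_of_related hpr hX₁ hAX₂ hY₁ hJY₂ h₁ (hrel h₂)]

/-- If `τ = c • pr^* σ` then `dτ = c • pr^* dσ`. -/
lemma TwoForm.d_of_pullback {pr : N → M} {p : N} (hpr : ContMDiffAt I I' ∞ pr p)
    {τ : TwoForm I N} {σ : TwoForm I' M} {c : ℝ}
    (hτ : ∀ᶠ q in 𝓝 p, ∀ v w, τ.toFun q v w =
      c * σ.toFun (pr q) (mfderiv I I' pr q v) (mfderiv I I' pr q w))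
    {X₁ X₂ X₃ : (q : N) → TangentSpace I q} {Y₁ Y₂ Y₃ : (x : M) → TangentSpace I' x}
    (hX₁ : SmoothFieldAt I X₁ p) (hX₂ : SmoothFieldAt I X₂ p) (hX₃ : SmoothFieldAt I X₃ p)
    (hY₁ : SmoothFieldAt I' Y₁ (pr p)) (hY₂ : SmoothFieldAt I' Y₂ (pr p))
    (hY₃ : SmoothFieldAt I' Y₃ (pr p))
    (h₁ : IsRelatedNear pr X₁ Y₁ p) (h₂ : IsRelatedNear pr X₂ Y₂ p)
    (h₃ : IsRelatedNear pr X₃ Y₃ p) :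
    τ.d X₁ X₂ X₃ p = c * σ.d Y₁ Y₂ Y₃ (pr p) := by
  have hprd := hpr.mdifferentiableAt (by simp)
  have key {X X' X'' : (q : N) → TangentSpace I q} {Y Y' Y'' : (x : M) → TangentSpace I' x}
      (hY : SmoothFieldAt I' Y (pr p)) (hY' : SmoothFieldAt I' Y' (pr p))
      (h : IsRelatedNear pr X Y p) (h' : IsRelatedNear pr X' Y' p)
      (h'' : IsRelatedNear pr X'' Y'' p) :
      mvfderiv I (fun q => τ.toFun q (X q) (X' q)) p (X'' p) =
        c * mvfderiv I' (fun x => σ.toFun x (Y x) (Y' x)) (pr p) (Y'' (pr p)) := by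
    have h1 : (fun q => τ.toFun q (X q) (X' q)) =ᶠ[𝓝 p]
        fun q => c * σ.toFun (pr q) (Y (pr q)) (Y' (pr q)) := by
      filter_upwards [hτ, h, h'] with q h1 h2 h3
      rw [h1, h2, h3]
    have hd := (σ.contMDiffAt_apply hY hY').mdifferentiableAt (by simp)
    have h2 := mvfderiv_comp_mfderiv (u := fun x => c * σ.toFun x (Y x) (Y' x))
      (hd.const_smul c) hprd (X'' p)
    have h3 : mvfderiv I' (fun x => c * σ.toFun x (Y x) (Y' x)) (pr p) =
      c • mvfderiv I' (fun x => σ.toFun x (Y x) (Y' x)) (pr p) :=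
      const_smul_mfderiv hd c
    rw [mvfderiv_congr h1, h2, h''.self_of_nhds, h3]
    rfl
  have hp := hτ.self_of_nhds
  rw [TwoForm.d, TwoForm.d, key hY₂ hY₃ h₂ h₃ h₁, key hY₁ hY₃ h₁ h₃ h₂, key hY₁ hY₂ h₁ h₂ h₃,
    hp, hp, hp, mfderiv_mlieBracket_of_related hpr hX₁ hX₂ hY₁ hY₂ h₁ h₂,
    mfderiv_mlieBracket_of_related hpr hX₁ hX₃ hY₁ hY₃ h₁ h₃,
    mfderiv_mlieBracket_of_related hpr hX₂ hX₃ hY₂ hY₃ h₂ h₃, h₁.self_of_nhds, h₂.self_of_nhds,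
    h₃.self_of_nhds]
  ring

lemma hasCurvature_iff {pr : N → M} {η : OneForm I N} {σ : TwoForm I' M} :
    HasCurvature η σ pr ↔ ∀ p v w, (1 / (2 * Real.pi)) * η.dForm.toFun p v w =
      σ.toFun (pr p) (mfderiv I I' pr p v) (mfderiv I I' pr p w) := by
  constructor
  · intro h p v w
    have hv := smoothFieldAt_extend (I := I) v
    have hw := smoothFieldAt_extend (I := I) w
    have := h p _ _ hv hw
    rw [← OneForm.dForm_apply _ hv.mdiff hw.mdiff] at this
    simpa only [FiberBundle.extend_apply_self] using this
  · intro h p X Y hX hY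
    rw [← OneForm.dForm_apply _ hX.mdiff hY.mdiff, h]

/-- A Riemannian metric with given inner product. -/
def Metric.ofInner (b : (x : N) → TangentSpace I x →L[ℝ] TangentSpace I x →L[ℝ] ℝ)
    (symm : ∀ x v w, b x v w = b x w v) (pos : ∀ x v, v ≠ 0 → 0 < b x v v)
    (smooth : ContMDiff I (I.prod 𝓘(ℝ, E →L[ℝ] E →L[ℝ] ℝ)) ∞
        (fun x => TotalSpace.mk' (E →L[ℝ] E →L[ℝ] ℝ)
          (E := fun x : N => TangentSpace I x →L[ℝ] TangentSpace I x →L[ℝ] ℝ) x (b x))) :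
    Metric I N where
  inner := b
  symm := symm
  pos := pos
  isVonNBounded x := isVonNBounded_of_posDef (E := E) (b x) (pos x)
  contMDiff := smooth

namespace STStructure

variable {S : STStructure I N} {pr : N → M} {O : Set N} {p : N}

lemma mvfderiv_g_hlift (h : IsAdapted (I' := I') pr S.ξ S.η O) (hp : p ∈ O)
    {Y Y' : (x : M) → TangentSpace I' x} (hY : SmoothFieldAt I' Y (pr p))
    (hY' : SmoothFieldAt I' Y' (pr p)) :
    mvfderiv I (fun q => S.g.inner q (hlift pr S.η q (Y (pr q))) (hlift pr S.η q (Y' (pr q)))) p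
      (S.ξ p) = 0 := by
  have hX := h.smoothFieldAt_hlift hp hY
  have hX' := h.smoothFieldAt_hlift hp hY'
  rw [S.killing p _ _ hX hX', h.bracket_ξ_eq_smul hp hX hY (h.isRelatedNear_hlift hp Y),
    h.bracket_ξ_eq_smul hp hX' hY' (h.isRelatedNear_hlift hp Y'), map_smul, map_smul,
    S.g.symm p _ (S.ξ p), _root_.smul_apply, ← S.dual, ← S.dual, h.form_hlift hp, h.form_hlift hp]
  simp

lemma mvfderiv_dForm_hlift (h : IsAdapted (I' := I') pr S.ξ S.η O) (hp : p ∈ O)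
    {Y Y' : (x : M) → TangentSpace I' x} (hY : SmoothFieldAt I' Y (pr p))
    (hY' : SmoothFieldAt I' Y' (pr p)) :
    mvfderiv I (fun q => S.η.dForm.toFun q (hlift pr S.η q (Y (pr q)))
      (hlift pr S.η q (Y' (pr q)))) p (S.ξ p) = 0 := by
  have hX := h.smoothFieldAt_hlift hp hY
  have hX' := h.smoothFieldAt_hlift hp hY'
  have hcl := S.η.dForm_isClosed p _ _ _ S.smoothFieldAt_ξ hX hX'
  have h0 (q : N) (v : TangentSpace I q) : S.η.dForm.toFun q v (S.ξ q) = 0 := by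
    have h1 := S.η.dForm.alternating q (v + S.ξ q)
    simp only [map_add, _root_.add_apply, S.dForm_ξ, S.η.dForm.alternating] at h1
    linarith
  rw [TwoForm.d, h.bracket_ξ_eq_smul hp hX hY (h.isRelatedNear_hlift hp Y),
    h.bracket_ξ_eq_smul hp hX' hY' (h.isRelatedNear_hlift hp Y')] at hcl
  simp only [S.dForm_ξ, h0, mvfderiv_const, _root_.zero_apply, map_smul, _root_.smul_apply,
    smul_zero] at hcl
  linarith

lemma mfderiv_bracket_φ_hlift (h : IsAdapted (I' := I') pr S.ξ S.η O) (hp : p ∈ O)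
    {Y : (x : M) → TangentSpace I' x} (hY : SmoothFieldAt I' Y (pr p)) :
    mfderiv I I' pr p (mlieBracket I S.ξ (fun q => S.φ.toFun q (hlift pr S.η q (Y (pr q)))) p)
      = 0 := by
  have hX := h.smoothFieldAt_hlift hp hY
  have h1 := S.φ_bracket_ξ hX
  rw [h.bracket_ξ_eq_smul hp hX hY (h.isRelatedNear_hlift hp Y), map_smul, S.φ_ξ, smul_zero,
    map_zero] at h1
  rw [S.eq_smul_of_φ_eq_zero h1, map_smul, h.ker p hp, smul_zero]

lemma dForm_eq_hlift (h : IsAdapted (I' := I') pr S.ξ S.η O) (hp : p ∈ O) (v w : TangentSpace I p) :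
    S.η.dForm.toFun p v w = S.η.dForm.toFun p (hlift pr S.η p (mfderiv I I' pr p v))
      (hlift pr S.η p (mfderiv I I' pr p w)) := by
  have h0 : ∀ v : TangentSpace I p, S.η.dForm.toFun p v (S.ξ p) = 0 := by
    intro v
    have h1 := S.η.dForm.alternating p (v + S.ξ p)
    simp only [map_add, _root_.add_apply, S.dForm_ξ, S.η.dForm.alternating] at h1
    linarith
  rw [h.hlift_mfderiv hp, h.hlift_mfderiv hp]
  simp [h0, S.dForm_ξ]

/-- The structure induced on the space of orbits of the Reeb field. -/
theorem exists_hermitian (h : IsLeafProj (I' := I') pr S.ξ S.η O) :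
    ∃ (K : HermitianStructure I' M) (σ : TwoForm I' M), σ.IsClosed ∧ σ.IsOneOne K.J ∧
      ∀ p ∈ O,
        (∀ v w : TangentSpace I p, K.h.inner (pr p) (mfderiv I I' pr p v) (mfderiv I I' pr p w) =
          S.g.inner p v w - S.η.toFun p v * S.η.toFun p w) ∧
        (∀ v : TangentSpace I p,
          mfderiv I I' pr p (S.φ.toFun p v) = K.J.toFun (pr p) (mfderiv I I' pr p v)) ∧
        ∀ v w : TangentSpace I p, (1 / (2 * Real.pi)) * S.η.dForm.toFun p v w =
          σ.toFun (pr p) (mfderiv I I' pr p v) (mfderiv I I' pr p w) := by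
  have ha := h.toIsAdapted
  obtain ⟨b, hb, hbs⟩ := h.exists_bilin (fun q => S.g.inner q)
    (fun p _ X X' hX hX' => S.g.contMDiffAt_apply hX hX')
    (fun p hp Y Y' hY hY' => mvfderiv_g_hlift ha hp hY hY')
  obtain ⟨s, hs, hss⟩ := h.exists_bilin (fun q => S.η.dForm.toFun q)
    (fun p _ X X' hX hX' => S.η.dForm.contMDiffAt_apply hX hX')
    (fun p hp Y Y' hY hY' => mvfderiv_dForm_hlift ha hp hY hY')
  obtain ⟨J, hJ⟩ := h.exists_endField S.φ fun p hp Y hY => mfderiv_bracket_φ_hlift ha hp hY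
  have hφ : ∀ p ∈ O, ∀ w : TangentSpace I' (pr p),
      hlift pr S.η p (J.toFun (pr p) w) = S.φ.toFun p (hlift pr S.η p w) := by
    intro p hp w
    rw [hJ p hp, ha.hlift_mfderiv hp, S.η_φ, zero_smul, sub_zero]
  have hJφ : ∀ p ∈ O, ∀ v : TangentSpace I p,
      mfderiv I I' pr p (S.φ.toFun p v) = J.toFun (pr p) (mfderiv I I' pr p v) := by
    intro p hp v
    rw [hJ p hp, ha.hlift_mfderiv hp, map_sub, map_smul, S.φ_ξ, smul_zero, sub_zero]
  have hbv : ∀ p ∈ O, ∀ v w : TangentSpace I p,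
      b (pr p) (mfderiv I I' pr p v) (mfderiv I I' pr p w) =
        S.g.inner p v w - S.η.toFun p v * S.η.toFun p w := by
    intro p hp v w
    rw [hb p hp, ha.hlift_mfderiv hp, ha.hlift_mfderiv hp]
    simp only [map_sub, map_smul, _root_.sub_apply, _root_.smul_apply, smul_eq_mul,
      S.g.symm p v (S.ξ p), ← S.dual, S.η_ξ]
    ring
  let σ : TwoForm I' M :=
    { toFun := fun x => (1 / (2 * Real.pi)) • s x
      alternating := fun x w => by
        obtain ⟨p, hp, rfl⟩ := h.cover x
        rw [_root_.smul_apply, _root_.smul_apply, hs p hp, S.η.dForm.alternating, smul_zero]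
      smooth := fun x => ContMDiffAt.smul_section
        (V := fun x : M => TangentSpace I' x →L[ℝ] TangentSpace I' x →L[ℝ] ℝ)
        (contMDiffAt_const (c := 1 / (2 * Real.pi))) (hss x) }
  have hσ : ∀ p ∈ O, ∀ v w : TangentSpace I p, (1 / (2 * Real.pi)) * S.η.dForm.toFun p v w =
      σ.toFun (pr p) (mfderiv I I' pr p v) (mfderiv I I' pr p w) := by
    intro p hp v w
    rw [dForm_eq_hlift ha hp v w]
    exact congrArg _ (hs p hp _ _).symm
  let K : HermitianStructure I' M :=
    { h := Metric.ofInner b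
        (fun x w w' => by
          obtain ⟨p, hp, rfl⟩ := h.cover x
          rw [hb p hp, hb p hp, S.g.symm])
        (fun x w hw => by
          obtain ⟨p, hp, rfl⟩ := h.cover x
          rw [hb p hp]
          refine S.g.pos p _ fun h0 => hw ?_
          rw [← ha.mfderiv_hlift hp w, h0, map_zero]) hbs
      J := J
      J_sq := fun x w => by
        obtain ⟨p, hp, rfl⟩ := h.cover x
        rw [hJ p hp, hφ p hp, S.φ_sq, ha.form_hlift hp, zero_smul, add_zero, map_neg,
          ha.mfderiv_hlift hp]
      compat := fun x w w' => by
        obtain ⟨p, hp, rfl⟩ := h.cover x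
        show b _ _ _ = b _ _ _
        rw [hb p hp, hb p hp, hφ p hp, hφ p hp, S.compat, ha.form_hlift hp, zero_mul, sub_zero]
      integrable := fun x Y Y' hY hY' => by
        obtain ⟨p, hp, rfl⟩ := h.cover x
        have hX := ha.smoothFieldAt_hlift hp hY
        have hX' := ha.smoothFieldAt_hlift hp hY'
        rw [← mfderiv_nijenhuis (A := S.φ) (h.smooth p hp) (by
            filter_upwards [h.isOpen.mem_nhds hp] with q hq using hJφ q hq) hX hX' hY hY'
          (ha.isRelatedNear_hlift hp Y) (ha.isRelatedNear_hlift hp Y')]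
        rw [eq_neg_of_add_eq_zero_left (S.normal p _ _ hX hX'), map_neg, map_smul, ha.ker p hp,
          smul_zero, neg_zero] }
  refine ⟨K, σ, ?_, ?_, fun p hp => ⟨hbv p hp, hJφ p hp, hσ p hp⟩⟩
  · intro x Y₁ Y₂ Y₃ hY₁ hY₂ hY₃
    obtain ⟨p, hp, rfl⟩ := h.cover x
    have hX₁ := ha.smoothFieldAt_hlift hp hY₁
    have hX₂ := ha.smoothFieldAt_hlift hp hY₂
    have hX₃ := ha.smoothFieldAt_hlift hp hY₃
    have h1 := TwoForm.d_of_pullback (τ := S.η.dForm) (σ := σ) (c := 2 * Real.pi) (h.smooth p hp) (by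
        filter_upwards [h.isOpen.mem_nhds hp] with q hq v w
        rw [← hσ q hq]
        field_simp) hX₁ hX₂ hX₃ hY₁ hY₂ hY₃ (ha.isRelatedNear_hlift hp Y₁)
      (ha.isRelatedNear_hlift hp Y₂) (ha.isRelatedNear_hlift hp Y₃)
    rw [S.η.dForm_isClosed p _ _ _ hX₁ hX₂ hX₃] at h1
    exact (mul_eq_zero.1 h1.symm).resolve_left (by positivity)
  · intro x w w'
    obtain ⟨p, hp, rfl⟩ := h.cover x
    rw [← ha.mfderiv_hlift hp w, ← ha.mfderiv_hlift hp w', ← hJφ p hp, ← hJφ p hp, ← hσ p hp,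
      ← hσ p hp, S.dForm_φ_φ]

end STStructure

end DescentST

section Compatible

variable {E : Type*} [NormedAddCommGroup E] [NormedSpace ℝ E] [FiniteDimensional ℝ E]
  {H : Type*} [TopologicalSpace H] {I : ModelWithCorners ℝ E H} [I.Boundaryless]
  {N : Type*} [TopologicalSpace N] [ChartedSpace H N] [IsManifold I ∞ N]
  {E' : Type*} [NormedAddCommGroup E'] [NormedSpace ℝ E'] [FiniteDimensional ℝ E']
  {H' : Type*} [TopologicalSpace H'] {I' : ModelWithCorners ℝ E' H'} [I'.Boundaryless]
  {M : Type*} [TopologicalSpace M] [ChartedSpace H' M] [IsManifold I' ∞ M]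
  {S : STStructure I N} {K : HermitianStructure I' M} {σ : TwoForm I' M} {pr : N → M}

lemma isCompatible_iff (h : IsAdapted (I' := I') pr S.ξ S.η univ)
    (hpr : Function.Surjective pr) :
    IsCompatible S K σ pr ↔ ∀ p,
      (∀ v w : TangentSpace I p, K.h.inner (pr p) (mfderiv I I' pr p v) (mfderiv I I' pr p w) =
          S.g.inner p v w - S.η.toFun p v * S.η.toFun p w) ∧
      (∀ v : TangentSpace I p,
          mfderiv I I' pr p (S.φ.toFun p v) = K.J.toFun (pr p) (mfderiv I I' pr p v)) ∧
      ∀ v w : TangentSpace I p, (1 / (2 * Real.pi)) * S.η.dForm.toFun p v w =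
          σ.toFun (pr p) (mfderiv I I' pr p v) (mfderiv I I' pr p w) := by
  constructor
  · rintro ⟨⟨_, h1⟩, h2, h3⟩ p
    refine ⟨fun v w => ?_, h2 p, hasCurvature_iff.1 h3 p⟩
    have hhor : ∀ v u : TangentSpace I p, mfderiv I I' pr p u = 0 →
        S.g.inner p (v - S.η.toFun p v • S.ξ p) u = 0 := by
      intro v u hu
      rw [h.eq_smul_of_mfderiv_eq_zero (mem_univ p) hu, map_smul, S.g.symm p _ (S.ξ p), ← S.dual,
        map_sub, map_smul, S.η_ξ]
      simp
    have := h1 p _ _ (hhor v) (hhor w)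
    simp only [map_sub, map_smul, h.ker p (mem_univ p), smul_zero, sub_zero] at this
    rw [this]
    simp only [_root_.sub_apply, _root_.smul_apply, smul_eq_mul, S.g.symm p v (S.ξ p), ← S.dual,
      S.η_ξ]
    ring
  · intro hp
    refine ⟨⟨⟨fun p => h.smooth p (mem_univ p), hpr, fun p => h.surj p (mem_univ p)⟩,
      fun p v w hv _ => ?_⟩, fun p => (hp p).2.1, hasCurvature_iff.2 fun p => (hp p).2.2⟩
    rw [(hp p).1, S.dual p v, S.g.symm p (S.ξ p), hv _ (h.ker p (mem_univ p)), zero_mul, sub_zero]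

lemma Metric.eq_of_inner {g g' : Metric I N} (h : ∀ p v w, g.inner p v w = g'.inner p v w) :
    g = g' := by
  cases g
  cases g'
  congr
  funext p
  ext v w
  exact h p v w

/-- The structure on the base is determined by the structure on the total space. -/
lemma IsCompatible.base_unique {K' : HermitianStructure I' M} {σ' : TwoForm I' M}
    (h : IsAdapted (I' := I') pr S.ξ S.η univ) (hpr : Function.Surjective pr)
    (hK : IsCompatible S K σ pr) (hK' : IsCompatible S K' σ' pr) : K = K' ∧ σ = σ' := by
  rw [isCompatible_iff h hpr] at hK hK'
  refine ⟨HermitianStructure.ext (Metric.eq_of_inner fun x w w' => ?_)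
    (EndField.ext (funext fun x => ?_)), TwoForm.ext (funext fun x => ?_)⟩
  all_goals obtain ⟨p, rfl⟩ := hpr x
  · obtain ⟨v, rfl⟩ := h.surj p (mem_univ p) w
    obtain ⟨v', rfl⟩ := h.surj p (mem_univ p) w'
    rw [(hK p).1, (hK' p).1]
  · ext w
    obtain ⟨v, rfl⟩ := h.surj p (mem_univ p) w
    rw [← (hK p).2.1, ← (hK' p).2.1]
  · ext w w'
    obtain ⟨v, rfl⟩ := h.surj p (mem_univ p) w
    obtain ⟨v', rfl⟩ := h.surj p (mem_univ p) w'
    rw [← (hK p).2.2, ← (hK' p).2.2]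

end Compatible

section LeafSpaceStructure

variable {E : Type*} [NormedAddCommGroup E] [NormedSpace ℝ E] [FiniteDimensional ℝ E]
  {H : Type*} [TopologicalSpace H] {I : ModelWithCorners ℝ E H} [I.Boundaryless]
  {N : Type*} [TopologicalSpace N] [ChartedSpace H N] [IsManifold I ∞ N]

lemma exists_integralCurve {V : (q : N) → TangentSpace I q} {p : N} (hV : SmoothFieldAt I V p) :
    ∃ (γ : ℝ → N) (ε : ℝ), 0 < ε ∧ γ 0 = p ∧ IsMIntegralCurveOn γ V (Ioo (-ε) ε) := by
  obtain ⟨γ, h0, hγ⟩ := exists_isMIntegralCurveAt_of_contMDiffAt_boundaryless (t₀ := 0)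
    (hV.of_le 1)
  obtain ⟨ε, hε, h⟩ := isMIntegralCurveAt_iff'.1 hγ
  refine ⟨γ, ε, hε, h0, ?_⟩
  rwa [Real.ball_eq_Ioo, zero_sub, zero_add] at h

variable {E' : Type*} [NormedAddCommGroup E'] [NormedSpace ℝ E'] [FiniteDimensional ℝ E']
  {H' : Type*} [TopologicalSpace H'] {I' : ModelWithCorners ℝ E' H'} [I'.Boundaryless]

lemma leafProj_eq_of_integralCurve {V : (q : N) → TangentSpace I q} {γ : ℝ → N} {a b s t : ℝ}
    (hγ : IsMIntegralCurveOn γ V (Ioo a b)) (hs : s ∈ Ioo a b) (ht : t ∈ Ioo a b) :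
    leafProj I V (γ s) = leafProj I V (γ t) :=
  Quot.sound ⟨γ, a, b, hγ, s, hs, t, ht, rfl, rfl⟩

lemma isLeafProj_leafProj (S : STStructure I N)
    [ChartedSpace H' (LeafSpace I S.ξ)] [IsManifold I' ∞ (LeafSpace I S.ξ)]
    (hd : Module.finrank ℝ E = Module.finrank ℝ E' + 1)
    (h : IsSurjSubmersion I I' (leafProj I S.ξ)) :
    IsLeafProj (I' := I') (leafProj I S.ξ) S.ξ S.η univ where
  isOpen := isOpen_univ
  smooth p _ := h.1 p
  surj p _ := h.2.2 p
  smooth_ξ p _ := S.smoothFieldAt_ξ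
  ker p _ := by
    obtain ⟨γ, ε, hε, rfl, hγ⟩ := exists_integralCurve (S.smoothFieldAt_ξ (p := p))
    have h0 : (0 : ℝ) ∈ Ioo (-ε) ε := ⟨by linarith, hε⟩
    have h1 := (hγ 0 h0).hasMFDerivAt (Ioo_mem_nhds h0.1 h0.2)
    have h2 := ((h.1 (γ 0)).mdifferentiableAt (by simp)).hasMFDerivAt.comp (0 : ℝ) h1
    have h3 : HasMFDerivAt 𝓘(ℝ, ℝ) I' (leafProj I S.ξ ∘ γ) 0 0 := by
      refine (hasMFDerivAt_const (leafProj I S.ξ (γ 0)) (0 : ℝ)).congr_of_eventuallyEq ?_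
      filter_upwards [Ioo_mem_nhds h0.1 h0.2] with t ht
      exact leafProj_eq_of_integralCurve hγ ht h0
    have h4 := congrArg (fun A : ℝ →L[ℝ] E' => A 1) (hasMFDerivAt_unique h2 h3)
    have h5 := congrArg (mfderiv I I' (leafProj I S.ξ) (γ 0)) (one_smul ℝ (S.ξ (γ 0)))
    exact h5.symm.trans h4
  unit p _ := S.η_ξ
  finrank _ _ := hd
  cover x := by
    obtain ⟨p, hp⟩ := h.2.1 x
    exact ⟨p, mem_univ p, hp⟩
  const p q := fun ⟨γ, a, b, hγ, _, s, hs, t, ht, hp, hq⟩ => by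
    rw [← hp, ← hq]; exact leafProj_eq_of_integralCurve hγ hs ht
  conn p _ q _ hpq := by
    refine Relation.EqvGen.mono (r := OnIntegralCurve I S.ξ) ?_ _ _ (Quot.eqvGen_exact hpq)
    rintro p q ⟨γ, a, b, hγ, hst⟩
    exact ⟨γ, a, b, hγ, fun _ _ => mem_univ _, hst⟩

theorem existsUnique_leafSpace_structure (S : STStructure I N)
    [ChartedSpace H' (LeafSpace I S.ξ)] [IsManifold I' ∞ (LeafSpace I S.ξ)]
    (hd : Module.finrank ℝ E = Module.finrank ℝ E' + 1)
    (h : IsSurjSubmersion I I' (leafProj I S.ξ)) :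
    ∃! t : HermitianStructure I' (LeafSpace I S.ξ) × TwoForm I' (LeafSpace I S.ξ),
      t.2.IsClosed ∧ t.2.IsOneOne t.1.J ∧ IsCompatible S t.1 t.2 (leafProj I S.ξ) := by
  have hl := isLeafProj_leafProj S hd h
  obtain ⟨K, σ, h1, h2, h3⟩ := STStructure.exists_hermitian hl
  refine ⟨(K, σ), ⟨h1, h2, (isCompatible_iff hl.toIsAdapted h.2.1).2 fun p => h3 p (mem_univ p)⟩,
    fun t ht => ?_⟩
  obtain ⟨h4, h5⟩ := ht.2.2.base_unique hl.toIsAdapted h.2.1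
    ((isCompatible_iff hl.toIsAdapted h.2.1).2 fun p => h3 p (mem_univ p))
  exact Prod.ext h4 h5

end LeafSpaceStructure

section FoliatedCharts

variable {E : Type*} [NormedAddCommGroup E] [NormedSpace ℝ E] [FiniteDimensional ℝ E]
  {H : Type*} [TopologicalSpace H] {I : ModelWithCorners ℝ E H} [I.Boundaryless]
  {N : Type*} [TopologicalSpace N] [ChartedSpace H N] [IsManifold I ∞ N]
  {E₀ : Type*} [NormedAddCommGroup E₀] [NormedSpace ℝ E₀] [FiniteDimensional ℝ E₀]

/-- A smooth chart with product image whose plaques are tangent to `V`. -/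
structure IsFoliatedChart (V : (q : N) → TangentSpace I q) (e : OpenPartialHomeomorph N (E₀ × ℝ))
    (W : Set E₀) (a b : ℝ) : Prop where
  smooth : ContMDiffOn I 𝓘(ℝ, E₀ × ℝ) ∞ e e.source
  smooth_symm : ContMDiffOn 𝓘(ℝ, E₀ × ℝ) I ∞ e.symm e.target
  target_eq : e.target = W ×ˢ Ioo a b
  tangent : ∀ q ∈ e.source, mfderiv I 𝓘(ℝ, E₀) (fun x => (e x).1) q (V q) = 0

namespace IsFoliatedChart

variable {V : (q : N) → TangentSpace I q} {e : OpenPartialHomeomorph N (E₀ × ℝ)}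
    {W : Set E₀} {a b : ℝ} {q q' : N}

lemma contMDiffAt (he : IsFoliatedChart V e W a b) (hq : q ∈ e.source) :
    ContMDiffAt I 𝓘(ℝ, E₀ × ℝ) ∞ e q :=
  he.smooth.contMDiffAt (e.open_source.mem_nhds hq)

lemma contMDiffAt_symm (he : IsFoliatedChart V e W a b) {y : E₀ × ℝ} (hy : y ∈ e.target) :
    ContMDiffAt 𝓘(ℝ, E₀ × ℝ) I ∞ e.symm y :=
  he.smooth_symm.contMDiffAt (e.open_target.mem_nhds hy)

lemma contMDiffAt_fst (he : IsFoliatedChart V e W a b) (hq : q ∈ e.source) :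
    ContMDiffAt I 𝓘(ℝ, E₀) ∞ (fun q => (e q).1) q :=
  contDiff_fst.contMDiff.contMDiffAt.comp q (he.contMDiffAt hq)

lemma contMDiffAt_snd (he : IsFoliatedChart V e W a b) (hq : q ∈ e.source) :
    ContMDiffAt I 𝓘(ℝ, ℝ) ∞ (fun q => (e q).2) q :=
  contDiff_snd.contMDiff.contMDiffAt.comp q (he.contMDiffAt hq)

lemma mem_target (he : IsFoliatedChart V e W a b) {y : E₀ × ℝ} :
    y ∈ e.target ↔ y.1 ∈ W ∧ y.2 ∈ Ioo a b := by
  rw [he.target_eq]; rfl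

lemma fst_mem (he : IsFoliatedChart V e W a b) (hq : q ∈ e.source) : (e q).1 ∈ W :=
  (he.mem_target.1 (e.map_source hq)).1

lemma snd_mem (he : IsFoliatedChart V e W a b) (hq : q ∈ e.source) : (e q).2 ∈ Ioo a b :=
  (he.mem_target.1 (e.map_source hq)).2

lemma ext_tangent (he : IsFoliatedChart V e W a b) (hq : q ∈ e.source) {v w : TangentSpace I q}
    (h1 : mvfderiv I (fun q => (e q).1) q v = mvfderiv I (fun q => (e q).1) q w)
    (h2 : mvfderiv I (fun q => (e q).2) q v = mvfderiv I (fun q => (e q).2) q w) : v = w := by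
  have hes := he.contMDiffAt_symm (e.map_source hq)
  have hd := (he.contMDiffAt hq).mdifferentiableAt (by simp)
  have hds := hes.mdifferentiableAt (by simp)
  have h3 : mvfderiv I e q v = mvfderiv I e q w := by
    have hf := fun v => mvfderiv_comp_mfderiv (I' := 𝓘(ℝ, E₀ × ℝ)) (u := Prod.fst (α := E₀) (β := ℝ))
      (contDiff_fst.contMDiff.mdifferentiable (n := ∞) (by simp) _) hd v
    have hs := fun v => mvfderiv_comp_mfderiv (I' := 𝓘(ℝ, E₀ × ℝ)) (u := Prod.snd (α := E₀) (β := ℝ))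
      (contDiff_snd.contMDiff.mdifferentiable (n := ∞) (by simp) _) hd v
    have hf' : mvfderiv 𝓘(ℝ, E₀ × ℝ) (Prod.fst (α := E₀) (β := ℝ)) (e q) =
        ContinuousLinearMap.fst ℝ E₀ ℝ := (mfderiv_eq_fderiv ..).trans fderiv_fst
    have hs' : mvfderiv 𝓘(ℝ, E₀ × ℝ) (Prod.snd (α := E₀) (β := ℝ)) (e q) =
        ContinuousLinearMap.snd ℝ E₀ ℝ := (mfderiv_eq_fderiv ..).trans fderiv_snd
    rw [hf, hf, hf'] at h1
    rw [hs, hs, hs'] at h2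
    exact Prod.ext h1 h2
  have h4 : mfderiv I I (e.symm ∘ e) q = ContinuousLinearMap.id ℝ (TangentSpace I q) := by
    have : e.symm ∘ e =ᶠ[𝓝 q] id := by
      filter_upwards [e.open_source.mem_nhds hq] with x hx using e.left_inv hx
    rw [this.mfderiv_eq]
    exact mfderiv_id
  rw [mfderiv_comp q hds hd] at h4
  have h5 := fun v => congrArg (fun A : E →L[ℝ] E => A v) h4
  exact (h5 v).symm.trans ((congrArg (mfderiv 𝓘(ℝ, E₀ × ℝ) I e.symm (e q)) h3).trans (h5 w))

lemma fst_const (he : IsFoliatedChart V e W a b) {γ : ℝ → N} {c d s t : ℝ}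
    (hγ : IsMIntegralCurveOn γ V (Ioo c d)) (hmem : ∀ r ∈ Ioo c d, γ r ∈ e.source)
    (hs : s ∈ Ioo c d) (ht : t ∈ Ioo c d) : (e (γ s)).1 = (e (γ t)).1 := by
  have hd : ∀ r ∈ Ioo c d, HasDerivAt (fun r => (e (γ r)).1) 0 r := by
    intro r hr
    have h1 := hasDerivAt_comp_integralCurve hγ hr
      ((he.contMDiffAt_fst (hmem r hr)).mdifferentiableAt (by simp))
    have h2 : mvfderiv I (fun q => (e q).1) (γ r) (V (γ r)) = 0 := he.tangent _ (hmem r hr)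
    rwa [h2] at h1
  exact isOpen_Ioo.is_const_of_deriv_eq_zero isPreconnected_Ioo
    (fun r hr => (hd r hr).differentiableAt.differentiableWithinAt) (fun r hr => (hd r hr).deriv)
    hs ht

/-- The plaques of a foliated chart are contained in orbits. -/
theorem eqvGen_joinedIn (he : IsFoliatedChart V e W a b)
    (hV : ∀ q ∈ e.source, SmoothFieldAt I V q) (hV0 : ∀ q ∈ e.source, V q ≠ 0)
    (hq : q ∈ e.source) (hq' : q' ∈ e.source) (h : (e q).1 = (e q').1) :
    Relation.EqvGen (JoinedIn V e.source) q q' := by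
  have hmem : ∀ t ∈ Ioo a b, ((e q).1, t) ∈ e.target := fun t ht =>
    he.mem_target.2 ⟨he.fst_mem hq, ht⟩
  have key := isPreconnected_Ioo.induction₂ (s := Ioo a b)
    (fun s t => Relation.EqvGen (JoinedIn V e.source) (e.symm ((e q).1, s)) (e.symm ((e q).1, t)))
    ?_ (fun _ _ _ _ _ _ => Relation.EqvGen.trans _ _ _) (fun _ _ _ _ => Relation.EqvGen.symm _ _)
    (he.snd_mem hq) (he.snd_mem hq')
  · have h1 : ((e q).1, (e q').2) = e q' := Prod.ext h rfl
    simp only [h1, Prod.mk.eta, e.left_inv hq, e.left_inv hq'] at key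
    exact key
  intro t ht
  obtain ⟨γ, ε, hε, hγ0, hγ⟩ := exists_integralCurve
    (hV (e.symm ((e q).1, t)) (e.map_target (hmem t ht)))
  have h0 : (0 : ℝ) ∈ Ioo (-ε) ε := ⟨by linarith, hε⟩
  have hsrc : ∀ᶠ s in 𝓝 0, γ s ∈ e.source :=
    (continuousAt_of_integralCurve hγ h0).eventually
      (by rw [hγ0]; exact e.open_source.mem_nhds (e.map_target (hmem t ht)))
  obtain ⟨δ, hδ, hball⟩ := Metric.eventually_nhds_iff_ball.1
    (hsrc.and (Ioo_mem_nhds h0.1 h0.2))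
  rw [Real.ball_eq_Ioo, zero_sub, zero_add] at hball
  have hγδ : IsMIntegralCurveOn γ V (Ioo (-δ) δ) := hγ.mono fun s hs => (hball s hs).2
  have hδ0 : (0 : ℝ) ∈ Ioo (-δ) δ := ⟨by linarith, hδ⟩
  have hγ0s := (hball 0 hδ0).1
  have hstrict : HasStrictDerivAt (fun s => (e (γ s)).2)
      (mvfderiv I (fun q => (e q).2) (γ 0) (V (γ 0))) 0 := by
    refine hasStrictDerivAt_of_hasDerivAt_of_continuousAt
      (f' := fun s => mvfderiv I (fun q => (e q).2) (γ s) (V (γ s))) ?_ ?_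
    · filter_upwards [Ioo_mem_nhds hδ0.1 hδ0.2] with s hs
      exact hasDerivAt_comp_integralCurve hγδ hs
        ((he.contMDiffAt_snd (hball s hs).1).mdifferentiableAt (by simp))
    · exact ((hV _ hγ0s).mvfderiv (he.contMDiffAt_snd hγ0s)).continuousAt.comp
        (f := γ) (continuousAt_of_integralCurve hγδ hδ0)
  have hne : mvfderiv I (fun q => (e q).2) (γ 0) (V (γ 0)) ≠ 0 := by
    intro h0
    refine hV0 _ hγ0s (he.ext_tangent hγ0s ?_ ?_)
    · rw [map_zero]; exact he.tangent _ hγ0s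
    · rw [map_zero, h0]
  have hmap := hstrict.map_nhds_eq hne
  have heγ : ∀ s ∈ Ioo (-δ) δ, (e (γ s)).1 = (e q).1 := by
    intro s hs
    rw [he.fst_const hγδ (fun r hr => (hball r hr).1) hs hδ0, hγ0, e.right_inv (hmem t ht)]
  have h2 : (e (γ 0)).2 = t := by rw [hγ0, e.right_inv (hmem t ht)]
  rw [h2] at hmap
  refine nhdsWithin_le_nhds ?_
  rw [← hmap]
  refine Filter.mem_map.2 ?_
  filter_upwards [Ioo_mem_nhds hδ0.1 hδ0.2] with s hs
  have h3 : ((e q).1, (e (γ s)).2) = e (γ s) := Prod.ext (heγ s hs).symm rfl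
  show Relation.EqvGen _ _ (e.symm ((e q).1, (e (γ s)).2))
  rw [h3, e.left_inv (hball s hs).1, ← hγ0]
  exact .rel _ _ (.restrict hγδ (fun r hr => (hball r hr).1) hδ0 hs)

end IsFoliatedChart

end FoliatedCharts

section LeafSpaceManifold

variable {E : Type*} [NormedAddCommGroup E] [NormedSpace ℝ E] [FiniteDimensional ℝ E]
  {H : Type*} [TopologicalSpace H] {I : ModelWithCorners ℝ E H} [I.Boundaryless]
  {N : Type*} [TopologicalSpace N] [ChartedSpace H N] [IsManifold I ∞ N]
  {E₀ : Type*} [NormedAddCommGroup E₀] [NormedSpace ℝ E₀] [FiniteDimensional ℝ E₀]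
  {V : (q : N) → TangentSpace I q}

/-- A foliated chart which each leaf meets in at most one plaque. -/
structure IsSimpleChart (V : (q : N) → TangentSpace I q) (e : OpenPartialHomeomorph N (E₀ × ℝ))
    (W : Set E₀) (a b : ℝ) : Prop extends IsFoliatedChart V e W a b where
  fst_eq : ∀ q ∈ e.source, ∀ q' ∈ e.source, leafProj I V q = leafProj I V q' → (e q).1 = (e q').1

/-- There is a smooth germ from `q` to `q'` preserving the leaves. -/
def LeafGerm (V : (q : N) → TangentSpace I q) (q q' : N) : Prop :=
  ∃ τ : N → N, τ q = q' ∧ ContMDiffAt I I ∞ τ q ∧ ∀ᶠ y in 𝓝 q, leafProj I V (τ y) = leafProj I V y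

lemma LeafGerm.refl (q : N) : LeafGerm V q q :=
  ⟨id, rfl, contMDiffAt_id, .of_forall fun _ => rfl⟩

lemma LeafGerm.trans {p q r : N} : LeafGerm V p q → LeafGerm V q r → LeafGerm V p r := by
  rintro ⟨τ, rfl, hτ, h⟩ ⟨τ', rfl, hτ', h'⟩
  refine ⟨τ' ∘ τ, rfl, hτ'.comp p hτ, ?_⟩
  filter_upwards [h, hτ.continuousAt.eventually h'] with y h1 h2 using h2.trans h1

lemma leafProj_eq_of_eqvGen {O : Set N} {q q' : N} (h : Relation.EqvGen (JoinedIn V O) q q') :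
    leafProj I V q = leafProj I V q' := by
  refine Quot.eqvGen_sound (Relation.EqvGen.mono (r := JoinedIn V O) ?_ _ _ h)
  rintro p q ⟨γ, a, b, hγ, _, hst⟩
  exact ⟨γ, a, b, hγ, hst⟩

variable {e : OpenPartialHomeomorph N (E₀ × ℝ)} {W : Set E₀} {a b : ℝ}

lemma IsFoliatedChart.leafProj_eq (he : IsFoliatedChart V e W a b)
    (hV : ∀ q, SmoothFieldAt I V q) (hV0 : ∀ q, V q ≠ 0) {q q' : N}
    (hq : q ∈ e.source) (hq' : q' ∈ e.source) (h : (e q).1 = (e q').1) :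
    leafProj I V q = leafProj I V q' :=
  leafProj_eq_of_eqvGen (he.eqvGen_joinedIn (fun q _ => hV q) (fun q _ => hV0 q) hq hq' h)

lemma IsFoliatedChart.leafGerm (he : IsFoliatedChart V e W a b)
    (hV : ∀ q, SmoothFieldAt I V q) (hV0 : ∀ q, V q ≠ 0) {q q' : N}
    (hq : q ∈ e.source) (hq' : q' ∈ e.source) (h : (e q).1 = (e q').1) : LeafGerm V q q' := by
  have h1 : ((e q).1, (e q').2) = e q' := Prod.ext h rfl
  refine ⟨fun y => e.symm ((e y).1, (e q').2), (congrArg e.symm h1).trans (e.left_inv hq'), ?_, ?_⟩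
  · refine ContMDiffAt.comp (g := e.symm) q ?_
      ((he.contMDiffAt_fst hq).prodMk_space contMDiffAt_const)
    rw [h1]
    exact he.contMDiffAt_symm (e.map_source hq')
  · filter_upwards [e.open_source.mem_nhds hq] with y hy
    have ht : ((e y).1, (e q').2) ∈ e.target := he.mem_target.2 ⟨he.fst_mem hy, he.snd_mem hq'⟩
    refine he.leafProj_eq hV hV0 (e.map_target ht) hy ?_
    rw [e.right_inv ht]

lemma IsRegularFoliation.exists_simpleChart {m : ℕ} (h : IsRegularFoliation I m V) (p : N) :
    ∃ (e : OpenPartialHomeomorph N (EuclideanSpace ℝ (Fin m) × ℝ))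
      (W : Set (EuclideanSpace ℝ (Fin m))) (a b : ℝ), p ∈ e.source ∧ IsSimpleChart V e W a b := by
  obtain ⟨e, hp, h1, h2, ⟨W, a, b, h3⟩, h4, h5⟩ := h p
  exact ⟨e, W, a, b, hp, ⟨⟨h1, h2, h3, h4⟩, h5⟩⟩

/-- Leaf preserving germs exist between any two points of a leaf of a regular foliation. -/
theorem IsRegularFoliation.leafGerm {m : ℕ} (h : IsRegularFoliation I m V)
    (hV : ∀ q, SmoothFieldAt I V q) (hV0 : ∀ q, V q ≠ 0) {q q' : N}
    (hqq : leafProj I V q = leafProj I V q') : LeafGerm V q q' := by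
  suffices H : ∀ {q q'}, Relation.EqvGen (OnIntegralCurve I V) q q' →
      LeafGerm V q q' ∧ LeafGerm V q' q from (H (Quot.eqvGen_exact hqq)).1
  intro q q' hq
  induction hq with
  | refl q => exact ⟨.refl q, .refl q⟩
  | symm q q' _ ih => exact ih.symm
  | trans p q r _ _ h1 h2 => exact ⟨h1.1.trans h2.1, h2.2.trans h1.2⟩
  | rel q q' hq =>
    obtain ⟨γ, a, b, hγ, s, hs, t, ht, rfl, rfl⟩ := hq
    refine isPreconnected_Ioo.induction₂ (s := Ioo a b)
      (fun s t => LeafGerm V (γ s) (γ t) ∧ LeafGerm V (γ t) (γ s)) ?_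
      (fun _ _ _ _ _ _ h1 h2 => ⟨h1.1.trans h2.1, h2.2.trans h1.2⟩) (fun _ _ _ _ => And.symm) hs ht
    intro r hr
    obtain ⟨e, W, c, d, hre, he⟩ := h.exists_simpleChart (γ r)
    refine nhdsWithin_le_nhds ?_
    filter_upwards [(continuousAt_of_integralCurve hγ hr).eventually (e.open_source.mem_nhds hre),
      Ioo_mem_nhds hr.1 hr.2] with r' h1 h2
    have h3 := he.fst_eq _ hre _ h1 (leafProj_eq_of_integralCurve hγ hr h2)
    exact ⟨he.leafGerm hV hV0 hre h1 h3, he.leafGerm hV hV0 h1 hre h3.symm⟩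

lemma continuous_leafProj : Continuous (leafProj I V) := continuous_quot_mk

lemma surjective_leafProj : Function.Surjective (leafProj I V) := Quot.mk_surjective

theorem IsRegularFoliation.isOpenQuotientMap {m : ℕ} (h : IsRegularFoliation I m V)
    (hV : ∀ q, SmoothFieldAt I V q) (hV0 : ∀ q, V q ≠ 0) : IsOpenQuotientMap (leafProj I V) := by
  refine ⟨surjective_leafProj, continuous_leafProj, fun O hO => ?_⟩
  refine isQuotientMap_quot_mk.isOpen_preimage.1 ?_
  show IsOpen (leafProj I V ⁻¹' (leafProj I V '' O))
  rw [isOpen_iff_mem_nhds]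
  rintro q' ⟨q, hq, hqq⟩
  obtain ⟨τ, h0, hτ, h1⟩ := h.leafGerm hV hV0 hqq.symm
  filter_upwards [h1, hτ.continuousAt.preimage_mem_nhds (hO.mem_nhds (by rwa [h0]))] with y h2 h3
  exact ⟨τ y, h3, h2⟩

/-- The chart of the leaf space induced by a simple chart around `p`. -/
def leafChart (hq : IsOpenQuotientMap (leafProj I V)) (hV : ∀ q, SmoothFieldAt I V q)
    (hV0 : ∀ q, V q ≠ 0) (he : IsSimpleChart V e W a b) {p : N} (hp : p ∈ e.source) :
    OpenPartialHomeomorph (LeafSpace I V) E₀ :=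
  have : Nonempty N := ⟨p⟩
  have hmem : ∀ {w : E₀}, w ∈ W → (w, (e p).2) ∈ e.target := fun hw =>
    he.mem_target.2 ⟨hw, he.snd_mem hp⟩
  have hinv : ∀ {q : N} (_ : q ∈ e.source),
      (e (Function.invFunOn (leafProj I V) e.source (leafProj I V q))).1 = (e q).1 := fun {q} hqs =>
    he.fst_eq _ (Function.invFunOn_mem ⟨q, hqs, rfl⟩) _ hqs (Function.invFunOn_eq ⟨q, hqs, rfl⟩)
  { toFun := fun x => (e (Function.invFunOn (leafProj I V) e.source x)).1
    invFun := fun w => leafProj I V (e.symm (w, (e p).2))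
    source := leafProj I V '' e.source
    target := W
    map_source' := by
      rintro _ ⟨q, hqs, rfl⟩
      rw [hinv hqs]
      exact he.fst_mem hqs
    map_target' := fun w hw => ⟨_, e.map_target (hmem hw), rfl⟩
    left_inv' := by
      rintro _ ⟨q, hqs, rfl⟩
      rw [hinv hqs]
      refine he.leafProj_eq hV hV0 (e.map_target (hmem (he.fst_mem hqs))) hqs ?_
      rw [e.right_inv (hmem (he.fst_mem hqs))]
    right_inv' := fun w hw => by
      rw [hinv (e.map_target (hmem hw)), e.right_inv (hmem hw)]
    open_source := hq.isOpenMap _ e.open_source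
    open_target := by
      have : W = (fun w => (w, (e p).2)) ⁻¹' e.target := by
        ext w
        exact ⟨hmem, fun hw => (he.mem_target.1 hw).1⟩
      rw [this]
      exact e.open_target.preimage (by fun_prop)
    continuousOn_toFun := by
      refine continuousOn_of_forall_continuousAt ?_
      rintro _ ⟨q, hqs, rfl⟩
      rw [← hq.continuousAt_comp_iff]
      refine (he.contMDiffAt_fst hqs).continuousAt.congr ?_
      filter_upwards [e.open_source.mem_nhds hqs] with y hy using (hinv hy).symm
    continuousOn_invFun := by
      refine continuous_leafProj.comp_continuousOn (e.continuousOn_symm.comp (by fun_prop) ?_)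
      exact fun w hw => hmem hw }

section leafChart

variable (hq : IsOpenQuotientMap (leafProj I V)) (hV : ∀ q, SmoothFieldAt I V q)
    (hV0 : ∀ q, V q ≠ 0) (he : IsSimpleChart V e W a b) {p : N} (hp : p ∈ e.source)

lemma leafChart_apply {q : N} (hqs : q ∈ e.source) :
    leafChart hq hV hV0 he hp (leafProj I V q) = (e q).1 :=
  have : Nonempty N := ⟨p⟩
  he.fst_eq _ (Function.invFunOn_mem ⟨q, hqs, rfl⟩) _ hqs (Function.invFunOn_eq ⟨q, hqs, rfl⟩)

end leafChart

/-- The leaf space of a regular foliation is a smooth manifold. -/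
theorem IsRegularFoliation.exists_manifold {m : ℕ} (h : IsRegularFoliation I m V)
    (hV : ∀ q, SmoothFieldAt I V q) (hV0 : ∀ q, V q ≠ 0) :
    ∃ (_ : ChartedSpace (EuclideanSpace ℝ (Fin m)) (LeafSpace I V))
      (_ : IsManifold (𝓡 m) ∞ (LeafSpace I V)), IsSurjSubmersion I (𝓡 m) (leafProj I V) := by
  have hq := h.isOpenQuotientMap hV hV0
  choose e W a b hp he using h.exists_simpleChart
  let c (p : N) := leafChart hq hV hV0 (he p) (hp p)
  let cs : ChartedSpace (EuclideanSpace ℝ (Fin m)) (LeafSpace I V) :=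
    { atlas := range c
      chartAt := fun x => c (Quot.out x)
      mem_chart_source := fun x => ⟨Quot.out x, hp _, Quot.out_eq x⟩
      chart_mem_atlas := fun x => mem_range_self _ }
  have hmem (p : N) {w : EuclideanSpace ℝ (Fin m)} (hw : w ∈ W p) :
      (w, (e p p).2) ∈ (e p).target := (he p).mem_target.2 ⟨hw, (he p).snd_mem (hp p)⟩
  have hsymm (p : N) {w : EuclideanSpace ℝ (Fin m)} (hw : w ∈ W p) :
      ContMDiffAt 𝓘(ℝ, EuclideanSpace ℝ (Fin m)) I ∞ (fun w => (e p).symm (w, (e p p).2)) w :=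
    ((he p).contMDiffAt_symm (hmem p hw)).comp w (contMDiffAt_id.prodMk_space contMDiffAt_const)
  have hman : IsManifold (𝓡 m) ∞ (LeafSpace I V) := by
    refine isManifold_of_contDiffOn _ _ _ ?_
    rintro _ _ ⟨p, rfl⟩ ⟨p', rfl⟩
    rintro w ⟨⟨hw, q', hq', hqq⟩, -⟩
    refine ContDiffAt.contDiffWithinAt ?_
    have hqq' : leafProj I V ((e p).symm (w, (e p p).2)) = leafProj I V q' := hqq.symm
    obtain ⟨τ, h0, hτ, h1⟩ := h.leafGerm hV hV0 hqq'
    have hc : ContMDiffAt 𝓘(ℝ, EuclideanSpace ℝ (Fin m)) I ∞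
        (fun w => τ ((e p).symm (w, (e p p).2))) w := hτ.comp w (hsymm p hw)
    have hc0 : τ ((e p).symm (w, (e p p).2)) ∈ (e p').source := by rwa [h0]
    refine ContDiffAt.congr_of_eventuallyEq
      (f := fun w => (e p' (τ ((e p).symm (w, (e p p).2)))).1) ?_ ?_
    · refine ContMDiffAt.contDiffAt (ContMDiffAt.comp w (g := fun q => (e p' q).1) ?_ hc)
      exact (he p').contMDiffAt_fst hc0
    · filter_upwards [(hsymm p hw).continuousAt.eventually h1,
        hc.continuousAt.preimage_mem_nhds ((e p').open_source.mem_nhds hc0)] with w' h2 h3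
      show c p' (leafProj I V ((e p).symm (w', (e p p).2))) = _
      rw [← h2]
      exact leafChart_apply hq hV hV0 (he p') (hp p') h3
  have hatlas (p : N) : c p ∈ IsManifold.maximalAtlas (𝓡 m) ∞ (LeafSpace I V) :=
    IsManifold.subset_maximalAtlas ⟨p, rfl⟩
  have hsm : ContMDiff I (𝓡 m) ∞ (leafProj I V) := by
    intro p
    have h1 : ContMDiffAt (𝓡 m) (𝓡 m) ∞ (c p).symm (e p p).1 :=
      contMDiffAt_symm_of_mem_maximalAtlas (hatlas p) ((he p).fst_mem (hp p))
    refine (h1.comp p ((he p).contMDiffAt_fst (hp p))).congr_of_eventuallyEq ?_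
    filter_upwards [(e p).open_source.mem_nhds (hp p)] with q hqs
    have h2 : leafProj I V q ∈ (c p).source := ⟨q, hqs, rfl⟩
    have h3 := (c p).left_inv h2
    rw [show c p (leafProj I V q) = (e p q).1 from
      leafChart_apply hq hV hV0 (he p) (hp p) hqs] at h3
    exact h3.symm
  refine ⟨cs, hman, hsm, surjective_leafProj, fun p => ?_⟩
  have hps : leafProj I V p ∈ (c p).source := ⟨p, hp p, rfl⟩
  have hcp : c p (leafProj I V p) = (e p p).1 := leafChart_apply hq hV hV0 (he p) (hp p) (hp p)
  let s (x : LeafSpace I V) : N := (e p).symm (c p x, (e p p).2)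
  have hs0 : s (leafProj I V p) = p := by
    simp only [s, hcp, Prod.mk.eta]
    exact (e p).left_inv (hp p)
  have hs : ContMDiffAt (𝓡 m) I ∞ s (leafProj I V p) := by
    refine ContMDiffAt.comp (leafProj I V p) (g := fun w => (e p).symm (w, (e p p).2)) ?_
      (contMDiffAt_of_mem_maximalAtlas (hatlas p) hps)
    rw [hcp]
    exact hsymm p ((he p).fst_mem (hp p))
  have hid : leafProj I V ∘ s =ᶠ[𝓝 (leafProj I V p)] id := by
    filter_upwards [(c p).open_source.mem_nhds hps] with x hx
    exact (c p).left_inv hx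
  have h1 : mfderiv (𝓡 m) (𝓡 m) (leafProj I V ∘ s) (leafProj I V p) =
      ContinuousLinearMap.id ℝ (TangentSpace (𝓡 m) (leafProj I V p)) := by
    rw [hid.mfderiv_eq]
    exact mfderiv_id
  have h2 : Function.Surjective (mfderiv I (𝓡 m) (leafProj I V) (s (leafProj I V p))) := by
    rw [mfderiv_comp (leafProj I V p) ((hsm _).mdifferentiableAt (by simp))
      (hs.mdifferentiableAt (by simp))] at h1
    exact fun w => ⟨mfderiv (𝓡 m) I s (leafProj I V p) w,
      congrArg (fun A : EuclideanSpace ℝ (Fin m) →L[ℝ] EuclideanSpace ℝ (Fin m) => A w) h1⟩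
  rwa [hs0] at h2

theorem IsRegularFoliation.secondCountable [SecondCountableTopology N] {m : ℕ}
    (h : IsRegularFoliation I m V)
    (hV : ∀ q, SmoothFieldAt I V q) (hV0 : ∀ q, V q ≠ 0) :
    SecondCountableTopology (LeafSpace I V) :=
  have hq := h.isOpenQuotientMap hV hV0
  hq.isQuotientMap.secondCountableTopology hq.isOpenMap

end LeafSpaceManifold

/-- The bilinear form `A^* k + α ⊗ α`. -/
def pullbackAddSq {E E' : Type*} [NormedAddCommGroup E] [NormedSpace ℝ E] [NormedAddCommGroup E']
    [NormedSpace ℝ E'] (k : E' →L[ℝ] E' →L[ℝ] ℝ) (A : E →L[ℝ] E') (α : E →L[ℝ] ℝ) :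
    E →L[ℝ] E →L[ℝ] ℝ :=
  k.bilinearComp A A + α.smulRight α

section Lift

variable {E : Type*} [NormedAddCommGroup E] [NormedSpace ℝ E] [FiniteDimensional ℝ E]
  {H : Type*} [TopologicalSpace H] {I : ModelWithCorners ℝ E H} [I.Boundaryless]
  {N : Type*} [TopologicalSpace N] [ChartedSpace H N] [IsManifold I ∞ N]
  {E' : Type*} [NormedAddCommGroup E'] [NormedSpace ℝ E'] [FiniteDimensional ℝ E']
  {H' : Type*} [TopologicalSpace H'] {I' : ModelWithCorners ℝ E' H'} [I'.Boundaryless]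
  {M : Type*} [TopologicalSpace M] [ChartedSpace H' M] [IsManifold I' ∞ M]
  {pr : N → M} {ξ : (q : N) → TangentSpace I q} {η : OneForm I N}

/-- The endomorphism field that is `J` on horizontal vectors and kills `ξ`. -/
def liftEndField (h : IsAdapted (I' := I') pr ξ η univ) (J : EndField I' M) : EndField I N where
  toFun p := (hlift pr η p).comp ((J.toFun (pr p)).comp (mfderiv I I' pr p))
  smooth p := by
    refine contMDiffAt_endField fun X hX => ?_
    refine contMDiffAt_hom_apply_of_frame (V := (TangentSpace I : N → Type _))
      (h.exists_isBasic (mem_univ p)) ?_ hX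
    rintro X - ⟨⟨Y, hY, hXY⟩, -⟩
    refine SmoothFieldAt.congr (h.smoothFieldAt_hlift (mem_univ p) (J.smoothFieldAt_apply hY)) ?_
    filter_upwards [hXY] with q hq
    simp [hq]

/-- The metric `pr^* h + η ⊗ η`. -/
def liftMetric (h : IsAdapted (I' := I') pr ξ η univ) (k : Metric I' M) : Metric I N :=
  Metric.ofInner
    (fun p => pullbackAddSq (E := E) (E' := E') (k.inner (pr p)) (mfderiv I I' pr p) (η.toFun p))
    (fun p v w => by
      show k.inner (pr p) (mfderiv I I' pr p v) (mfderiv I I' pr p w) +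
          η.toFun p v * η.toFun p w =
        k.inner (pr p) (mfderiv I I' pr p w) (mfderiv I I' pr p v) + η.toFun p w * η.toFun p v
      rw [k.symm, mul_comm])
    (fun p v hv => by
      show 0 < k.inner (pr p) (mfderiv I I' pr p v) (mfderiv I I' pr p v) +
        η.toFun p v * η.toFun p v
      by_cases h0 : mfderiv I I' pr p v = 0
      · have h1 : η.toFun p v ≠ 0 := fun h1 => hv (h.ext (mem_univ p) (by rw [h0, map_zero])
          (by rw [h1, map_zero]))
        rw [h0, map_zero, zero_add]
        exact mul_self_pos.2 h1
      · exact add_pos_of_pos_of_nonneg (k.pos _ _ h0) (mul_self_nonneg _))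
    (fun p => contMDiffAt_bilinForm fun X Y hX hY => by
      refine contMDiffAt_bilin_apply_of_frame (h.exists_isBasic (mem_univ p)) ?_ hX hY
      rintro X Y hX ⟨⟨X', hX', hXX'⟩, -⟩ hY ⟨⟨Y', hY', hYY'⟩, -⟩
      have h1 : ContMDiffAt I 𝓘(ℝ, ℝ) ∞ (fun q => k.inner (pr q) (X' (pr q)) (Y' (pr q)) +
          η.toFun q (X q) * η.toFun q (Y q)) p :=
        ((k.contMDiffAt_apply hX' hY').comp p (h.smooth p (mem_univ p))).add
          ((η.contMDiffAt_apply hX).mul (η.contMDiffAt_apply hY))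
      refine h1.congr_of_eventuallyEq ?_
      filter_upwards [hXX', hYY'] with q h2 h3
      rw [← h2, ← h3]
      rfl)

lemma liftMetric_inner (h : IsAdapted (I' := I') pr ξ η univ) (k : Metric I' M) (p : N)
    (v w : TangentSpace I p) :
    (liftMetric h k).inner p v w =
      k.inner (pr p) (mfderiv I I' pr p v) (mfderiv I I' pr p w) + η.toFun p v * η.toFun p w := rfl

section

variable (h : IsAdapted (I' := I') pr ξ η univ) (K : HermitianStructure I' M)

/-- The almost contact metric structure on the total space. -/
def liftAlmostContact : AlmostContactMetric I N where
  g := liftMetric h K.h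
  ξ := ξ
  η := η
  φ := liftEndField h K.J
  smooth_ξ p := h.smooth_ξ p (mem_univ p)
  unit p := by
    rw [liftMetric_inner, h.ker p (mem_univ p), h.unit p (mem_univ p), map_zero]; simp
  dual p v := by
    rw [liftMetric_inner, h.ker p (mem_univ p), h.unit p (mem_univ p), map_zero]; simp
  φ_ξ p := by
    show hlift pr η p (K.J.toFun (pr p) (mfderiv I I' pr p (ξ p))) = 0
    rw [h.ker p (mem_univ p), map_zero, map_zero]
  φ_sq p v := by
    show hlift pr η p (K.J.toFun (pr p) (mfderiv I I' pr p
      (hlift pr η p (K.J.toFun (pr p) (mfderiv I I' pr p v))))) = _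
    rw [h.mfderiv_hlift (mem_univ p), K.J_sq, map_neg, h.hlift_mfderiv (mem_univ p)]
    abel
  compat p v w := by
    show K.h.inner (pr p) (mfderiv I I' pr p (hlift pr η p (K.J.toFun (pr p) (mfderiv I I' pr p v))))
      (mfderiv I I' pr p (hlift pr η p (K.J.toFun (pr p) (mfderiv I I' pr p w)))) +
      η.toFun p (hlift pr η p (K.J.toFun (pr p) (mfderiv I I' pr p v))) *
      η.toFun p (hlift pr η p (K.J.toFun (pr p) (mfderiv I I' pr p w))) = _
    rw [h.mfderiv_hlift (mem_univ p), h.mfderiv_hlift (mem_univ p), K.compat,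
      h.form_hlift (mem_univ p), liftMetric_inner]
    ring

lemma mfderiv_liftAlmostContact_φ (p : N) (v : TangentSpace I p) :
    mfderiv I I' pr p ((liftAlmostContact h K).φ.toFun p v) =
      K.J.toFun (pr p) (mfderiv I I' pr p v) :=
  h.mfderiv_hlift (mem_univ p) _

variable {σ : TwoForm I' M}

lemma d_liftAlmostContact_φ (hσ : σ.IsOneOne K.J) (hη : HasCurvature η σ pr) {p : N}
    {X Y : (q : N) → TangentSpace I q} (hX : SmoothFieldAt I X p) (hY : SmoothFieldAt I Y p) :
    η.d (fun q => (liftAlmostContact h K).φ.toFun q (X q))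
      (fun q => (liftAlmostContact h K).φ.toFun q (Y q)) p = η.d X Y p := by
  have h1 := hη p _ _ ((liftAlmostContact h K).φ.smoothFieldAt_apply hX)
    ((liftAlmostContact h K).φ.smoothFieldAt_apply hY)
  rw [mfderiv_liftAlmostContact_φ, mfderiv_liftAlmostContact_φ, hσ, ← hη p X Y hX hY] at h1
  exact mul_left_cancel₀ (by positivity) h1

lemma normal_liftAlmostContact (hσ : σ.IsOneOne K.J) (hη : HasCurvature η σ pr) {p : N}
    {X Y : (q : N) → TangentSpace I q} (hX : SmoothFieldAt I X p) (hY : SmoothFieldAt I Y p) :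
    (liftAlmostContact h K).sasakiHatakeyama X Y p = 0 := by
  set A := liftAlmostContact h K
  have hAη : A.η = η := rfl
  have hAξ : A.ξ = ξ := rfl
  rw [AlmostContactMetric.sasakiHatakeyama, hAη, hAξ]
  refine h.ext (mem_univ p) ?_ ?_
  · obtain ⟨X', hX', ⟨⟨Y₁, hY₁, h₁⟩, -⟩, hXX'⟩ := h.exists_isBasic (mem_univ p) (X p)
    obtain ⟨Y', hY', ⟨⟨Y₂, hY₂, h₂⟩, -⟩, hYY'⟩ := h.exists_isBasic (mem_univ p) (Y p)
    have h3 : A.φ.nijenhuis X Y p = A.φ.nijenhuis X' Y' p :=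
      TensorialAt.pointwise₂ (Φ := fun X Y => A.φ.nijenhuis X Y p)
        (fun _ _ => A.φ.tensorialAt_nijenhuis_left) (fun _ _ => A.φ.tensorialAt_nijenhuis_right)
        hX.mdiff hX'.mdiff hY.mdiff hY'.mdiff hXX'.symm hYY'.symm
    rw [map_add, map_smul, h.ker p (mem_univ p), smul_zero, add_zero, h3,
      mfderiv_nijenhuis (J := K.J) (h.smooth p (mem_univ p))
        (.of_forall fun q v => mfderiv_liftAlmostContact_φ h K q v) hX' hY' hY₁ hY₂ h₁ h₂,
      K.integrable _ _ _ hY₁ hY₂, map_zero]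
  · have h0 (Z : (q : N) → TangentSpace I q) :
        (fun q => η.toFun q (A.φ.toFun q (Z q))) = fun _ => 0 := funext fun q => A.η_φ _
    have h0' (v : TangentSpace I p) : η.toFun p (A.φ.toFun p v) = 0 := A.η_φ v
    have h1 := d_liftAlmostContact_φ h K hσ hη hX hY
    rw [OneForm.d] at h1
    simp only [show liftAlmostContact h K = A from rfl, h0, mvfderiv_const, _root_.zero_apply] at h1
    rw [EndField.nijenhuis]
    simp only [map_add, map_sub, map_smul, map_zero, h0', h.unit p (mem_univ p), smul_eq_mul]
    linarith

lemma isKilling_liftMetric (hη : HasCurvature η σ pr) (k : Metric I' M) :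
    IsKilling (liftMetric h k) ξ := by
  intro p X Y hX hY
  suffices H : (liftMetric h k).lieDeriv ξ X Y p = 0 by
    rw [Metric.lieDeriv] at H
    linarith
  have hξ := h.smooth_ξ p (mem_univ p)
  have hbr {X : (q : N) → TangentSpace I q} (hX : SmoothFieldAt I X p)
      (hXb : IsAdapted.IsBasic (I' := I') pr η p X) : mlieBracket I ξ X p = 0 := by
    obtain ⟨⟨X', hX', hXX'⟩, c, hc⟩ := hXb
    rw [h.bracket_ξ_eq_smul (mem_univ p) hX hX' hXX']
    have h1 := hη p ξ X hξ hX
    rw [h.ker p (mem_univ p), map_zero, _root_.zero_apply, OneForm.d,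
      show (fun q => η.toFun q (ξ q)) = fun _ => 1 from funext fun q => h.unit q (mem_univ q),
      mvfderiv_congr (v := fun _ => c) hc, mvfderiv_const, mvfderiv_const] at h1
    have h2 := (mul_eq_zero.1 h1).resolve_left (by positivity)
    simp only [_root_.zero_apply, sub_zero, zero_sub, neg_eq_zero] at h2
    rw [h2, zero_smul]
  have key := tensorial_ext (h.exists_isBasic (mem_univ p))
    (Φ := fun X Y => (liftMetric h k).lieDeriv ξ X Y p) (Ψ := fun _ _ => (0 : ℝ))
    (fun _ hτ => (liftMetric h k).tensorialAt_lieDeriv_left hτ)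
    (fun _ hτ => (liftMetric h k).tensorialAt_lieDeriv_right hτ)
    (fun _ _ => ⟨fun _ _ => (smul_zero _).symm, fun _ _ => (add_zero _).symm⟩)
    (fun _ _ => ⟨fun _ _ => (smul_zero _).symm, fun _ _ => (add_zero _).symm⟩) ?_ hX hY
  · exact key
  intro X Y hX hXb hY hYb
  rw [Metric.lieDeriv, hbr hX hXb, hbr hY hYb]
  obtain ⟨⟨X', hX', hXX'⟩, c, hc⟩ := hXb
  obtain ⟨⟨Y', hY', hYY'⟩, d, hd⟩ := hYb
  have h1 : (fun q => (liftMetric h k).inner q (X q) (Y q)) =ᶠ[𝓝 p]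
      fun q => k.inner (pr q) (X' (pr q)) (Y' (pr q)) + c * d := by
    filter_upwards [hXX', hYY', hc, hd] with q h2 h3 h4 h5
    rw [liftMetric_inner, h2, h3, h4, h5]
  rw [mvfderiv_congr h1, mvfderiv_comp_mfderiv (u := fun x => k.inner x (X' x) (Y' x) + c * d)
    (((k.contMDiffAt_apply hX' hY').add contMDiffAt_const).mdifferentiableAt (by simp))
    ((h.smooth p (mem_univ p)).mdifferentiableAt (by simp)), h.ker p (mem_univ p)]
  simp

end

/-- The ST structure on the total space of a bundle with connection. -/
theorem existsUnique_STStructure (h : IsAdapted (I' := I') pr ξ η univ)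
    (hpr : Function.Surjective pr) (K : HermitianStructure I' M) {σ : TwoForm I' M}
    (hσ : σ.IsOneOne K.J) (hη : HasCurvature η σ pr) :
    ∃! S : STStructure I N, S.ξ = ξ ∧ S.η = η ∧ IsCompatible S K σ pr := by
  let S : STStructure I N :=
    { liftAlmostContact h K with
      normal := fun p X Y hX hY => normal_liftAlmostContact h K hσ hη hX hY
      killing := isKilling_liftMetric h hη K.h }
  have hS : ∀ S : STStructure I N, S.ξ = ξ → S.η = η →
      IsAdapted (I' := I') pr S.ξ S.η univ := by
    rintro S hξ hη
    rwa [hξ, hη]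
  refine ⟨S, ⟨rfl, rfl, (isCompatible_iff h hpr).2 fun p => ⟨fun v w => ?_, fun v => ?_,
    hasCurvature_iff.1 hη p⟩⟩, ?_⟩
  · rw [show S.g = liftMetric h K.h from rfl, liftMetric_inner, show S.η = η from rfl]
    ring
  · exact mfderiv_liftAlmostContact_φ h K p v
  · rintro S' ⟨h1, h2, h3⟩
    have h4 := (isCompatible_iff (hS S' h1 h2) hpr).1 h3
    refine STStructure.ext (Metric.eq_of_inner fun p v w => ?_) h1 h2
      (EndField.ext (funext fun p => ContinuousLinearMap.ext fun v => ?_))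
    · have h5 := (h4 p).1 v w
      rw [h2] at h5
      rw [show S.g = liftMetric h K.h from rfl, liftMetric_inner, h5]
      ring
    · refine h.ext (mem_univ p) ?_ ?_
      · rw [(h4 p).2.1]
        exact (mfderiv_liftAlmostContact_φ h K p v).symm
      · rw [← h2, S'.η_φ, h2]
        exact (S.η_φ v).symm

end Lift

section CircleBundleAdapted

variable {E : Type*} [NormedAddCommGroup E] [NormedSpace ℝ E] [FiniteDimensional ℝ E]
  {H : Type*} [TopologicalSpace H] {I : ModelWithCorners ℝ E H} [I.Boundaryless]
  {N : Type*} [TopologicalSpace N] [ChartedSpace H N] [IsManifold I ∞ N]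
  {E' : Type*} [NormedAddCommGroup E'] [NormedSpace ℝ E'] [FiniteDimensional ℝ E']
  {H' : Type*} [TopologicalSpace H'] {I' : ModelWithCorners ℝ E' H'} [I'.Boundaryless]
  {M : Type*} [TopologicalSpace M] [ChartedSpace H' M] [IsManifold I' ∞ M]
  (B : CircleBundle I N I' M)

/-- A local diffeomorphism identifies the dimensions. -/
lemma finrank_eq_of_openPartialHomeomorph {e : OpenPartialHomeomorph N M} {p : N}
    (hp : p ∈ e.source) (h : ContMDiffOn I I' ∞ e e.source)
    (hs : ContMDiffOn I' I ∞ e.symm e.target) : Module.finrank ℝ E = Module.finrank ℝ E' := by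
  let Φ : PartialDiffeomorph I I' N M ∞ :=
    { e.toPartialEquiv with
      open_source := e.open_source
      open_target := e.open_target
      contMDiffOn_toFun := h
      contMDiffOn_invFun := hs }
  have hΦ : IsLocalDiffeomorphAt I I' ∞ e p := ⟨Φ, hp, fun _ _ => rfl⟩
  exact (hΦ.mfderivToContinuousLinearEquiv (by simp)).toLinearEquiv.finrank_eq

namespace CircleBundle

lemma act_exp_zero (p : N) : B.act (Circle.exp 0) p = p := by
  rw [Circle.exp_zero, B.one_act]

lemma contMDiff_act_exp :
    ContMDiff (𝓘(ℝ, ℝ).prod I) I ∞ (fun x : ℝ × N => B.act (Circle.exp x.1) x.2) :=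
  B.smooth_act.comp ((contMDiff_circleExp.comp contMDiff_fst).prodMk contMDiff_snd)

lemma contMDiff_act_exp_left (p : N) :
    ContMDiff 𝓘(ℝ, ℝ) I ∞ (fun t : ℝ => B.act (Circle.exp t) p) :=
  B.contMDiff_act_exp.comp (contMDiff_id.prodMk contMDiff_const)

lemma mvfderiv_fundamental {F : Type*} [NormedAddCommGroup F] [NormedSpace ℝ F] {u : N → F} {p : N}
    (hu : MDifferentiableAt I 𝓘(ℝ, F) u p) :
    mvfderiv I u p (B.fundamental p) = deriv (fun t : ℝ => u (B.act (Circle.exp t) p)) 0 := by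
  have h1 := mvfderiv_comp_mfderiv (pr := fun t : ℝ => B.act (Circle.exp t) p) (p := (0 : ℝ))
    (u := u) (by rwa [B.act_exp_zero]) ((B.contMDiff_act_exp_left p).mdifferentiableAt (by simp))
    (1 : ℝ)
  have h2 : (mvfderiv I u (B.act (Circle.exp 0) p) : E →L[ℝ] F) = mvfderiv I u p := by
    rw [B.act_exp_zero]
  have h3 : mvfderiv 𝓘(ℝ, ℝ) (fun t : ℝ => u (B.act (Circle.exp t) p)) 0 (1 : ℝ) =
      deriv (fun t : ℝ => u (B.act (Circle.exp t) p)) 0 := by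
    rw [← fderiv_apply_one_eq_deriv]
    exact congrArg (fun A : ℝ →L[ℝ] F => A 1) (mfderiv_eq_fderiv ..)
  rw [← h3, h1]
  exact congrArg (fun A : E →L[ℝ] F => A (B.fundamental p)) h2.symm

lemma smoothFieldAt_fundamental (p : N) : SmoothFieldAt I B.fundamental p := by
  refine smoothFieldAt_of_extChartAt ?_
  set u := extChartAt I p
  have hu : ContMDiffAt I 𝓘(ℝ, E) ∞ u p := contMDiffAt_extChartAt
  have h1 : ContMDiffAt (I.prod 𝓘(ℝ, ℝ)) 𝓘(ℝ, E) ∞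
      (Function.uncurry fun (q : N) (t : ℝ) => u (B.act (Circle.exp t) q)) (p, 0) := by
    refine ContMDiffAt.comp (p, (0 : ℝ)) (g := u)
      (f := fun x : N × ℝ => B.act (Circle.exp x.2) x.1) ?_
      (B.contMDiff_act_exp.comp (contMDiff_snd.prodMk contMDiff_fst) _)
    simpa only [B.act_exp_zero] using hu
  have h2 := ContMDiffAt.mfderiv (m := ∞) (fun (q : N) (t : ℝ) => u (B.act (Circle.exp t) q))
    (fun _ => 0) h1 contMDiffAt_const (by simp)
  have h2' : ContMDiffAt I 𝓘(ℝ, ℝ →L[ℝ] E) ∞ (fun q => show ℝ →L[ℝ] E from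
      mfderiv 𝓘(ℝ, ℝ) 𝓘(ℝ, E) (fun t : ℝ => u (B.act (Circle.exp t) q)) 0) p :=
    h2.congr_of_eventuallyEq (.of_forall fun q => (congrFun (inTangentCoordinates_model_space
      (I := 𝓘(ℝ, ℝ)) (I' := 𝓘(ℝ, E)) (fun _ => (0 : ℝ)) (fun q => u (B.act (Circle.exp 0) q))
      (fun q => mfderiv 𝓘(ℝ, ℝ) 𝓘(ℝ, E) (fun t : ℝ => u (B.act (Circle.exp t) q)) 0) p) q).symm)
  have h3 := h2'.clm_apply (contMDiffAt_const (c := (1 : ℝ)))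
  refine h3.congr_of_eventuallyEq ?_
  filter_upwards [eventually_mdifferentiableAt hu (by simp)] with q hq
  rw [B.mvfderiv_fundamental hq, ← fderiv_apply_one_eq_deriv]
  exact congrArg (fun A : ℝ →L[ℝ] E => A 1) (mfderiv_eq_fderiv ..).symm

lemma contMDiff_proj : ContMDiff I I' ∞ B.proj := by
  intro p
  obtain ⟨e, hx, he, -, -⟩ := B.locally_trivial (B.proj p)
  have hp : p ∈ e.source := e.mem_source.2 hx
  have h1 := contMDiff_fst.contMDiffAt.comp p (he.contMDiffAt (e.open_source.mem_nhds hp))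
  refine h1.congr_of_eventuallyEq ?_
  filter_upwards [e.open_source.mem_nhds hp] with q hq using (e.coe_fst hq).symm

lemma surjective_proj : Function.Surjective B.proj := by
  intro x
  obtain ⟨e, hx, -⟩ := B.locally_trivial x
  exact ⟨_, e.proj_symm_apply' (x := (1 : Circle)) hx⟩

lemma surjective_mfderiv_proj (p : N) : Function.Surjective (mfderiv I I' B.proj p) := by
  obtain ⟨e, hx, he, hes, -⟩ := B.locally_trivial (B.proj p)
  have hp : p ∈ e.source := e.mem_source.2 hx
  let s (x : M) : N := e.toOpenPartialHomeomorph.symm (x, (e p).2)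
  have hep : (B.proj p, (e p).2) = e p := Prod.ext (e.coe_fst hp).symm rfl
  have hs0 : s (B.proj p) = p := by
    simp only [s, hep]
    exact e.toOpenPartialHomeomorph.left_inv hp
  have hs : ContMDiffAt I' I ∞ s (B.proj p) := by
    refine ContMDiffAt.comp (B.proj p) (g := e.toOpenPartialHomeomorph.symm) ?_
      (contMDiffAt_id.prodMk (contMDiffAt_const (I' := 𝓡 1)))
    refine hes.contMDiffAt (e.open_target.mem_nhds ?_)
    exact e.mem_target.2 hx
  have hid : B.proj ∘ s =ᶠ[𝓝 (B.proj p)] id := by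
    filter_upwards [e.open_baseSet.mem_nhds hx] with x hx
    exact e.proj_symm_apply' hx
  have h1 : mfderiv I' I' (B.proj ∘ s) (B.proj p) =
      ContinuousLinearMap.id ℝ (TangentSpace I' (B.proj p)) := by
    rw [hid.mfderiv_eq]
    exact mfderiv_id
  have h2 : Function.Surjective (mfderiv I I' B.proj (s (B.proj p))) := by
    rw [mfderiv_comp (B.proj p) ((B.contMDiff_proj _).mdifferentiableAt (by simp))
      (hs.mdifferentiableAt (by simp))] at h1
    exact fun w => ⟨mfderiv I' I s (B.proj p) w, congrArg (fun A : E' →L[ℝ] E' => A w) h1⟩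
  rwa [hs0] at h2

lemma mfderiv_proj_fundamental (p : N) : mfderiv I I' B.proj p (B.fundamental p) = 0 := by
  have hpr := (B.contMDiff_proj p).mdifferentiableAt (by simp)
  have hu : ContMDiffAt I' 𝓘(ℝ, E') ∞ (extChartAt I' (B.proj p)) (B.proj p) :=
    contMDiffAt_extChartAt
  have hud := hu.mdifferentiableAt (by simp)
  apply mvfderiv_extChartAt_injective (mem_extChartAt_source (I := I') (B.proj p))
  rw [map_zero, ← mvfderiv_comp_mfderiv hud hpr, B.mvfderiv_fundamental
    (u := fun q => extChartAt I' (B.proj p) (B.proj q)) (hud.comp p hpr)]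
  simp only [B.proj_act, deriv_const]

lemma finrank_eq (B : CircleBundle I N I' M) (p : N) : Module.finrank ℝ E = Module.finrank ℝ E' + 1 := by
  obtain ⟨e, hx, he, hes, -⟩ := B.locally_trivial (B.proj p)
  have := finrank_eq_of_openPartialHomeomorph (e := e.toOpenPartialHomeomorph)
    (e.mem_source.2 hx) he hes
  rw [this, Module.finrank_prod]
  simp

lemma isAdapted {η : OneForm I N} (hη : ∀ p, η.toFun p (B.fundamental p) = 1) :
    IsAdapted (I' := I') B.proj B.fundamental η univ where
  isOpen := isOpen_univ
  smooth p _ := B.contMDiff_proj p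
  surj p _ := B.surjective_mfderiv_proj p
  smooth_ξ p _ := B.smoothFieldAt_fundamental p
  ker p _ := B.mfderiv_proj_fundamental p
  unit p _ := hη p
  finrank p _ := B.finrank_eq p

end CircleBundle

end CircleBundleAdapted

section InverseFunction

variable {A B : Type*} [NormedAddCommGroup A] [NormedSpace ℝ A] [CompleteSpace A]
  [NormedAddCommGroup B] [NormedSpace ℝ B] [CompleteSpace B]

/-- The inverse function theorem, with an inverse that is smooth on its whole domain. -/
theorem exists_localInverse {F : A → B} {U : Set A} (hU : IsOpen U) (hF : ContDiffOn ℝ ∞ F U)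
    {a : A} (ha : a ∈ U) {F' : A ≃L[ℝ] B} (hF' : HasFDerivAt F (F' : A →L[ℝ] B) a) :
    ∃ f : OpenPartialHomeomorph A B, a ∈ f.source ∧ f.source ⊆ U ∧ (f : A → B) = F ∧
      ContDiffOn ℝ ∞ f.symm f.target := by
  have hFa : ∀ {x}, x ∈ U → ContDiffAt ℝ ∞ F x := fun hx => hF.contDiffAt (hU.mem_nhds hx)
  let f₀ := (hFa ha).toOpenPartialHomeomorph F hF' (by simp)
  have hd : ContinuousOn (fderiv ℝ F) U := hF.continuousOn_fderiv_of_isOpen hU (by simp)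
  have hinv : IsOpen (U ∩ fderiv ℝ F ⁻¹' range ((↑) : (A ≃L[ℝ] B) → A →L[ℝ] B)) :=
    hd.isOpen_inter_preimage hU ContinuousLinearEquiv.isOpen
  refine ⟨f₀.restrOpen _ hinv, ⟨?_, ha, F', hF'.fderiv.symm⟩, fun x hx => hx.2.1, rfl, ?_⟩
  · exact (hFa ha).mem_toOpenPartialHomeomorph_source hF' (by simp)
  · intro y hy
    refine ContDiffAt.contDiffWithinAt ?_
    have hs := (f₀.restrOpen _ hinv).map_target hy
    obtain ⟨F'', hF''⟩ := hs.2.2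
    refine OpenPartialHomeomorph.contDiffAt_symm (f₀' := F'') _ hy ?_ (hFa hs.2.1)
    rw [hF'']
    exact ((hFa hs.2.1).differentiableAt (by simp)).hasFDerivAt

end InverseFunction

section Nemytskii

universe u

variable {K : Type*} [TopologicalSpace K] [CompactSpace K]
  {E : Type u} [NormedAddCommGroup E] [NormedSpace ℝ E]
  {F : Type u} [NormedAddCommGroup F] [NormedSpace ℝ F]

/-- Composition with a continuous map, on the space of continuous functions on a compact space. -/
def superposition (V : C(E, F)) (γ : C(K, E)) : C(K, F) := V.comp γ

lemma continuous_superposition (V : C(E, F)) :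
    Continuous (superposition V : C(K, E) → C(K, F)) := ContinuousMap.continuous_postcomp V

set_option synthInstance.maxHeartbeats 200000 in
/-- Pointwise application of a function with values in linear maps. -/
def pointwiseApply : C(K, E →L[ℝ] F) →L[ℝ] C(K, E) →L[ℝ] C(K, F) :=
  LinearMap.mkContinuous₂
    (LinearMap.mk₂ ℝ (fun (A : C(K, E →L[ℝ] F)) (γ : C(K, E)) =>
        (⟨fun k => A k (γ k), A.continuous.clm_apply γ.continuous⟩ : C(K, F)))
      (fun _ _ _ => by ext; simp) (fun _ _ _ => by ext; simp) (fun _ _ _ => by ext; simp)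
      (fun _ _ _ => by ext; simp)) 1
    (fun A γ => by
      refine (ContinuousMap.norm_le _ (by positivity)).2 fun k => ?_
      rw [one_mul]
      exact (A k).le_of_opNorm_le_of_le (A.norm_coe_le_norm k) (γ.norm_coe_le_norm k))

lemma hasFDerivAt_superposition {V : C(E, F)} {V' : C(E, E →L[ℝ] F)}
    (hV : ∀ x, HasFDerivAt V (V' x) x) (γ : C(K, E)) :
    HasFDerivAt (superposition V : C(K, E) → C(K, F)) (pointwiseApply (superposition V' γ)) γ := by
  rw [hasFDerivAt_iff_isLittleO, Asymptotics.isLittleO_iff]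
  intro c hc
  have hcont := (continuous_superposition (K := K) V').continuousAt (x := γ)
  obtain ⟨δ, hδ, hball⟩ := Metric.continuousAt_iff.1 hcont c hc
  filter_upwards [Metric.ball_mem_nhds γ hδ] with γ' hγ'
  refine (ContinuousMap.norm_le _ (by positivity)).2 fun k => ?_
  have hk : ‖γ' k - γ k‖ ≤ ‖γ' - γ‖ := (γ' - γ).norm_coe_le_norm k
  have hk' : ‖γ' k - γ k‖ < δ := hk.trans_lt (by rwa [← dist_eq_norm])
  refine le_trans ?_ (mul_le_mul_of_nonneg_left hk hc.le)
  refine Convex.norm_image_sub_le_of_norm_hasFDerivWithin_le' (f := V) (f' := V') (φ := V' (γ k))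
    (s := Metric.ball (γ k) δ) (fun x _ => (hV x).hasFDerivWithinAt) (fun x hx => ?_)
    (convex_ball _ _) (Metric.mem_ball_self hδ) (by rwa [mem_ball_iff_norm])
  have h1 : dist (γ + ContinuousMap.const K (x - γ k)) γ < δ := by
    rw [dist_eq_norm, add_sub_cancel_left]
    refine lt_of_le_of_lt ((ContinuousMap.norm_le _ (norm_nonneg _)).2 fun _ => le_rfl) ?_
    rwa [mem_ball_iff_norm] at hx
  have h2 := hball h1
  rw [dist_eq_norm] at h2
  have h3 := (ContinuousMap.norm_coe_le_norm _ k).trans h2.le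
  simpa [superposition] using h3

set_option synthInstance.maxHeartbeats 400000 in
set_option maxHeartbeats 1000000 in
theorem contDiff_superposition_nat (n : ℕ) {F : Type u} [NormedAddCommGroup F] [NormedSpace ℝ F]
    (V : C(E, F)) (hV : ContDiff ℝ n V) :
    ContDiff ℝ n (superposition V : C(K, E) → C(K, F)) := by
  induction n generalizing F with
  | zero => exact contDiff_zero.2 (continuous_superposition V)
  | succ n ih =>
    obtain ⟨V', hV', hd⟩ := contDiff_succ_iff_hasFDerivAt.1 hV
    let W : C(E, E →L[ℝ] F) := ⟨V', hV'.continuous⟩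
    have h1 : ContDiff ℝ n (superposition W : C(K, E) → C(K, E →L[ℝ] F)) := ih W hV'
    have h2 : ContDiff ℝ n (fun γ : C(K, E) => pointwiseApply (superposition W γ)) :=
      h1.continuousLinearMap_comp pointwiseApply
    exact contDiff_succ_iff_hasFDerivAt.2 ⟨_, h2, hasFDerivAt_superposition hd⟩

theorem contDiff_superposition {V : C(E, F)} (hV : ContDiff ℝ ∞ V) :
    ContDiff ℝ ∞ (superposition V : C(K, E) → C(K, F)) :=
  contDiff_infty.2 fun n => contDiff_superposition_nat n V (contDiff_infty.1 hV n)

end Nemytskii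

section LocalFlow

universe u

variable {E : Type u} [NormedAddCommGroup E] [NormedSpace ℝ E] [CompleteSpace E]

/-- The primitive of a continuous function on the unit interval. -/
def primitive : C(unitInterval, E) →L[ℝ] C(unitInterval, E) :=
  have hint : ∀ (γ : C(unitInterval, E)) (a b : ℝ), IntervalIntegrable
      (fun u => γ (projIcc 0 1 zero_le_one u)) MeasureTheory.volume a b := fun γ a b =>
    (γ.continuous.comp continuous_projIcc).intervalIntegrable a b
  LinearMap.mkContinuous
    { toFun := fun γ => ⟨fun r => ∫ u in (0 : ℝ)..r, γ (projIcc 0 1 zero_le_one u),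
        (intervalIntegral.continuous_primitive (hint γ) 0).comp continuous_subtype_val⟩
      map_add' := fun γ γ' => by
        ext r
        exact intervalIntegral.integral_add (hint γ _ _) (hint γ' _ _)
      map_smul' := fun c γ => by
        ext r
        exact intervalIntegral.integral_smul c _ } 1
    (fun γ => by
      refine (ContinuousMap.norm_le _ (by positivity)).2 fun r => ?_
      have h := intervalIntegral.norm_integral_le_of_norm_le_const
        (f := fun u => γ (projIcc 0 1 zero_le_one u)) (a := 0) (b := r) (C := ‖γ‖)
        fun u _ => γ.norm_coe_le_norm _
      rw [sub_zero, abs_of_nonneg r.2.1] at h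
      rw [one_mul]
      exact h.trans (mul_le_of_le_one_right (norm_nonneg _) r.2.2))

lemma primitive_apply (γ : C(unitInterval, E)) (r : unitInterval) :
    primitive γ r = ∫ u in (0 : ℝ)..r, γ (projIcc 0 1 zero_le_one u) := rfl

/-- The constant functions on the unit interval. -/
def constCLM : E →L[ℝ] C(unitInterval, E) :=
  LinearMap.mkContinuous
    { toFun := ContinuousMap.const unitInterval
      map_add' := fun _ _ => rfl
      map_smul' := fun _ _ => rfl } 1
    (fun x => (ContinuousMap.norm_le _ (by positivity)).2 fun _ => by
      rw [one_mul]; exact le_rfl)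

/-- The equation `γ(r) = x + s ∫_0^r V(γ)` in the unknown `γ`, as a map. -/
def integralEquation (V : C(E, E)) (y : (ℝ × E) × C(unitInterval, E)) :
    (ℝ × E) × C(unitInterval, E) :=
  (y.1, y.2 - constCLM y.1.2 - y.1.1 • primitive (superposition V y.2))

lemma contDiff_integralEquation {V : C(E, E)} (hV : ContDiff ℝ ∞ V) :
    ContDiff ℝ ∞ (integralEquation V) := by
  refine contDiff_fst.prodMk ((contDiff_snd.sub ?_).sub (contDiff_fst.fst.smul ?_))
  · exact ContDiff.continuousLinearMap_comp (𝕜 := ℝ) (F := E) (G := C(unitInterval, E)) constCLM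
      contDiff_fst.snd
  · exact ContDiff.continuousLinearMap_comp (𝕜 := ℝ) (F := C(unitInterval, E))
      (G := C(unitInterval, E)) primitive ((contDiff_superposition hV).comp contDiff_snd)

lemma hasFDerivAt_integralEquation {V : C(E, E)} (hV : ContDiff ℝ ∞ V) (x₀ : E)
    (γ₀ : C(unitInterval, E)) :
    HasFDerivAt (integralEquation V)
      ((ContinuousLinearEquiv.refl ℝ (ℝ × E)).skewProd (ContinuousLinearEquiv.refl ℝ _)
        (-(constCLM.comp (ContinuousLinearMap.snd ℝ ℝ E) +
          (ContinuousLinearMap.fst ℝ ℝ E).smulRight (primitive (superposition V γ₀))))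
        : (ℝ × E) × C(unitInterval, E) →L[ℝ] (ℝ × E) × C(unitInterval, E)) ((0, x₀), γ₀) := by
  have h1 : HasFDerivAt (superposition V : C(unitInterval, E) → C(unitInterval, E))
      (fderiv ℝ (superposition V) γ₀) γ₀ :=
    ((contDiff_superposition hV).differentiable (by simp) γ₀).hasFDerivAt
  have h2 := primitive.hasFDerivAt.comp γ₀ h1
  have h3 : HasFDerivAt (fun y : (ℝ × E) × C(unitInterval, E) => primitive (superposition V y.2))
      ((primitive.comp (fderiv ℝ (superposition V) γ₀)).comp
        (ContinuousLinearMap.snd ℝ (ℝ × E) C(unitInterval, E))) ((0, x₀), γ₀) :=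
    HasFDerivAt.comp (g := fun γ => primitive (superposition V γ)) ((0, x₀), γ₀) h2 hasFDerivAt_snd
  have h4 : HasFDerivAt (fun y : (ℝ × E) × C(unitInterval, E) => y.1.1)
      ((ContinuousLinearMap.fst ℝ ℝ E).comp (ContinuousLinearMap.fst ℝ (ℝ × E) C(unitInterval, E)))
      ((0, x₀), γ₀) := hasFDerivAt_fst.fst
  have h5 : HasFDerivAt (fun y : (ℝ × E) × C(unitInterval, E) => constCLM y.1.2)
      ((constCLM.comp (ContinuousLinearMap.snd ℝ ℝ E)).comp
        (ContinuousLinearMap.fst ℝ (ℝ × E) C(unitInterval, E)))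
      ((0, x₀), γ₀) := (constCLM.comp (ContinuousLinearMap.snd ℝ ℝ E)).hasFDerivAt.comp _ hasFDerivAt_fst
  have h6 := hasFDerivAt_fst.prodMk ((hasFDerivAt_snd.sub h5).sub (h4.smul h3))
  refine h6.congr_fderiv ?_
  ext <;> simp [sub_eq_add_neg, add_comm]

end LocalFlow

section LocalFlow

universe u

variable {E : Type u} [NormedAddCommGroup E] [NormedSpace ℝ E] [CompleteSpace E]

/-- Slowing down a curve on the unit interval by the factor `c`. -/
def slowDown (c : unitInterval) (γ : C(unitInterval, E)) : C(unitInterval, E) :=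
  ⟨fun r => γ (c * r), γ.continuous.comp (continuous_const.mul continuous_id)⟩

lemma primitive_slowDown (c : unitInterval) (γ : C(unitInterval, E)) (r : unitInterval) :
    (c : ℝ) • primitive (slowDown c γ) r = primitive γ (c * r) := by
  rw [primitive_apply, primitive_apply]
  have h := intervalIntegral.smul_integral_comp_mul_right (a := 0) (b := r)
    (fun u => γ (projIcc 0 1 zero_le_one u)) (c : ℝ)
  rw [zero_mul, mul_comm (r : ℝ)] at h
  rw [show ((c * r : unitInterval) : ℝ) = (c : ℝ) * r from rfl, ← h]
  congr 1
  refine intervalIntegral.integral_congr fun u hu => ?_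
  rw [uIcc_of_le r.2.1] at hu
  have hu' : u ∈ Icc (0 : ℝ) 1 := ⟨hu.1, hu.2.trans r.2.2⟩
  show γ (c * projIcc 0 1 zero_le_one u) = γ (projIcc 0 1 zero_le_one (u * c))
  congr 1
  apply Subtype.ext
  have h1 : u * c ∈ Icc (0 : ℝ) 1 :=
    ⟨mul_nonneg hu'.1 c.2.1, mul_le_one₀ hu'.2 c.2.1 c.2.2⟩
  rw [projIcc_of_mem _ hu', projIcc_of_mem _ h1]
  exact mul_comm _ _

/-- Smooth local flows of smooth vector fields on a Banach space. -/
theorem exists_smooth_localFlow {V : C(E, E)} (hV : ContDiff ℝ ∞ V) (x₀ : E) :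
    ∃ (Φ : ℝ × E → E) (D : Set (ℝ × E)), IsOpen D ∧ (0, x₀) ∈ D ∧ ContDiffOn ℝ ∞ Φ D ∧
      (∀ x, (0, x) ∈ D → Φ (0, x) = x) ∧
      ∀ s x, (s, x) ∈ D → HasDerivAt (fun s => Φ (s, x)) (V (Φ (s, x))) s := by
  obtain ⟨f, hf0, -, hfG, hfs⟩ := exists_localInverse isOpen_univ
    (contDiff_integralEquation hV).contDiffOn (mem_univ _)
    (hasFDerivAt_integralEquation hV x₀ (constCLM x₀))
  let Γ (z : ℝ × E) : C(unitInterval, E) := (f.symm (z, 0)).2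
  let D₀ : Set (ℝ × E) := {z | (z, (0 : C(unitInterval, E))) ∈ f.target}
  have hD₀ : IsOpen D₀ := f.open_target.preimage (by fun_prop)
  have hΓ : ContDiffOn ℝ ∞ Γ D₀ :=
    contDiff_snd.comp_contDiffOn (hfs.comp
      (contDiff_id.prodMk contDiff_const).contDiffOn fun _ hz => hz)
  have hG (y) : f y = (y.1, y.2 - constCLM y.1.2 - y.1.1 • primitive (superposition V y.2)) :=
    congrFun hfG y
  have hΓs : ∀ z ∈ D₀, (z, Γ z) ∈ f.source ∧
      Γ z = constCLM z.2 + z.1 • primitive (superposition V (Γ z)) := by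
    intro z hz
    have h1 := f.right_inv hz
    rw [hG, Prod.mk.injEq] at h1
    have h2 : f.symm (z, 0) = (z, Γ z) := Prod.ext h1.1 rfl
    refine ⟨h2 ▸ f.map_target hz, ?_⟩
    have h3 := h1.2
    rw [h2] at h3
    rw [sub_sub, sub_eq_zero] at h3
    exact h3
  have huniq : ∀ z γ, (z, γ) ∈ f.source →
      γ = constCLM z.2 + z.1 • primitive (superposition V γ) → z ∈ D₀ ∧ Γ z = γ := by
    intro z γ hs hγ
    have h1 : f (z, γ) = (z, 0) := by
      rw [hG]
      refine Prod.ext rfl ?_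
      rw [sub_sub, sub_eq_zero]
      exact hγ
    refine ⟨show (z, (0 : C(unitInterval, E))) ∈ f.target from h1 ▸ f.map_source hs, ?_⟩
    show (f.symm (z, 0)).2 = γ
    rw [← h1, f.left_inv hs]
  have h00 : ((0 : ℝ), x₀) ∈ D₀ ∧ Γ (0, x₀) = constCLM x₀ := huniq _ _ hf0 (by simp)
  obtain ⟨ρ, hρ, hball⟩ := Metric.isOpen_iff.1 f.open_source _ hf0
  let D : Set (ℝ × E) := D₀ ∩ (fun z => (z, Γ z)) ⁻¹' Metric.ball ((0, x₀), constCLM x₀) ρ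
  have hD : IsOpen D :=
    (continuousOn_id.prodMk hΓ.continuousOn).isOpen_inter_preimage hD₀ Metric.isOpen_ball
  have hmemD : ∀ {z : ℝ × E} {γ : C(unitInterval, E)},
      (z, γ) ∈ Metric.ball (((0 : ℝ), x₀), constCLM x₀) ρ ↔
        (|z.1| < ρ ∧ dist z.2 x₀ < ρ) ∧ dist γ (constCLM x₀) < ρ := by
    intro z γ
    rw [Metric.mem_ball, Prod.dist_eq, max_lt_iff, Prod.dist_eq, max_lt_iff, Real.dist_0_eq_abs]
  have hscale : ∀ z ∈ D, ∀ c : unitInterval, ((c : ℝ) * z.1, z.2) ∈ D ∧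
      Γ ((c : ℝ) * z.1, z.2) = slowDown c (Γ z) := by
    rintro z ⟨hz, hzb⟩ c
    obtain ⟨⟨h1, h2⟩, h3⟩ := hmemD.1 hzb
    have hb : (((c : ℝ) * z.1, z.2), slowDown c (Γ z)) ∈
        Metric.ball (((0 : ℝ), x₀), constCLM x₀) ρ := by
      refine hmemD.2 ⟨⟨?_, h2⟩, ?_⟩
      · rw [abs_mul, abs_of_nonneg c.2.1]
        exact (mul_le_of_le_one_left (abs_nonneg _) c.2.2).trans_lt h1
      · refine lt_of_le_of_lt ?_ h3
        refine (ContinuousMap.dist_le dist_nonneg).2 fun r => ?_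
        exact (Γ z).dist_apply_le_dist (g := constCLM x₀) (c * r)
    obtain ⟨h4, h5⟩ := huniq ((c : ℝ) * z.1, z.2) (slowDown c (Γ z)) (hball hb) (by
      ext r
      have h6 := congrArg (fun γ : C(unitInterval, E) => γ (c * r)) (hΓs z hz).2
      have h7 := primitive_slowDown c (superposition V (Γ z)) r
      have h8 : superposition V (slowDown c (Γ z)) = slowDown c (superposition V (Γ z)) := rfl
      show Γ z (c * r) = z.2 + ((c : ℝ) * z.1) • primitive (superposition V (slowDown c (Γ z))) r
      rw [h8, mul_comm (c : ℝ), mul_smul, h7]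
      exact h6)
    refine ⟨⟨h4, ?_⟩, h5⟩
    rw [mem_preimage, h5]
    exact hb
  have hmem0 : ((0 : ℝ), x₀) ∈ D := by
    refine ⟨h00.1, ?_⟩
    rw [mem_preimage, h00.2]
    exact Metric.mem_ball_self hρ
  let Φ (z : ℝ × E) : E := Γ z 1
  have hΦ : ContDiffOn ℝ ∞ Φ D :=
    ContDiff.comp_contDiffOn (g := fun γ : C(unitInterval, E) => γ 1)
      (ContDiff.continuousLinearMap_comp (𝕜 := ℝ) (F := C(unitInterval, E)) (G := E)
        (ContinuousMap.evalCLM ℝ (1 : unitInterval)) contDiff_id) (hΓ.mono inter_subset_left)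
  have hinteg : ∀ s x, (s, x) ∈ D → Φ (s, x) = x + ∫ u in (0 : ℝ)..s, V (Φ (u, x)) := by
    intro s x hz
    have h1 := congrArg (fun γ : C(unitInterval, E) => γ 1) (hΓs _ hz.1).2
    have h2 := intervalIntegral.smul_integral_comp_mul_right (a := 0) (b := 1)
      (fun u => V (Φ (u, x))) s
    rw [zero_mul, one_mul] at h2
    rw [← h2]
    refine h1.trans ?_
    show x + s • ∫ u in (0 : ℝ)..1, V (Γ (s, x) (projIcc 0 1 zero_le_one u)) = _
    congr 2
    refine intervalIntegral.integral_congr fun u hu => ?_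
    rw [uIcc_of_le zero_le_one] at hu
    have h3 := (hscale _ hz ⟨u, hu⟩).2
    show V _ = V (Γ (u * s, x) 1)
    rw [h3, projIcc_of_mem _ hu]
    show _ = V (Γ (s, x) (⟨u, hu⟩ * 1))
    rw [mul_one]
  refine ⟨Φ, D, hD, hmem0, hΦ, fun x hx => by rw [hinteg 0 x hx]; simp, fun s x hz => ?_⟩
  have hopen : IsOpen {u : ℝ | (u, x) ∈ D} := hD.preimage (by fun_prop)
  have hcont : ContinuousOn (fun u => V (Φ (u, x))) {u : ℝ | (u, x) ∈ D} :=
    V.continuous.comp_continuousOn (hΦ.continuousOn.comp (by fun_prop) fun _ hu => hu)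
  have hsub : uIcc 0 s ⊆ {u : ℝ | (u, x) ∈ D} := by
    intro u hu
    rw [← segment_eq_uIcc, segment_eq_image] at hu
    obtain ⟨c, hc, rfl⟩ := hu
    have := (hscale _ hz ⟨c, hc⟩).1
    simpa using this
  have hder := (intervalIntegral.integral_hasDerivAt_right
    (hcont.mono hsub).intervalIntegrable (hcont.stronglyMeasurableAtFilter hopen s hz)
    (hcont.continuousAt (hopen.mem_nhds hz))).const_add x
  refine hder.congr_of_eventuallyEq ?_
  filter_upwards [hopen.mem_nhds hz] with u hu using hinteg u x hu

end LocalFlow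

section FlowBox

universe u

variable {E : Type u} [NormedAddCommGroup E] [NormedSpace ℝ E] [FiniteDimensional ℝ E]
  {H : Type*} [TopologicalSpace H] {I : ModelWithCorners ℝ E H} [I.Boundaryless]
  {N : Type*} [TopologicalSpace N] [ChartedSpace H N] [IsManifold I ∞ N]
  {E₀ : Type*} [NormedAddCommGroup E₀] [NormedSpace ℝ E₀] [FiniteDimensional ℝ E₀]

/-- A smooth function on an open set agrees near a given point with a globally smooth function. -/
lemma exists_contDiff_extension {F : Type*} [NormedAddCommGroup F] [NormedSpace ℝ F]
    {V : E → F} {U : Set E} (hU : IsOpen U) (hV : ContDiffOn ℝ ∞ V U) {x : E} (hx : x ∈ U) :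
    ∃ W : E → F, ContDiff ℝ ∞ W ∧ ∃ r > 0, Metric.ball x r ⊆ U ∧ EqOn W V (Metric.ball x r) := by
  obtain ⟨r, hr, hball⟩ := Metric.isOpen_iff.1 hU x hx
  let b : ContDiffBump x := ⟨r / 4, r / 2, by positivity, by linarith⟩
  refine ⟨fun y => b y • V y, ?_, r / 4, by positivity,
    (Metric.ball_subset_ball (by linarith)).trans hball, fun y hy => ?_⟩
  · rw [contDiff_iff_contDiffAt]
    intro y
    by_cases hy : y ∈ U
    · exact b.contDiff.contDiffAt.smul (hV.contDiffAt (hU.mem_nhds hy))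
    · have h1 : y ∈ (Metric.closedBall x (r / 2))ᶜ := fun h => hy (hball
        (Metric.closedBall_subset_ball (by linarith) h))
      refine (contDiffAt_const (c := (0 : F))).congr_of_eventuallyEq ?_
      filter_upwards [Metric.isClosed_closedBall.isOpen_compl.mem_nhds h1] with z hz
      have : b z = 0 := b.zero_of_le_dist (by
        rw [mem_compl_iff, Metric.mem_closedBall, not_le] at hz
        exact hz.le)
      rw [this, zero_smul]
  · have : b y = 1 := b.one_of_mem_closedBall (Metric.ball_subset_closedBall hy)
    show b y • V y = V y
    rw [this, one_smul]

/-- A nonzero vector can be completed to a splitting. -/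
lemma exists_splitting {v : E} (hv : v ≠ 0) (hd : Module.finrank ℝ E = Module.finrank ℝ E₀ + 1) :
    ∃ A : (E₀ × ℝ) ≃L[ℝ] E, A (0, 1) = v := by
  obtain ⟨C, hC⟩ := (Submodule.span ℝ {v}).exists_isCompl
  have h1 : Module.finrank ℝ (Submodule.span ℝ {v}) = 1 := finrank_span_singleton hv
  have h2 := Submodule.finrank_add_eq_of_isCompl hC
  have e₁ : E₀ ≃ₗ[ℝ] C := LinearEquiv.ofFinrankEq _ _ (by omega)
  let A := (e₁.prodCongr (LinearEquiv.toSpanNonzeroSingleton ℝ E v hv)).trans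
    (Submodule.prodEquivOfIsCompl C _ hC.symm)
  refine ⟨A.toContinuousLinearEquiv, ?_⟩
  simp [A]

/-- The flow box theorem in a vector space. -/
lemma exists_straightening {V : C(E, E)} (hV : ContDiff ℝ ∞ V) {x₀ : E} (h0 : V x₀ ≠ 0)
    (hd : Module.finrank ℝ E = Module.finrank ℝ E₀ + 1) {U : Set E} (hU : IsOpen U)
    (hx₀ : x₀ ∈ U) :
    ∃ f : OpenPartialHomeomorph (E₀ × ℝ) E, (0, 0) ∈ f.source ∧ f (0, 0) = x₀ ∧
      (∀ y ∈ f.source, f y ∈ U) ∧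
      ContDiffOn ℝ ∞ f f.source ∧ ContDiffOn ℝ ∞ f.symm f.target ∧
      ∀ y ∈ f.source, fderiv ℝ f y (0, 1) = V (f y) := by
  have : CompleteSpace E := FiniteDimensional.complete ℝ E
  have : CompleteSpace E₀ := FiniteDimensional.complete ℝ E₀
  obtain ⟨A, hA⟩ := exists_splitting (E₀ := E₀) h0 hd
  obtain ⟨Φ, D, hD, hxD, hΦ, hΦ0, hΦd⟩ := exists_smooth_localFlow hV x₀
  let j (y : E₀ × ℝ) : ℝ × E := (y.2, x₀ + A (y.1, 0))
  have hj : ContDiff ℝ ∞ j := contDiff_snd.prodMk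
    (contDiff_const.add (A.contDiff.comp (contDiff_fst.prodMk contDiff_const)))
  have hj0 : j (0, 0) = (0, x₀) := by
    show ((0 : ℝ), x₀ + A ((0 : E₀), (0 : ℝ))) = (0, x₀)
    rw [Prod.mk_zero_zero, map_zero, add_zero]
  let Ψ (y : E₀ × ℝ) : E := Φ (j y)
  have hjD : IsOpen (j ⁻¹' D) := hD.preimage hj.continuous
  have hΨ : ContDiffOn ℝ ∞ Ψ (j ⁻¹' D) := hΦ.comp hj.contDiffOn fun _ h => h
  have hΨ0 : Ψ (0, 0) = x₀ := by
    show Φ (j (0, 0)) = x₀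
    rw [hj0]
    exact hΦ0 _ hxD
  have h0D : ((0 : E₀), (0 : ℝ)) ∈ j ⁻¹' D := by
    rw [mem_preimage, hj0]
    exact hxD
  have hΨU : IsOpen (j ⁻¹' D ∩ Ψ ⁻¹' U) := hΨ.continuousOn.isOpen_inter_preimage hjD hU
  have hdt : ∀ y ∈ j ⁻¹' D, fderiv ℝ Ψ y (0, 1) = V (Ψ y) := by
    intro y hy
    have h1 : HasFDerivAt Ψ (fderiv ℝ Ψ y) (y.1, y.2) :=
      ((hΨ.contDiffAt (hjD.mem_nhds hy)).differentiableAt (by simp)).hasFDerivAt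
    have h2 : HasDerivAt (fun t : ℝ => (y.1, t)) ((0 : E₀), (1 : ℝ)) y.2 :=
      (hasDerivAt_const _ _).prodMk (hasDerivAt_id _)
    exact (h1.comp_hasDerivAt y.2 h2).unique (hΦd y.2 _ hy)
  have hder : HasFDerivAt Ψ (A : E₀ × ℝ →L[ℝ] E) (0, 0) := by
    have h1 : HasFDerivAt Ψ (fderiv ℝ Ψ (0, 0)) (0, 0) :=
      ((hΨ.contDiffAt (hjD.mem_nhds h0D)).differentiableAt (by simp)).hasFDerivAt
    have h2 : HasFDerivAt (fun w : E₀ => (w, (0 : ℝ))) (ContinuousLinearMap.inl ℝ E₀ ℝ) 0 :=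
      hasFDerivAt_prodMk_left _ _
    have h3 : HasFDerivAt (fun w : E₀ => Ψ (w, 0))
        ((fderiv ℝ Ψ (0, 0)).comp (ContinuousLinearMap.inl ℝ E₀ ℝ)) 0 :=
      HasFDerivAt.comp (0 : E₀) (g := Ψ) (f := fun w : E₀ => (w, (0 : ℝ))) h1 h2
    have h4 : HasFDerivAt (fun w : E₀ => Ψ (w, 0))
        ((A : E₀ × ℝ →L[ℝ] E).comp (ContinuousLinearMap.inl ℝ E₀ ℝ)) 0 := by
      refine (((A : E₀ × ℝ →L[ℝ] E).comp
        (ContinuousLinearMap.inl ℝ E₀ ℝ)).hasFDerivAt.const_add x₀).congr_of_eventuallyEq ?_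
      have hc : Continuous fun w : E₀ => (w, (0 : ℝ)) := by fun_prop
      filter_upwards [(hjD.preimage hc).mem_nhds h0D] with w hw
      exact hΦ0 _ hw
    have h5 := h3.unique h4
    have h6 : fderiv ℝ Ψ (0, 0) = A := by
      refine ContinuousLinearMap.prod_ext h5 (ContinuousLinearMap.ext_ring ?_)
      show fderiv ℝ Ψ (0, 0) (0, 1) = A (0, 1)
      rw [hdt _ h0D, hΨ0, hA]
    rwa [h6] at h1
  obtain ⟨f, hf0, hfU, hfΨ, hfs⟩ := exists_localInverse hΨU (hΨ.mono inter_subset_left)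
    ⟨h0D, by rwa [mem_preimage, hΨ0]⟩ hder
  refine ⟨f, hf0, by rw [hfΨ, hΨ0], fun y hy => ?_, ?_, hfs, fun y hy => ?_⟩
  · rw [hfΨ]; exact (hfU hy).2
  · rw [hfΨ]; exact hΨ.mono fun y hy => (hfU hy).1
  · rw [hfΨ]; exact hdt y (hfU hy).1

/-- The flow box theorem on a manifold. -/
theorem exists_flowBox {ξ : (q : N) → TangentSpace I q} (hξ : ∀ q, SmoothFieldAt I ξ q) {p : N}
    (h0 : ξ p ≠ 0) (hd : Module.finrank ℝ E = Module.finrank ℝ E₀ + 1) :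
    ∃ (e : OpenPartialHomeomorph N (E₀ × ℝ)) (W : Set E₀) (ε : ℝ), IsOpen W ∧ 0 < ε ∧ ε ≤ 1 ∧
      IsFoliatedChart ξ e W (-ε) ε ∧ p ∈ e.source ∧
      ∀ q ∈ e.source, mvfderiv I (fun q => (e q).2) q (ξ q) = 1 := by
  let φ : OpenPartialHomeomorph N E :=
    { extChartAt I p with
      open_source := isOpen_extChartAt_source p
      open_target := isOpen_extChartAt_target p
      continuousOn_toFun := continuousOn_extChartAt p
      continuousOn_invFun := continuousOn_extChartAt_symm p }
  have hp : p ∈ φ.source := mem_extChartAt_source (I := I) p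
  have hφ : ∀ {q}, q ∈ φ.source → ContMDiffAt I 𝓘(ℝ, E) ∞ φ q := fun hq =>
    (contMDiffOn_extChartAt (I := I)).contMDiffAt ((chartAt H p).open_source.mem_nhds
      (by rwa [← extChartAt_source I]))
  have hφs : ∀ {y}, y ∈ φ.target → ContMDiffAt 𝓘(ℝ, E) I ∞ φ.symm y := fun hy =>
    (contMDiffOn_extChartAt_symm p).contMDiffAt (φ.open_target.mem_nhds hy)
  let V₀ (y : E) : E := mvfderiv I φ (φ.symm y) (ξ (φ.symm y))
  have hV₀ : ContDiffOn ℝ ∞ V₀ φ.target := by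
    intro y hy
    have h1 := (hξ (φ.symm y)).mvfderiv (hφ (φ.map_target hy))
    exact (ContMDiffAt.contDiffAt (h1.comp y (hφs hy))).contDiffWithinAt
  obtain ⟨V, hV, r, hr, hrU, hVV⟩ := exists_contDiff_extension φ.open_target hV₀ (φ.map_source hp)
  have hφp : φ p ∈ Metric.ball (φ p) r := Metric.mem_ball_self hr
  have hVp : V (φ p) ≠ 0 := by
    rw [hVV hφp]
    show mvfderiv I φ (φ.symm (φ p)) (ξ (φ.symm (φ p))) ≠ 0
    rw [φ.left_inv hp]
    intro h
    refine h0 (mvfderiv_extChartAt_injective (I' := I) hp ?_)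
    rw [map_zero]
    exact h
  obtain ⟨f, hf0, hfp, hfU, hf, hfs, hft⟩ := exists_straightening (E₀ := E₀)
    (V := ⟨V, hV.continuous⟩) hV hVp hd Metric.isOpen_ball hφp
  obtain ⟨δ, hδ, hδf⟩ := Metric.isOpen_iff.1 f.open_source _ hf0
  let ε := min δ 1
  have hε : 0 < ε := lt_min hδ one_pos
  let box : Set (E₀ × ℝ) := Metric.ball 0 ε ×ˢ Ioo (-ε) ε
  have hbox : IsOpen box := Metric.isOpen_ball.prod isOpen_Ioo
  have hboxf : box ⊆ f.source := by
    rintro ⟨w, t⟩ ⟨hw, ht⟩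
    refine hδf ?_
    rw [Metric.mem_ball, Prod.dist_eq, max_lt_iff]
    refine ⟨(Metric.mem_ball.1 hw).trans_le (min_le_left _ _), ?_⟩
    rw [Real.dist_0_eq_abs]
    exact (abs_lt.2 ht).trans_le (min_le_left _ _)
  let f₁ := f.restrOpen box hbox
  have hf₁ : f₁.source = box := inter_eq_right.2 hboxf
  let e := φ.trans f₁.symm
  have hes {q : N} (hq : q ∈ e.source) : q ∈ φ.source ∧ φ q ∈ f.target ∧ f.symm (φ q) ∈ box := by
    have h1 : f₁.symm (φ q) ∈ f₁.source := f₁.map_target hq.2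
    exact ⟨hq.1, f₁.right_inv hq.2 ▸ f.map_source h1.1, h1.2⟩
  have het : e.target = box := by
    have : e.target = f₁.source ∩ f₁ ⁻¹' φ.target := rfl
    rw [this, hf₁]
    exact inter_eq_left.2 fun y hy => hrU (hfU y (hboxf hy))
  have hesm : ∀ q ∈ e.source, ContMDiffAt I 𝓘(ℝ, E₀ × ℝ) ∞ e q := fun q hq =>
    ((hfs.contDiffAt (f.open_target.mem_nhds (hes hq).2.1)).contMDiffAt).comp q (hφ (hes hq).1)
  have hξe : ∀ q ∈ e.source, mvfderiv I e q (ξ q) = ((0 : E₀), (1 : ℝ)) := by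
    intro q hq
    obtain ⟨h1, h2, h3⟩ := hes hq
    have hys := f.map_target h2
    have hfd := (hfs.contDiffAt (f.open_target.mem_nhds h2)).differentiableAt (by simp)
    have h4 := mvfderiv_comp_mfderiv (I' := 𝓘(ℝ, E)) (u := f.symm) (pr := φ)
      hfd.mdifferentiableAt ((hφ h1).mdifferentiableAt (by simp)) (ξ q)
    have h5 : mvfderiv I φ q (ξ q) = fderiv ℝ f (f.symm (φ q)) (0, 1) := by
      rw [hft _ hys, f.right_inv h2]
      have h6 : φ q ∈ Metric.ball (φ p) r := by
        have := hfU _ hys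
        rwa [f.right_inv h2] at this
      have h7 : V (φ q) = V₀ (φ q) := hVV h6
      show _ = V (φ q)
      rw [h7]
      show _ = mvfderiv I φ (φ.symm (φ q)) (ξ (φ.symm (φ q)))
      rw [φ.left_inv h1]
    have h8 : mvfderiv 𝓘(ℝ, E) f.symm (φ q) = fderiv ℝ f.symm (φ q) := mfderiv_eq_fderiv ..
    have h9 : HasFDerivAt (f.symm ∘ f) ((fderiv ℝ f.symm (φ q)).comp
        (fderiv ℝ f (f.symm (φ q)))) (f.symm (φ q)) := by
      refine HasFDerivAt.comp _ ?_
        ((hf.contDiffAt (f.open_source.mem_nhds hys)).differentiableAt (by simp)).hasFDerivAt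
      rw [f.right_inv h2]
      exact hfd.hasFDerivAt
    have h10 : HasFDerivAt (f.symm ∘ f) (ContinuousLinearMap.id ℝ (E₀ × ℝ)) (f.symm (φ q)) := by
      refine (hasFDerivAt_id _).congr_of_eventuallyEq ?_
      filter_upwards [f.open_source.mem_nhds hys] with y hy using f.left_inv hy
    have h11 := congrArg (fun A : E₀ × ℝ →L[ℝ] E₀ × ℝ => A (0, 1)) (h9.unique h10)
    rw [h8] at h4
    refine h4.trans (Eq.trans ?_ h11)
    exact congrArg (fderiv ℝ f.symm (φ q)) h5
  have hfst : ∀ q ∈ e.source, ∀ v, mvfderiv I (fun q => (e q).1) q v = (mvfderiv I e q v).1 := by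
    intro q hq v
    have h1 := mvfderiv_comp_mfderiv (I' := 𝓘(ℝ, E₀ × ℝ)) (u := Prod.fst (α := E₀) (β := ℝ))
      (contDiff_fst.contMDiff.mdifferentiable (n := ∞) (by simp) _)
      ((hesm q hq).mdifferentiableAt (by simp)) v
    rw [show mvfderiv 𝓘(ℝ, E₀ × ℝ) (Prod.fst (α := E₀) (β := ℝ)) (e q) =
        ContinuousLinearMap.fst ℝ E₀ ℝ from (mfderiv_eq_fderiv ..).trans fderiv_fst] at h1
    exact h1
  have hsnd : ∀ q ∈ e.source, ∀ v, mvfderiv I (fun q => (e q).2) q v = (mvfderiv I e q v).2 := by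
    intro q hq v
    have h1 := mvfderiv_comp_mfderiv (I' := 𝓘(ℝ, E₀ × ℝ)) (u := Prod.snd (α := E₀) (β := ℝ))
      (contDiff_snd.contMDiff.mdifferentiable (n := ∞) (by simp) _)
      ((hesm q hq).mdifferentiableAt (by simp)) v
    rw [show mvfderiv 𝓘(ℝ, E₀ × ℝ) (Prod.snd (α := E₀) (β := ℝ)) (e q) =
        ContinuousLinearMap.snd ℝ E₀ ℝ from (mfderiv_eq_fderiv ..).trans fderiv_snd] at h1
    exact h1
  refine ⟨e, Metric.ball 0 ε, ε, Metric.isOpen_ball, hε, min_le_right _ _,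
    ⟨fun q hq => (hesm q hq).contMDiffWithinAt, ?_, het, fun q hq => ?_⟩, ?_, fun q hq => ?_⟩
  · intro y hy
    rw [het] at hy
    have h1 := (hf.contDiffAt (f.open_source.mem_nhds (hboxf hy))).contMDiffAt
    exact (ContMDiffAt.comp y (g := φ.symm) (hφs (hrU (hfU y (hboxf hy)))) h1).contMDiffWithinAt
  · exact (hfst q hq (ξ q)).trans (by rw [hξe q hq]; rfl)
  · have h1 : φ p ∈ f.target := by rw [← hfp]; exact f.map_source hf0
    refine ⟨hp, ?_⟩
    have h2 : f.symm (φ p) = (0, 0) := by rw [← hfp, f.left_inv hf0]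
    show φ p ∈ f₁.target
    have h3 : ((0 : E₀), (0 : ℝ)) ∈ f₁.source := by
      rw [hf₁]
      exact ⟨Metric.mem_ball_self hε, by simp [hε]⟩
    have h4 := f₁.map_source h3
    rwa [show f₁ (0, 0) = φ p from hfp] at h4
  · rw [hsnd q hq, hξe q hq]

end FlowBox

section CircleCoordinates

attribute [local instance] finrank_real_complex_fact'

lemma contMDiff_circle_coe : ContMDiff (𝓡 1) 𝓘(ℝ, ℂ) ∞ (fun z : Circle => (z : ℂ)) :=
  contMDiff_coe_sphere

lemma contDiffAt_arg {z : ℂ} (hz : z ∈ Complex.slitPlane) : ContDiffAt ℝ ∞ Complex.arg z := by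
  have h : Complex.arg = fun z => Complex.imCLM (Complex.log z) :=
    funext fun z => (Complex.log_im z).symm
  rw [h]
  exact Complex.imCLM.contDiff.contDiffAt.comp z ((Complex.contDiffAt_log hz).restrict_scalars ℝ)

end CircleCoordinates

section AngularForm

variable {E : Type*} [NormedAddCommGroup E] [NormedSpace ℝ E] [FiniteDimensional ℝ E]
  {H : Type*} [TopologicalSpace H] {I : ModelWithCorners ℝ E H} [I.Boundaryless]
  {N : Type*} [TopologicalSpace N] [ChartedSpace H N] [IsManifold I ∞ N]
  {E' : Type*} [NormedAddCommGroup E'] [NormedSpace ℝ E'] [FiniteDimensional ℝ E']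
  {H' : Type*} [TopologicalSpace H'] {I' : ModelWithCorners ℝ E' H'} [I'.Boundaryless]
  {M : Type*} [TopologicalSpace M] [ChartedSpace H' M] [IsManifold I' ∞ M]

/-- `⟨i f, df⟩`, the differential of the argument of a unimodular function `f`. -/
def angular (I : ModelWithCorners ℝ E H) (f : N → ℂ) (p : N) : TangentSpace I p →L[ℝ] ℝ :=
  (innerSL ℝ (Complex.I * f p)).comp (mvfderiv I f p)

lemma angular_apply (f : N → ℂ) (p : N) (v : TangentSpace I p) :
    angular I f p v = inner ℝ (Complex.I * f p) (mvfderiv I f p v) := rfl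

lemma contMDiffAt_angular {f : N → ℂ} {p : N} (hf : ContMDiffAt I 𝓘(ℝ, ℂ) ∞ f p)
    {X : (q : N) → TangentSpace I q} (hX : SmoothFieldAt I X p) :
    ContMDiffAt I 𝓘(ℝ, ℝ) ∞ (fun q => angular I f q (X q)) p := by
  have h1 := SmoothFieldAt.mvfderiv hf hX
  have h2 : ContDiff ℝ ∞ (fun x : ℂ × ℂ => inner ℝ (Complex.I * x.1) x.2) :=
    (contDiff_const.mul contDiff_fst).inner ℝ contDiff_snd
  exact h2.contMDiff.contMDiffAt.comp p (hf.prodMk_space h1)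

lemma angular_eq_mvfderiv {f : N → ℂ} {u : N → ℝ} {c : Circle} {p : N}
    (hu : MDifferentiableAt I 𝓘(ℝ, ℝ) u p)
    (h : f =ᶠ[𝓝 p] fun q => c * Complex.exp (u q * Complex.I)) (v : TangentSpace I p) :
    angular I f p v = mvfderiv I u p v := by
  have hg : HasDerivAt (fun t : ℝ => (c : ℂ) * Complex.exp (t * Complex.I))
      (c * (Complex.exp (u p * Complex.I) * Complex.I)) (u p) := by
    have h1 : HasDerivAt (fun t : ℝ => (t : ℂ) * Complex.I) Complex.I (u p) := by
      simpa using (Complex.ofRealCLM.hasDerivAt (x := u p)).mul_const Complex.I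
    exact h1.cexp.const_mul _
  have h1 := mvfderiv_comp_mfderiv (I' := 𝓘(ℝ, ℝ)) (u := fun t : ℝ => (c : ℂ) * Complex.exp (t * Complex.I))
    (hg.differentiableAt.mdifferentiableAt) hu v
  have h2 : mvfderiv 𝓘(ℝ, ℝ) (fun t : ℝ => (c : ℂ) * Complex.exp (t * Complex.I)) (u p) =
      ContinuousLinearMap.toSpanSingleton ℝ (c * (Complex.exp (u p * Complex.I) * Complex.I)) :=
    (mfderiv_eq_fderiv ..).trans hg.hasFDerivAt.fderiv
  rw [h2] at h1
  have h3 : mvfderiv I f p v = mvfderiv I u p v • (c * (Complex.exp (u p * Complex.I) * Complex.I)) := by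
    rw [mvfderiv_congr h]
    exact h1
  rw [angular_apply, h3, real_inner_smul_right, h.self_of_nhds,
    show (c : ℂ) * (Complex.exp (u p * Complex.I) * Complex.I) =
      Complex.I * (c * Complex.exp (u p * Complex.I)) by ring, real_inner_self_eq_norm_sq]
  simp [Complex.norm_exp_ofReal_mul_I, Circle.norm_coe]

/-- The exterior derivative of the sum of a pulled back form and an exact form. -/
lemma IsAdapted.dForm_of_pullback_add {pr : N → M} {ξ : (q : N) → TangentSpace I q}
    {η β : OneForm I N} {O : Set N} {p : N} (h : IsAdapted (I' := I') pr ξ η O) (hp : p ∈ O)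
    {α : OneForm I' M} {u : N → ℝ} {c : ℝ} (hu : ContMDiffAt I 𝓘(ℝ, ℝ) ∞ u p)
    (hβ : ∀ᶠ q in 𝓝 p, ∀ v : TangentSpace I q,
      β.toFun q v = c * α.toFun (pr q) (mfderiv I I' pr q v) + mvfderiv I u q v)
    (v w : TangentSpace I p) :
    β.dForm.toFun p v w =
      c * α.dForm.toFun (pr p) (mfderiv I I' pr p v) (mfderiv I I' pr p w) := by
  obtain ⟨X, hX, ⟨⟨X', hX', hXX'⟩, -⟩, rfl⟩ := h.exists_isBasic hp v
  obtain ⟨Y, hY, ⟨⟨Y', hY', hYY'⟩, -⟩, rfl⟩ := h.exists_isBasic hp w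
  have hpr := h.smooth p hp
  have hprd := hpr.mdifferentiableAt (by simp)
  have key {X Y : (q : N) → TangentSpace I q} {X' Y' : (x : M) → TangentSpace I' x}
      (hY : SmoothFieldAt I Y p) (hY' : SmoothFieldAt I' Y' (pr p))
      (hXX' : IsRelatedNear pr X X' p) (hYY' : IsRelatedNear pr Y Y' p) :
      mvfderiv I (fun q => β.toFun q (Y q)) p (X p) =
        c * mvfderiv I' (fun x => α.toFun x (Y' x)) (pr p) (X' (pr p)) +
          mvfderiv I (fun q => mvfderiv I u q (Y q)) p (X p) := by
    have h1 : (fun q => β.toFun q (Y q)) =ᶠ[𝓝 p]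
        (fun q => c * α.toFun (pr q) (Y' (pr q))) + fun q => mvfderiv I u q (Y q) := by
      filter_upwards [hβ, hYY'] with q h1 h2
      rw [h1, h2]
      rfl
    have hd := (α.contMDiffAt_apply hY').mdifferentiableAt (n := ∞) (by simp)
    have hd' : MDifferentiableAt I' 𝓘(ℝ, ℝ) (fun x => c * α.toFun x (Y' x)) (pr p) :=
      hd.const_smul c
    have h2 := mvfderiv_comp_mfderiv (u := fun x => c * α.toFun x (Y' x)) hd' hprd (X p)
    have h3 : mvfderiv I' (fun x => c * α.toFun x (Y' x)) (pr p) =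
      c • mvfderiv I' (fun x => α.toFun x (Y' x)) (pr p) :=
      const_smul_mfderiv hd c
    have h4 : MDifferentiableAt I 𝓘(ℝ, ℝ) (fun q => c * α.toFun (pr q) (Y' (pr q))) p :=
      MDifferentiableAt.comp p (g := fun x => c * α.toFun x (Y' x)) hd' hprd
    have h5 := (SmoothFieldAt.mvfderiv hu hY).mdifferentiableAt (by simp)
    rw [mvfderiv_congr h1, mvfderiv_add h4 h5, _root_.add_apply, h2, hXX'.self_of_nhds, h3]
    rfl
  rw [OneForm.dForm_apply _ hX.mdiff hY.mdiff, hXX'.self_of_nhds, hYY'.self_of_nhds,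
    OneForm.dForm_apply _ hX'.mdiff hY'.mdiff, OneForm.d, OneForm.d, key hY hY' hXX' hYY',
    key hX hX' hYY' hXX', hβ.self_of_nhds, mfderiv_mlieBracket_of_related hpr hX hY hX' hY' hXX' hYY',
    mvfderiv_mlieBracket (hu.of_le (by exact WithTop.coe_le_coe.2 le_top)) (hX.of_le 1) (hY.of_le 1)]
  ring

end AngularForm

section Primitive

variable {E : Type*} [NormedAddCommGroup E] [NormedSpace ℝ E] [FiniteDimensional ℝ E]
  {H : Type*} [TopologicalSpace H] {I : ModelWithCorners ℝ E H} [I.Boundaryless]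
  {N : Type*} [TopologicalSpace N] [ChartedSpace H N] [IsManifold I ∞ N]
  {E' : Type*} [NormedAddCommGroup E'] [NormedSpace ℝ E'] [FiniteDimensional ℝ E']
  {H' : Type*} [TopologicalSpace H'] {I' : ModelWithCorners ℝ E' H'} [I'.Boundaryless]
  {M : Type*} [TopologicalSpace M] [ChartedSpace H' M] [IsManifold I' ∞ M]
  {S : STStructure I N} {pr : N → M} {O : Set N} {p : N}

lemma STStructure.bracket_ξ_hlift (h : IsAdapted (I' := I') pr S.ξ S.η O) (hp : p ∈ O)
    {Y : (x : M) → TangentSpace I' x} (hY : SmoothFieldAt I' Y (pr p)) :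
    mlieBracket I S.ξ (fun q => hlift pr S.η q (Y (pr q))) p = 0 := by
  have hL := h.smoothFieldAt_hlift hp hY
  rw [h.bracket_ξ_eq_smul hp hL hY (h.isRelatedNear_hlift hp Y)]
  have h1 := S.d_ξ hL
  have h2 : (fun q => S.η.toFun q (hlift pr S.η q (Y (pr q)))) =ᶠ[𝓝 p] fun _ => (0 : ℝ) := by
    filter_upwards [h.isOpen.mem_nhds hp] with q hq
    exact h.form_hlift hq _
  have h3 : (fun q => S.η.toFun q (S.ξ q)) = fun _ => 1 := funext fun q => S.η_ξ
  simp only [OneForm.d, h3, mvfderiv_congr h2, mvfderiv_const, _root_.zero_apply, sub_zero,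
    zero_sub, neg_eq_zero] at h1
  rw [h1, zero_smul]

/-- Where there is a function `u` with `ξ u = 1`, the form `η - du` descends. -/
theorem IsLeafProj.exists_primitive (h : IsLeafProj (I' := I') pr S.ξ S.η O) {u : N → ℝ}
    (hu : ∀ p ∈ O, ContMDiffAt I 𝓘(ℝ, ℝ) ∞ u p) (hu1 : ∀ p ∈ O, mvfderiv I u p (S.ξ p) = 1) :
    ∃ α : OneForm I' M, ∀ p ∈ O, ∀ v : TangentSpace I p,
      S.η.toFun p v = 2 * Real.pi * α.toFun (pr p) (mfderiv I I' pr p v) + mvfderiv I u p v := by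
  have ha := h.toIsAdapted
  let T : (q : N) → TangentSpace I q →L[ℝ] ℝ := fun q =>
    (1 / (2 * Real.pi)) • (S.η.toFun q - mvfderiv I u q)
  have hTv (q : N) (v : TangentSpace I q) :
      T q v = 1 / (2 * Real.pi) * (S.η.toFun q v - mvfderiv I u q v) := rfl
  suffices h0 : ∃ α : OneForm I' M, ∀ p ∈ O, ∀ w : TangentSpace I' (pr p),
      α.toFun (pr p) w = T p (hlift pr S.η p w) by
    obtain ⟨α, hα⟩ := h0
    refine ⟨α, fun p hp v => ?_⟩
    rw [hα p hp, ha.hlift_mfderiv hp, map_sub, map_smul, hTv, hTv, S.η_ξ, hu1 p hp, sub_self, mul_zero,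
      smul_zero, sub_zero]
    field_simp
    ring
  refine h.exists_oneForm T ?_ ?_
  · intro p hp X hX
    exact contMDiffAt_const.mul ((S.η.contMDiffAt_apply hX).sub (SmoothFieldAt.mvfderiv (hu p hp) hX))
  · intro p hp Y hY
    have hL := ha.smoothFieldAt_hlift hp hY
    have h1 := mvfderiv_mlieBracket ((hu p hp).of_le two_le_infty) ((ha.smooth_ξ p hp).of_le 1)
      (hL.of_le 1)
    have h2 : (fun q => mvfderiv I u q (S.ξ q)) =ᶠ[𝓝 p] fun _ => (1 : ℝ) := by
      filter_upwards [ha.isOpen.mem_nhds hp] with q hq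
      exact hu1 q hq
    rw [S.bracket_ξ_hlift ha hp hY, map_zero, mvfderiv_congr h2, mvfderiv_const, _root_.zero_apply,
      sub_zero] at h1
    have h3 : (fun q => T q (hlift pr S.η q (Y (pr q)))) =ᶠ[𝓝 p]
        fun q => (-(1 / (2 * Real.pi))) • mvfderiv I u q (hlift pr S.η q (Y (pr q))) := by
      filter_upwards [ha.isOpen.mem_nhds hp] with q hq
      rw [hTv, ha.form_hlift hq]
      simp
    have hd := (SmoothFieldAt.mvfderiv (hu p hp) hL).mdifferentiableAt (by simp)
    have h4 : mvfderiv I (fun q => (-(1 / (2 * Real.pi))) •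
        mvfderiv I u q (hlift pr S.η q (Y (pr q)))) p = (-(1 / (2 * Real.pi))) •
        mvfderiv I (fun q => mvfderiv I u q (hlift pr S.η q (Y (pr q)))) p :=
      const_smul_mfderiv hd _
    rw [mvfderiv_congr h3, h4, _root_.smul_apply, ← h1, smul_zero]

end Primitive

section TrivialBundle

variable {E : Type*} [NormedAddCommGroup E] [NormedSpace ℝ E] [FiniteDimensional ℝ E]
  {H : Type*} [TopologicalSpace H] (I : ModelWithCorners ℝ E H) [I.Boundaryless]
  (M : Type*) [TopologicalSpace M] [ChartedSpace H M] [IsManifold I ∞ M]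

/-- The trivial principal circle bundle. -/
def trivialCircleBundle : CircleBundle (I.prod (𝓡 1)) (M × Circle) I M where
  proj := Prod.fst
  act z x := (x.1, z * x.2)
  one_act p := by simp
  mul_act z w p := by simp [mul_assoc]
  smooth_act :=
    (contMDiff_fst.comp contMDiff_snd).prodMk
      (ContMDiff.mul (I := 𝓡 1) contMDiff_fst (contMDiff_snd.comp contMDiff_snd))
  proj_act z p := rfl
  locally_trivial x :=
    ⟨{ OpenPartialHomeomorph.refl (M × Circle) with
        baseSet := univ
        open_baseSet := isOpen_univ
        source_eq := rfl
        target_eq := univ_prod_univ.symm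
        proj_toFun := fun _ _ => rfl }, mem_univ x, contMDiffOn_id, contMDiffOn_id, fun _ _ _ => rfl⟩

variable {I M}

/-- The connection form `2π α + dθ` on the trivial circle bundle. -/
def trivialConnection (α : OneForm I M) : OneForm (I.prod (𝓡 1)) (M × Circle) where
  toFun x := (2 * Real.pi) • (α.toFun x.1).comp (mfderiv (I.prod (𝓡 1)) I Prod.fst x) +
    angular (I.prod (𝓡 1)) (fun x : M × Circle => (x.2 : ℂ)) x
  smooth x := by
    refine contMDiffAt_oneForm fun X hX => ?_
    have h1 : ContMDiffAt (I.prod (𝓡 1)) I.tangent ∞ (fun x : M × Circle =>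
        (⟨x.1, mfderiv (I.prod (𝓡 1)) I Prod.fst x (X x)⟩ : TangentBundle I M)) x :=
      ((contMDiff_fst (I := I) (J := 𝓡 1) (M := M) (N := Circle)
        (n := ∞)).contMDiff_tangentMap (m := ∞) (by simp)).contMDiffAt.comp x hX
    have h2 : ContMDiffAt (I.prod (𝓡 1)) 𝓘(ℝ, ℝ) ∞ (fun x : M × Circle =>
        α.toFun x.1 (mfderiv (I.prod (𝓡 1)) I Prod.fst x (X x))) x := by
      have h3 := ContMDiffAt.clm_bundle_apply (E₂ := Bundle.Trivial M ℝ) (F₂ := ℝ)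
        ((α.smooth x.1).comp x contMDiffAt_fst) h1
      exact (contMDiffAt_totalSpace.1 h3).2
    exact (contMDiffAt_const.mul h2).add (contMDiffAt_angular
      (contMDiff_circle_coe.comp contMDiff_snd).contMDiffAt hX)

lemma trivialConnection_apply (α : OneForm I M) (x : M × Circle)
    (v : TangentSpace (I.prod (𝓡 1)) x) : (trivialConnection α).toFun x v =
      2 * Real.pi * α.toFun x.1 (mfderiv (I.prod (𝓡 1)) I Prod.fst x v) +
        angular (I.prod (𝓡 1)) (fun x : M × Circle => (x.2 : ℂ)) x v := rfl

lemma contMDiff_snd_circle_coe :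
    ContMDiff (I.prod (𝓡 1)) 𝓘(ℝ, ℂ) ∞ (fun x : M × Circle => (x.2 : ℂ)) :=
  contMDiff_circle_coe.comp contMDiff_snd

lemma isConnection_trivialConnection (α : OneForm I M) :
    (trivialCircleBundle I M).IsConnection (trivialConnection α) := by
  set B := trivialCircleBundle I M
  refine ⟨fun x => ?_, fun z x v => ?_⟩
  · have h1 : mfderiv (I.prod (𝓡 1)) I Prod.fst x (B.fundamental x) = 0 :=
      B.mfderiv_proj_fundamental x
    have h2 := B.mvfderiv_fundamental ((contMDiff_snd_circle_coe (I := I) (M := M) x).mdifferentiableAt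
      (by simp))
    have h3 : HasDerivAt (fun t : ℝ => ((Circle.exp t * x.2 : Circle) : ℂ)) (Complex.I * x.2) 0 := by
      have h4 : HasDerivAt (fun t : ℝ => (t : ℂ) * Complex.I) Complex.I 0 := by
        simpa using (Complex.ofRealCLM.hasDerivAt (x := 0)).mul_const Complex.I
      simpa using h4.cexp.mul_const (x.2 : ℂ)
    rw [trivialConnection_apply, h1, map_zero, mul_zero, zero_add, angular_apply, h2]
    have h5 : deriv (fun t : ℝ => ((B.act (Circle.exp t) x).2 : ℂ)) 0 = Complex.I * x.2 := h3.deriv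
    rw [h5, real_inner_self_eq_norm_sq]
    simp [Circle.norm_coe]
  · have hz : ContMDiff (I.prod (𝓡 1)) (I.prod (𝓡 1)) ∞ (B.act z) :=
      B.smooth_act.comp (contMDiff_const.prodMk contMDiff_id)
    have hzd := (hz x).mdifferentiableAt (by simp)
    have h1 : mfderiv (I.prod (𝓡 1)) I Prod.fst (B.act z x)
        (mfderiv (I.prod (𝓡 1)) (I.prod (𝓡 1)) (B.act z) x v) =
        mfderiv (I.prod (𝓡 1)) I Prod.fst x v :=
      (congrArg (fun A : E × EuclideanSpace ℝ (Fin 1) →L[ℝ] E => A v)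
        (mfderiv_comp x (mdifferentiableAt_fst (x := B.act z x)) hzd)).symm
    have hs := contMDiff_snd_circle_coe (I := I) (M := M)
    have h2 := mvfderiv_comp_mfderiv ((hs (B.act z x)).mdifferentiableAt (by simp)) hzd v
    have h3 : mvfderiv (I.prod (𝓡 1)) (fun y : M × Circle => ((B.act z y).2 : ℂ)) x v =
        z * mvfderiv (I.prod (𝓡 1)) (fun y : M × Circle => (y.2 : ℂ)) x v := by
      have h4 := mvfderiv_comp_mfderiv (pr := fun y : M × Circle => (y.2 : ℂ)) (I' := 𝓘(ℝ, ℂ))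
        (u := fun w : ℂ => z * w) (differentiable_id.const_mul (z : ℂ) _).mdifferentiableAt
        ((hs x).mdifferentiableAt (by simp)) v
      have h5 : mvfderiv 𝓘(ℝ, ℂ) (fun w : ℂ => z * w) (x.2 : ℂ) =
          (z : ℂ) • ContinuousLinearMap.id ℝ ℂ :=
        (mfderiv_eq_fderiv ..).trans ((hasFDerivAt_id (𝕜 := ℝ) (x.2 : ℂ)).const_mul (z : ℂ)).fderiv
      rw [h5] at h4
      exact h4
    rw [trivialConnection_apply, trivialConnection_apply, h1, angular_apply, angular_apply, ← h2, h3]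
    have h6 : Complex.I * ((B.act z x).2 : ℂ) = z * (Complex.I * x.2) := by
      show Complex.I * ((z * x.2 : Circle) : ℂ) = _
      push_cast
      ring
    rw [h6]
    exact congrArg _ ((rotation z).inner_map_map _ _)

end TrivialBundle

section OpenSubsets

variable {E : Type*} [NormedAddCommGroup E] [NormedSpace ℝ E]
  {H : Type*} [TopologicalSpace H] {I : ModelWithCorners ℝ E H}
  {N : Type*} [TopologicalSpace N] [ChartedSpace H N]
  {E₀ : Type*} [NormedAddCommGroup E₀] [NormedSpace ℝ E₀] {U : TopologicalSpace.Opens E₀}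

lemma contMDiffAt_opens_of_val {f : N → U} {p : N} {n : WithTop ℕ∞}
    (h : ContMDiffAt I 𝓘(ℝ, E₀) n (fun q => (f q : E₀)) p) : ContMDiffAt I 𝓘(ℝ, E₀) n f p := by
  rw [contMDiffAt_iff_target]
  exact ⟨Topology.IsInducing.subtypeVal.continuousAt_iff.2 h.continuousAt, h⟩

lemma contMDiffAt_opens_val (x : U) {n : WithTop ℕ∞} :
    ContMDiffAt 𝓘(ℝ, E₀) 𝓘(ℝ, E₀) n (fun x : U => (x : E₀)) x :=
  contMDiff_subtype_val x

lemma mvfderiv_opens_val_injective [FiniteDimensional ℝ E₀] (x : U) :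
    Function.Injective (mvfderiv 𝓘(ℝ, E₀) (fun x : U => (x : E₀)) x) :=
  mvfderiv_extChartAt_injective (I' := 𝓘(ℝ, E₀)) (mem_extChartAt_source (I := 𝓘(ℝ, E₀)) x)

end OpenSubsets

section LocalModel

variable {E : Type*} [NormedAddCommGroup E] [NormedSpace ℝ E] [FiniteDimensional ℝ E]
  {H : Type*} [TopologicalSpace H] {I : ModelWithCorners ℝ E H} [I.Boundaryless]
  {N : Type*} [TopologicalSpace N] [ChartedSpace H N] [IsManifold I ∞ N]
  {E₀ : Type*} [NormedAddCommGroup E₀] [NormedSpace ℝ E₀] [FiniteDimensional ℝ E₀]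

namespace IsFoliatedChart

variable {S : STStructure I N} {e : OpenPartialHomeomorph N (E₀ × ℝ)}
    {U : TopologicalSpace.Opens E₀} {a b : ℝ} {pr : N → U}

lemma contMDiffAt_proj (he : IsFoliatedChart S.ξ e (U : Set E₀) a b)
    (hpr : ∀ q ∈ e.source, (pr q : E₀) = (e q).1) {q : N} (hq : q ∈ e.source) :
    ContMDiffAt I 𝓘(ℝ, E₀) ∞ pr q :=
  contMDiffAt_opens_of_val ((he.contMDiffAt_fst hq).congr_of_eventuallyEq
    (Filter.eventually_of_mem (e.open_source.mem_nhds hq) hpr))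

lemma contMDiffAt_symm_opens (he : IsFoliatedChart S.ξ e (U : Set E₀) a b) {t : ℝ}
    (ht : t ∈ Ioo a b) (x : U) :
    ContMDiffAt 𝓘(ℝ, E₀) I ∞ (fun x : U => e.symm ((x : E₀), t)) x :=
  ContMDiffAt.comp x (g := e.symm) (he.contMDiffAt_symm (he.mem_target.2 ⟨x.2, ht⟩))
    ((contMDiffAt_opens_val x).prodMk_space contMDiffAt_const)

/-- The first coordinate of a foliated chart is a projection onto the space of plaques. -/
theorem isLeafProj (he : IsFoliatedChart S.ξ e (U : Set E₀) a b) (hab : a < b)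
    (hpr : ∀ q ∈ e.source, (pr q : E₀) = (e q).1)
    (hd : Module.finrank ℝ E = Module.finrank ℝ E₀ + 1) :
    IsLeafProj (I' := 𝓘(ℝ, E₀)) pr S.ξ S.η e.source where
  isOpen := e.open_source
  smooth q hq := he.contMDiffAt_proj hpr hq
  surj q hq := by
    have ht := he.snd_mem hq
    have hs := (he.contMDiffAt_symm_opens ht (pr q)).mdifferentiableAt (by simp)
    have hq' : e.symm ((pr q : E₀), (e q).2) = q := by rw [hpr q hq]; exact e.left_inv hq
    have hpd : MDifferentiableAt I 𝓘(ℝ, E₀) pr (e.symm ((pr q : E₀), (e q).2)) := by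
      rw [hq']; exact (he.contMDiffAt_proj hpr hq).mdifferentiableAt (by simp)
    have h1 := mfderiv_comp (pr q) (f := fun x : U => e.symm ((x : E₀), (e q).2)) hpd hs
    have h2 : pr ∘ (fun x : U => e.symm ((x : E₀), (e q).2)) = id := funext fun x => by
      have hx : ((x : E₀), (e q).2) ∈ e.target := he.mem_target.2 ⟨x.2, ht⟩
      refine Subtype.ext ?_
      show (pr (e.symm ((x : E₀), (e q).2)) : E₀) = x
      rw [hpr _ (e.map_target hx), e.right_inv hx]
    rw [h2, mfderiv_id] at h1
    have h3 : (mfderiv I 𝓘(ℝ, E₀) pr (e.symm ((pr q : E₀), (e q).2)) : E →L[ℝ] E₀) =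
        mfderiv I 𝓘(ℝ, E₀) pr q := by rw [hq']
    intro w
    refine ⟨mfderiv 𝓘(ℝ, E₀) I (fun x : U => e.symm ((x : E₀), (e q).2)) (pr q) w, ?_⟩
    exact (congrArg (fun A : E →L[ℝ] E₀ => A (mfderiv 𝓘(ℝ, E₀) I
      (fun x : U => e.symm ((x : E₀), (e q).2)) (pr q) w)) h3).symm.trans
      (congrArg (fun A : E₀ →L[ℝ] E₀ => A w) h1).symm
  smooth_ξ q _ := S.smoothFieldAt_ξ
  ker q hq := by
    apply mvfderiv_opens_val_injective (pr q)
    rw [map_zero, ← mvfderiv_comp_mfderiv ((contMDiffAt_opens_val (pr q)).mdifferentiableAt (n := ∞) (by simp))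
      ((he.contMDiffAt_proj hpr hq).mdifferentiableAt (by simp)),
      mvfderiv_congr (Filter.eventually_of_mem (e.open_source.mem_nhds hq) hpr)]
    exact he.tangent q hq
  unit q _ := S.η_ξ
  finrank _ _ := hd
  cover x := by
    obtain ⟨t, ht⟩ := exists_between hab
    have hx : ((x : E₀), t) ∈ e.target := he.mem_target.2 ⟨x.2, ht⟩
    refine ⟨e.symm ((x : E₀), t), e.map_target hx, Subtype.ext ?_⟩
    rw [hpr _ (e.map_target hx), e.right_inv hx]
  const := by
    rintro _ _ ⟨γ, c, d, hγ, hmem, s, hs, t, ht, rfl, rfl⟩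
    refine Subtype.ext ?_
    rw [hpr _ (hmem s hs), hpr _ (hmem t ht)]
    exact he.fst_const hγ hmem hs ht
  conn q hq q' hq' h := he.eqvGen_joinedIn (fun _ _ => S.smoothFieldAt_ξ) (fun _ _ => S.ξ_ne_zero)
    hq hq' (by rw [← hpr q hq, ← hpr q' hq', h])

/-- The chart `q ↦ (pr q, exp (i t))` with values in the trivial circle bundle. -/
theorem exists_circleChart {ε : ℝ} (he : IsFoliatedChart S.ξ e (U : Set E₀) (-ε) ε) (hε : ε ≤ 1)
    (hpr : ∀ q ∈ e.source, (pr q : E₀) = (e q).1) :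
    ∃ f : OpenPartialHomeomorph N (U × Circle), f.source = e.source ∧
      (∀ q, f q = (pr q, Circle.exp (e q).2)) ∧
      ContMDiffOn I (𝓘(ℝ, E₀).prod (𝓡 1)) ∞ f f.source ∧
      ContMDiffOn (𝓘(ℝ, E₀).prod (𝓡 1)) I ∞ f.symm f.target := by
  let T : Set (U × Circle) := {x | (x.2 : ℂ) ∈ Complex.slitPlane ∧ Complex.arg x.2 ∈ Ioo (-ε) ε}
  have hpi : ε < Real.pi := by linarith [Real.pi_gt_three]
  have hT : IsOpen T := by
    have h1 : ContinuousOn (fun x : U × Circle => Complex.arg x.2)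
        {x | (x.2 : ℂ) ∈ Complex.slitPlane} := fun x hx =>
      ((contDiffAt_arg hx).continuousAt.comp
        (f := fun x : U × Circle => (x.2 : ℂ)) (by fun_prop)).continuousWithinAt
    exact h1.isOpen_inter_preimage (Complex.isOpen_slitPlane.preimage (by fun_prop)) isOpen_Ioo
  have harg : ∀ t ∈ Ioo (-ε) ε, Complex.arg (Circle.exp t) = t := fun t ht =>
    Circle.arg_exp (by linarith [ht.1]) (by linarith [ht.2])
  have hmaps : ∀ x ∈ T, ((x.1 : E₀), Complex.arg x.2) ∈ e.target := fun x hx =>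
    he.mem_target.2 ⟨x.1.2, hx.2⟩
  have hf : ContMDiffOn I (𝓘(ℝ, E₀).prod (𝓡 1)) ∞ (fun q => (pr q, Circle.exp (e q).2)) e.source :=
    fun q hq => ((he.contMDiffAt_proj hpr hq).prodMk
      (contMDiff_circleExp.contMDiffAt.comp q (he.contMDiffAt_snd hq))).contMDiffWithinAt
  have hg : ContMDiffOn (𝓘(ℝ, E₀).prod (𝓡 1)) I ∞
      (fun x : U × Circle => e.symm ((x.1 : E₀), Complex.arg x.2)) T := by
    intro x hx
    have h1 : ContMDiffAt (𝓘(ℝ, E₀).prod (𝓡 1)) 𝓘(ℝ, E₀ × ℝ) ∞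
        (fun x : U × Circle => ((x.1 : E₀), Complex.arg x.2)) x :=
      ((contMDiffAt_opens_val x.1).comp x _root_.contMDiffAt_fst).prodMk_space
        ((contDiffAt_arg hx.1).contMDiffAt.comp x
          (f := fun x : U × Circle => (x.2 : ℂ)) (contMDiff_snd_circle_coe x))
    exact (ContMDiffAt.comp x (g := e.symm) (he.contMDiffAt_symm (hmaps x hx)) h1).contMDiffWithinAt
  refine ⟨
    { toFun := fun q => (pr q, Circle.exp (e q).2)
      invFun := fun x => e.symm ((x.1 : E₀), Complex.arg x.2)
      source := e.source
      target := T
      map_source' := fun q hq => ?_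
      map_target' := fun x hx => e.map_target (hmaps x hx)
      left_inv' := fun q hq => ?_
      right_inv' := fun x hx => ?_
      open_source := e.open_source
      open_target := hT
      continuousOn_toFun := hf.continuousOn
      continuousOn_invFun := hg.continuousOn }, rfl, fun _ => rfl, hf, hg⟩
  · have ht := he.snd_mem hq
    refine ⟨Complex.mem_slitPlane_iff_arg.2 ⟨?_, (Circle.exp (e q).2).coe_ne_zero⟩, ?_⟩
    · rw [harg _ ht]; linarith [ht.2]
    · rw [harg _ ht]; exact ht
  · show e.symm ((pr q : E₀), Complex.arg (Circle.exp (e q).2)) = q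
    rw [harg _ (he.snd_mem hq), hpr q hq]
    exact e.left_inv hq
  · have h1 := hmaps x hx
    refine Prod.ext (Subtype.ext ?_) ?_
    · show (pr (e.symm ((x.1 : E₀), Complex.arg x.2)) : E₀) = x.1
      rw [hpr _ (e.map_target h1), e.right_inv h1]
    · show Circle.exp (e (e.symm ((x.1 : E₀), Complex.arg x.2))).2 = x.2
      rw [e.right_inv h1]
      exact Circle.exp_arg x.2

end IsFoliatedChart

end LocalModel

section LocalStructure

variable {E : Type*} [NormedAddCommGroup E] [NormedSpace ℝ E] [FiniteDimensional ℝ E]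
  {H : Type*} [TopologicalSpace H] {I : ModelWithCorners ℝ E H} [I.Boundaryless]
  {N : Type*} [TopologicalSpace N] [ChartedSpace H N] [IsManifold I ∞ N]
  {E' : Type*} [NormedAddCommGroup E'] [NormedSpace ℝ E'] [FiniteDimensional ℝ E']
  {H' : Type*} [TopologicalSpace H'] {I' : ModelWithCorners ℝ E' H'} [I'.Boundaryless]
  {M : Type*} [TopologicalSpace M] [ChartedSpace H' M] [IsManifold I' ∞ M]

/-- The exterior derivative of `2π α + dθ` is the pull back of `2π dα`. -/
lemma dForm_trivialConnection (α : OneForm I' M) (x : M × Circle)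
    (v w : TangentSpace (I'.prod (𝓡 1)) x) :
    (trivialConnection α).dForm.toFun x v w = 2 * Real.pi * α.dForm.toFun x.1
      (mfderiv (I'.prod (𝓡 1)) I' Prod.fst x v) (mfderiv (I'.prod (𝓡 1)) I' Prod.fst x w) := by
  have ha := (trivialCircleBundle I' M).isAdapted (isConnection_trivialConnection α).1
  let u : M × Circle → ℝ := fun y => Complex.arg ((x.2⁻¹ * y.2 : Circle) : ℂ)
  have hc : ContMDiff (I'.prod (𝓡 1)) 𝓘(ℝ, ℂ) ∞
      (fun y : M × Circle => ((x.2⁻¹ * y.2 : Circle) : ℂ)) :=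
    contMDiff_circle_coe.comp (ContMDiff.mul (I := 𝓡 1) contMDiff_const contMDiff_snd)
  have hx : ((x.2⁻¹ * x.2 : Circle) : ℂ) ∈ Complex.slitPlane := by simp
  have hev : ∀ᶠ y in 𝓝 x, ((x.2⁻¹ * y.2 : Circle) : ℂ) ∈ Complex.slitPlane :=
    hc.continuous.continuousAt.eventually (Complex.isOpen_slitPlane.mem_nhds hx)
  have hu : ∀ᶠ y in 𝓝 x, ContMDiffAt (I'.prod (𝓡 1)) 𝓘(ℝ, ℝ) ∞ u y :=
    hev.mono fun y hy => (contDiffAt_arg hy).contMDiffAt.comp y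
      (f := fun y : M × Circle => ((x.2⁻¹ * y.2 : Circle) : ℂ)) (hc y)
  have hexp (y : M × Circle) : (y.2 : ℂ) = x.2 * Complex.exp (u y * Complex.I) := by
    have h1 : (Circle.exp (u y) : ℂ) = ((x.2⁻¹ * y.2 : Circle) : ℂ) :=
      congrArg _ (Circle.exp_arg _)
    rw [← Circle.coe_exp, h1, ← Circle.coe_mul, mul_inv_cancel_left]
  refine ha.dForm_of_pullback_add (mem_univ x) hu.self_of_nhds ?_ v w
  filter_upwards [hu] with y hy v
  rw [trivialConnection_apply, angular_eq_mvfderiv (c := x.2) (hy.mdifferentiableAt (by simp))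
    (.of_forall hexp)]
  rfl

/-- A primitive of the curvature downstairs. -/
lemma IsLeafProj.dForm_primitive {S : STStructure I N} {pr : N → M} {O : Set N}
    (h : IsLeafProj (I' := I') pr S.ξ S.η O) {u : N → ℝ} {α : OneForm I' M} {σ : TwoForm I' M}
    (hu : ∀ p ∈ O, ContMDiffAt I 𝓘(ℝ, ℝ) ∞ u p)
    (hα : ∀ p ∈ O, ∀ v : TangentSpace I p,
      S.η.toFun p v = 2 * Real.pi * α.toFun (pr p) (mfderiv I I' pr p v) + mvfderiv I u p v)
    (hσ : ∀ p ∈ O, ∀ v w : TangentSpace I p, (1 / (2 * Real.pi)) * S.η.dForm.toFun p v w =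
      σ.toFun (pr p) (mfderiv I I' pr p v) (mfderiv I I' pr p w))
    (x : M) (v w : TangentSpace I' x) : α.dForm.toFun x v w = σ.toFun x v w := by
  obtain ⟨p, hp, rfl⟩ := h.cover x
  obtain ⟨v, rfl⟩ := h.surj p hp v
  obtain ⟨w, rfl⟩ := h.surj p hp w
  rw [← hσ p hp, h.dForm_of_pullback_add hp (hu p hp)
    (Filter.eventually_of_mem (h.isOpen.mem_nhds hp) hα)]
  field_simp

lemma TwoForm.isExact_of_dForm {α : OneForm I' M} {σ : TwoForm I' M}
    (h : ∀ (x : M) (v w : TangentSpace I' x), α.dForm.toFun x v w = σ.toFun x v w) : σ.IsExact :=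
  ⟨α, fun p X Y hX hY => by rw [← OneForm.dForm_apply _ hX.mdiff hY.mdiff, h]⟩

/-- A local diffeomorphism over the identity of the base which matches the contact forms matches the
ST structures. -/
lemma isLocalSTIso_of_map_η {E'' : Type*} [NormedAddCommGroup E''] [NormedSpace ℝ E'']
    [FiniteDimensional ℝ E''] {H'' : Type*} [TopologicalSpace H''] {I'' : ModelWithCorners ℝ E'' H''}
    [I''.Boundaryless] {P : Type*} [TopologicalSpace P] [ChartedSpace H'' P] [IsManifold I'' ∞ P]
    {S : STStructure I N} {S' : STStructure I'' P} {pr : N → M} {pr' : P → M}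
    {K : HermitianStructure I' M} {f : OpenPartialHomeomorph N P}
    (hS : IsAdapted (I' := I') pr S.ξ S.η f.source) (hS' : IsAdapted (I' := I') pr' S'.ξ S'.η univ)
    (hK : ∀ p ∈ f.source,
      (∀ v w : TangentSpace I p, K.h.inner (pr p) (mfderiv I I' pr p v) (mfderiv I I' pr p w) =
          S.g.inner p v w - S.η.toFun p v * S.η.toFun p w) ∧
      (∀ v : TangentSpace I p,
          mfderiv I I' pr p (S.φ.toFun p v) = K.J.toFun (pr p) (mfderiv I I' pr p v)))
    (hK' : ∀ p,
      (∀ v w : TangentSpace I'' p,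
          K.h.inner (pr' p) (mfderiv I'' I' pr' p v) (mfderiv I'' I' pr' p w) =
          S'.g.inner p v w - S'.η.toFun p v * S'.η.toFun p w) ∧
      (∀ v : TangentSpace I'' p,
          mfderiv I'' I' pr' p (S'.φ.toFun p v) = K.J.toFun (pr' p) (mfderiv I'' I' pr' p v)))
    (hf : ContMDiffOn I I'' ∞ f f.source) (hf' : ContMDiffOn I'' I ∞ f.symm f.target)
    (hpr : ∀ p, pr' (f p) = pr p)
    (hη : ∀ p ∈ f.source, ∀ v : TangentSpace I p,
      S'.η.toFun (f p) (mfderiv I I'' f p v) = S.η.toFun p v) : IsLocalSTIso S S' f := by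
  obtain rfl : (fun p => pr' (f p)) = pr := funext hpr
  have hd : ∀ p ∈ f.source, ∀ v : TangentSpace I p,
      mfderiv I'' I' pr' (f p) (mfderiv I I'' f p v) = mfderiv I I' (fun p => pr' (f p)) p v :=
    fun p hp v => (congrArg (fun A : E →L[ℝ] E' => A v)
      (mfderiv_comp p ((hS'.smooth (f p) (mem_univ _)).mdifferentiableAt (by simp))
        ((hf.contMDiffAt (f.open_source.mem_nhds hp)).mdifferentiableAt (by simp)))).symm
  refine ⟨hf, hf', fun p hp v w => ?_, fun p hp => ?_, hη, fun p hp v => ?_⟩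
  · have h1 := (hK p hp).1 v w
    have h2 := (hK' (f p)).1 (mfderiv I I'' f p v) (mfderiv I I'' f p w)
    rw [hη p hp, hη p hp, hd p hp, hd p hp] at h2
    linarith
  · refine hS'.ext (mem_univ _) ?_ ?_
    · rw [hd p hp, hS.ker p hp, hS'.ker _ (mem_univ _)]
    · rw [hη p hp, S.η_ξ, S'.η_ξ]
  · refine hS'.ext (mem_univ _) ?_ ?_
    · rw [hd p hp, (hK p hp).2, (hK' (f p)).2, hd p hp]
    · rw [hη p hp, S.η_φ, S'.η_φ]

end LocalStructure

section LocalForm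

universe u v w

variable {E : Type u} [NormedAddCommGroup E] [NormedSpace ℝ E] [FiniteDimensional ℝ E]
  {H : Type v} [TopologicalSpace H] {I : ModelWithCorners ℝ E H} [I.Boundaryless]
  {N : Type w} [TopologicalSpace N] [ChartedSpace H N] [IsManifold I ∞ N] [T2Space N]

/-- Every ST manifold is locally a trivial circle bundle over a Hermitian manifold. -/
theorem exists_local_circleBundle (S : STStructure I N) (k : ℕ)
    (hd : Module.finrank ℝ E = 2 * k + 1) (p : N) :
    ∃ (U : TopologicalSpace.Opens (EuclideanSpace ℝ (Fin (2 * k))))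
      (K : HermitianStructure (𝓡 (2 * k)) U) (σ : TwoForm (𝓡 (2 * k)) U)
      (S' : STStructure ((𝓡 (2 * k)).prod (𝓡 1)) (U × Circle))
      (f : OpenPartialHomeomorph N (U × Circle)),
      σ.IsClosed ∧ σ.IsExact ∧ σ.IsOneOne K.J ∧
      (trivialCircleBundle (𝓡 (2 * k)) U).IsConnection S'.η ∧
      S'.ξ = (trivialCircleBundle (𝓡 (2 * k)) U).fundamental ∧
      IsCompatible S' K σ (trivialCircleBundle (𝓡 (2 * k)) U).proj ∧
      p ∈ f.source ∧ IsLocalSTIso S S' f := by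
  classical
  have hd' : Module.finrank ℝ E = Module.finrank ℝ (EuclideanSpace ℝ (Fin (2 * k))) + 1 := by
    simp [hd]
  obtain ⟨e, W, ε, hW, hε, hε1, he, hp, het⟩ :=
    exists_flowBox (p := p) (fun q => S.smoothFieldAt_ξ) S.ξ_ne_zero hd'
  let U : TopologicalSpace.Opens (EuclideanSpace ℝ (Fin (2 * k))) := ⟨W, hW⟩
  let pr : N → U := fun q => if h : (e q).1 ∈ W then ⟨(e q).1, h⟩ else ⟨(e p).1, he.fst_mem hp⟩
  have hpr : ∀ q ∈ e.source, (pr q : EuclideanSpace ℝ (Fin (2 * k))) = (e q).1 := fun q hq => by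
    simp only [pr, dif_pos (he.fst_mem hq)]
  have heU : IsFoliatedChart S.ξ e (U : Set (EuclideanSpace ℝ (Fin (2 * k)))) (-ε) ε := he
  have hL := heU.isLeafProj (by linarith) hpr hd'
  have hu : ∀ q ∈ e.source, ContMDiffAt I 𝓘(ℝ, ℝ) ∞ (fun q => (e q).2) q :=
    fun q hq => heU.contMDiffAt_snd hq
  obtain ⟨K, σ, hσ, hσJ, hK⟩ := STStructure.exists_hermitian hL
  obtain ⟨α, hα⟩ := hL.exists_primitive hu het
  have hασ := hL.dForm_primitive hu hα fun q hq => (hK q hq).2.2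
  set B := trivialCircleBundle (𝓡 (2 * k)) U with hB
  have hconn := isConnection_trivialConnection α
  have hcurv : HasCurvature (trivialConnection α) σ B.proj := hasCurvature_iff.2 fun x v w => by
    rw [dForm_trivialConnection, hασ]
    field_simp
    rfl
  obtain ⟨S', ⟨hξ', hη', hS'⟩, -⟩ := existsUnique_STStructure (B.isAdapted hconn.1)
    B.surjective_proj K hσJ hcurv
  obtain ⟨f, hfs, hf, hfsm, hfsm'⟩ := heU.exists_circleChart hε1 hpr
  have ha' : IsAdapted (I' := 𝓡 (2 * k)) B.proj S'.ξ S'.η univ := by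
    rw [hξ', hη']
    exact B.isAdapted hconn.1
  refine ⟨U, K, σ, S', f, hσ, TwoForm.isExact_of_dForm hασ, hσJ, by rwa [hη'], hξ', hS', hfs ▸ hp, ?_⟩
  have hprf : ∀ q, B.proj (f q) = pr q := fun q => by rw [hf]; rfl
  refine isLocalSTIso_of_map_η (pr := pr) (K := K) (by rw [hfs]; exact hL.toIsAdapted) ha'
    (fun q hq => ⟨(hK q (hfs ▸ hq)).1, (hK q (hfs ▸ hq)).2.1⟩)
    (fun x => ⟨((isCompatible_iff ha' B.surjective_proj).1 hS' x).1,
      ((isCompatible_iff ha' B.surjective_proj).1 hS' x).2.1⟩) hfsm hfsm' hprf ?_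
  intro q hq v
  have hq' : q ∈ e.source := hfs ▸ hq
  have hfd := (hfsm.contMDiffAt (f.open_source.mem_nhds hq)).mdifferentiableAt (by simp)
  have h1 : mfderiv ((𝓡 (2 * k)).prod (𝓡 1)) (𝓡 (2 * k)) Prod.fst (f q)
      (mfderiv I ((𝓡 (2 * k)).prod (𝓡 1)) f q v) = mfderiv I (𝓡 (2 * k)) pr q v := by
    have h2 := mfderiv_comp q (mdifferentiableAt_fst (x := f q) (I := 𝓡 (2 * k)) (I' := 𝓡 1)) hfd
    have h3 : (Prod.fst ∘ f : N → U) = pr := funext hprf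
    rw [h3] at h2
    exact (congrArg (fun A : E →L[ℝ] EuclideanSpace ℝ (Fin (2 * k)) => A v) h2).symm
  have h2 : angular ((𝓡 (2 * k)).prod (𝓡 1)) (fun x : U × Circle => (x.2 : ℂ)) (f q)
      (mfderiv I ((𝓡 (2 * k)).prod (𝓡 1)) f q v) = mvfderiv I (fun q => (e q).2) q v := by
    have h3 := mvfderiv_comp_mfderiv ((contMDiff_snd_circle_coe (I := 𝓡 (2 * k)) (f q)).mdifferentiableAt
      (by simp)) hfd v
    have hfe (q : N) : (((f q).2 : Circle) : ℂ) =
        ((1 : Circle) : ℂ) * Complex.exp ((e q).2 * Complex.I) := by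
      rw [hf, Circle.coe_exp, Circle.coe_one, one_mul]
    rw [angular_apply, ← h3, ← angular_eq_mvfderiv (c := 1) (f := fun q => ((f q).2 : ℂ))
      ((hu q hq').mdifferentiableAt (by simp)) (.of_forall hfe), angular_apply]
  have h4 : (pr q : U) = (f q).1 := (hprf q).symm
  have h5 (w : EuclideanSpace ℝ (Fin (2 * k))) : α.toFun (f q).1 w = α.toFun (pr q) w := by rw [h4]
  rw [hη', trivialConnection_apply, hα q hq', h2, h1]
  exact congrArg (fun t => 2 * Real.pi * t + _) (h5 _)

end LocalForm

end SasakiTorsion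

end

theorem mainTheorem4 :
    -- A regular ST manifold and its leaf space
    (∀ (k : ℕ) (E : Type*) [NormedAddCommGroup E] [NormedSpace ℝ E] [FiniteDimensional ℝ E]
      (H : Type*) [TopologicalSpace H] (I : ModelWithCorners ℝ E H) [I.Boundaryless]
      (N : Type*) [TopologicalSpace N] [ChartedSpace H N] [IsManifold I ∞ N]
      [T2Space N] [SecondCountableTopology N]
      (S : SasakiTorsion.STStructure I N),
      Module.finrank ℝ E = 2 * k + 1 →
      SasakiTorsion.IsRegularFoliation I (2 * k) S.ξ →
      SecondCountableTopology (SasakiTorsion.LeafSpace I S.ξ) ∧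
      (∃ (_ : ChartedSpace (EuclideanSpace ℝ (Fin (2 * k))) (SasakiTorsion.LeafSpace I S.ξ))
        (_ : IsManifold (𝓡 (2 * k)) ∞ (SasakiTorsion.LeafSpace I S.ξ)),
        SasakiTorsion.IsSurjSubmersion I (𝓡 (2 * k)) (SasakiTorsion.leafProj I S.ξ)) ∧
      (∀ (_ : ChartedSpace (EuclideanSpace ℝ (Fin (2 * k))) (SasakiTorsion.LeafSpace I S.ξ))
        (_ : IsManifold (𝓡 (2 * k)) ∞ (SasakiTorsion.LeafSpace I S.ξ)),
        SasakiTorsion.IsSurjSubmersion I (𝓡 (2 * k)) (SasakiTorsion.leafProj I S.ξ) →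
        ∃! t : SasakiTorsion.HermitianStructure (𝓡 (2 * k)) (SasakiTorsion.LeafSpace I S.ξ) ×
            SasakiTorsion.TwoForm (𝓡 (2 * k)) (SasakiTorsion.LeafSpace I S.ξ),
          t.2.IsClosed ∧ t.2.IsOneOne t.1.J ∧
            SasakiTorsion.IsCompatible S t.1 t.2 (SasakiTorsion.leafProj I S.ξ))) ∧
    -- The converse: circle bundles over Hermitian manifolds
    (∀ (E : Type*) [NormedAddCommGroup E] [NormedSpace ℝ E] [FiniteDimensional ℝ E]
      (H : Type*) [TopologicalSpace H] (I : ModelWithCorners ℝ E H) [I.Boundaryless]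
      (M : Type*) [TopologicalSpace M] [ChartedSpace H M] [IsManifold I ∞ M]
      [T2Space M] [SecondCountableTopology M]
      (E' : Type*) [NormedAddCommGroup E'] [NormedSpace ℝ E'] [FiniteDimensional ℝ E']
      (H' : Type*) [TopologicalSpace H'] (I' : ModelWithCorners ℝ E' H') [I'.Boundaryless]
      (N : Type*) [TopologicalSpace N] [ChartedSpace H' N] [IsManifold I' ∞ N]
      [T2Space N] [SecondCountableTopology N]
      (K : SasakiTorsion.HermitianStructure I M) (σ : SasakiTorsion.TwoForm I M)
      (B : SasakiTorsion.CircleBundle I' N I M) (η : SasakiTorsion.OneForm I' N),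
      σ.IsClosed → σ.IsOneOne K.J →
      B.IsConnection η → SasakiTorsion.HasCurvature η σ B.proj →
      ∃! S : SasakiTorsion.STStructure I' N,
        S.ξ = B.fundamental ∧ S.η = η ∧ SasakiTorsion.IsCompatible S K σ B.proj) ∧
    -- Every ST manifold is locally of this form
    (∀ (k : ℕ) (E : Type*) [NormedAddCommGroup E] [NormedSpace ℝ E] [FiniteDimensional ℝ E]
      (H : Type*) [TopologicalSpace H] (I : ModelWithCorners ℝ E H) [I.Boundaryless]
      (N : Type*) [TopologicalSpace N] [ChartedSpace H N] [IsManifold I ∞ N]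
      [T2Space N] [SecondCountableTopology N]
      (S : SasakiTorsion.STStructure I N),
      Module.finrank ℝ E = 2 * k + 1 →
      ∀ p : N, ∃ (U : TopologicalSpace.Opens (EuclideanSpace ℝ (Fin (2 * k))))
        (K : SasakiTorsion.HermitianStructure (𝓡 (2 * k)) U)
        (σ : SasakiTorsion.TwoForm (𝓡 (2 * k)) U)
        (B : SasakiTorsion.CircleBundle ((𝓡 (2 * k)).prod (𝓡 1)) (U × Circle) (𝓡 (2 * k)) U)
        (S' : SasakiTorsion.STStructure ((𝓡 (2 * k)).prod (𝓡 1)) (U × Circle))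
        (e : OpenPartialHomeomorph N (U × Circle)),
        σ.IsClosed ∧ σ.IsExact ∧ σ.IsOneOne K.J ∧
        B.proj = Prod.fst ∧ (∀ (z : Circle) (x : U × Circle), B.act z x = (x.1, z * x.2)) ∧
        B.IsConnection S'.η ∧ S'.ξ = B.fundamental ∧
        SasakiTorsion.IsCompatible S' K σ B.proj ∧
        p ∈ e.source ∧ SasakiTorsion.IsLocalSTIso S S' e) := by
  refine ⟨?_, ?_, ?_⟩
  · intro k E _ _ _ H _ I _ N _ _ _ _ _ S hd hreg
    have hV : ∀ q, SasakiTorsion.SmoothFieldAt I S.ξ q := fun q => S.smoothFieldAt_ξ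
    have hV0 : ∀ q, S.ξ q ≠ 0 := fun q => S.ξ_ne_zero
    refine ⟨hreg.secondCountable hV hV0, hreg.exists_manifold hV hV0, fun _ _ h => ?_⟩
    exact SasakiTorsion.existsUnique_leafSpace_structure S (by simp [hd]) h
  · intro E _ _ _ H _ I _ M _ _ _ _ _ E' _ _ _ H' _ I' _ N _ _ _ _ _ K σ B η _ hσ hB hη
    exact SasakiTorsion.existsUnique_STStructure (B.isAdapted hB.1) B.surjective_proj K hσ hη
  · intro k E _ _ _ H _ I _ N _ _ _ _ _ S hd p
    obtain ⟨U, K, σ, S', e, h1, h2, h3, h4, h5, h6, h7, h8⟩ :=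
      SasakiTorsion.exists_local_circleBundle S k hd p
    exact ⟨U, K, σ, SasakiTorsion.trivialCircleBundle _ U, S', e, h1, h2, h3, rfl, fun _ _ => rfl,
      h4, h5, h6, h7, h8⟩
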